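/- Let $T>0$ and let $L\ge 1$ be an integer. For $\Gamma\subseteq\{0,\dots,L-1\}^2$ let $$M_\Gamma=\bigcup_{(k,m)\in\Gamma}\big[kT,(k+1)T\big)\times\Big[\tfrac{m}{TL},\tfrac{m+1}{TL}\Big)\subseteq\mathbb R^2 ,$$ a union of cells of area $1/L$ each. To $s\in L^2(\mathbb R^2)$ supported (up to a null set) in some $M_\Gamma$ associate the operator $H$ with spreading function $s_H=s$, $$Hx=\iint s_H(\tau,\nu)\,M_\nu T_\tau x\;d\nu\,d\tau ,\qquad (T_\tau x)(t)=x(t-\tau),\quad (M_\nu x)(t)=e^{2\pi i\nu t}x(t),$$ for tempered distributions $x$ on $\mathbb R$, the integral being understood weakly (against Schwartz functions), and put $\|H\|=\|s_H\|_{L^2(\mathbb R^2)}$. For $\Delta\in\mathbb R$ let $\mathcal X(\Delta)$ be the union, over all $\Gamma$ with $\mathrm{area}(M_\Gamma)\le\Delta$, of the sets of operators with spreading function supported in $M_\Gamma$. A probing signal $x$ stably identifies $\mathcal X(\Delta)$ if $Hx\in L^2(\mathbb R)$ for all $H\in\mathcal X(\Delta)$ and there are constants $0<\alpha\le\beta<\infty$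 with $$\alpha\|H_1-H_2\|\le\|H_1x-H_2x\|_{L^2(\mathbb R)}\le\beta\|H_1-H_2\|\qquad\text{for all }H_1,H_2\in\mathcal X(\Delta);$$ $\mathcal X(\Delta)$ is stably identifiable if some tempered distribution $x$ stably identifies it. (a) Let $L\ge2$ and suppose that, in case $\Delta>1/2$, there is a region $M_\Gamma$ with $1/2<\mathrm{area}(M_\Gamma)\le\Delta$ (this holds in particular if $\Delta>1/2$ is itself the area of some $M_\Gamma$). Then $\mathcal X(\Delta)$ is stably identifiable if and only if $\Delta\le 1/2$. (b) If $\Delta\le 1/2$ (and $L\ge 1$), then $\mathcal X(\Delta)$ is stably identified by a weighted Dirac train $x=\sum_{k\in\mathbb Z}c_k\,\delta(t+kT)$ with some $L$-periodic sequence of complex weights, $c_{k+L}=c_k$. -/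

import Mathlib

open MeasureTheory Set
open scoped SchwartzMap

noncomputable section

namespace OperatorIdentification

/-- The character `t ↦ e^{2πiνt}`. -/
def modChar (ν : ℝ) (t : ℝ) : ℂ :=
  Complex.exp (2 * (Real.pi : ℂ) * Complex.I * (ν : ℂ) * (t : ℂ))

theorem modChar_hasDerivAt (ν t : ℝ) :
    HasDerivAt (modChar ν) ((2 * (Real.pi : ℂ) * Complex.I * (ν : ℂ)) * modChar ν t) t := by
  have h := ((Complex.ofRealCLM.hasDerivAt (x := t)).const_mul
    (2 * (Real.pi : ℂ) * Complex.I * (ν : ℂ))).cexp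
  rw [mul_comm]
  have e : modChar ν = fun u : ℝ =>
      Complex.exp (2 * (Real.pi : ℂ) * Complex.I * (ν : ℂ) * Complex.ofRealCLM u) := rfl
  rw [e]
  simpa using h

theorem modChar_norm (ν t : ℝ) : ‖modChar ν t‖ = 1 := by
  rw [modChar, Complex.norm_exp]
  simp

theorem modChar_iteratedDeriv (ν : ℝ) (n : ℕ) :
    iteratedDeriv n (modChar ν) =
      fun t => (2 * (Real.pi : ℂ) * Complex.I * (ν : ℂ)) ^ n * modChar ν t := by
  induction n with
  | zero => simp
  | succ n ih =>
    rw [iteratedDeriv_succ, ih]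
    funext t
    rw [((modChar_hasDerivAt ν t).const_mul _).deriv]
    ring

/-- Characters have temperate growth, so multiplication by them acts on tempered distributions. -/
theorem modChar_hasTemperateGrowth (ν : ℝ) : (modChar ν).HasTemperateGrowth := by
  refine ⟨?_, fun n => ⟨0, ‖(2 * (Real.pi : ℂ) * Complex.I * (ν : ℂ)) ^ n‖, fun t => ?_⟩⟩
  · have : ContDiff ℝ ((⊤ : ℕ∞) : WithTop ℕ∞) (fun t : ℝ =>
        Complex.exp (2 * (Real.pi : ℂ) * Complex.I * (ν : ℂ) * (t : ℂ))) :=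
      (contDiff_const.mul Complex.ofRealCLM.contDiff).cexp
    exact this
  · rw [norm_iteratedFDeriv_eq_norm_iteratedDeriv, modChar_iteratedDeriv, norm_mul, modChar_norm]
    simp

/-- The translation operator `T_τ`, `(T_τ x)(t) = x(t - τ)`, on tempered distributions:
`⟨T_τ x, φ⟩ = ⟨x, φ(· + τ)⟩`. -/
def translation (τ : ℝ) : 𝓢'(ℝ, ℂ) →L[ℂ] 𝓢'(ℝ, ℂ) :=
  PointwiseConvergenceCLM.precomp ℂ (SchwartzMap.compSubConstCLM ℂ (-τ))

/-- The modulation operator `M_ν`, `(M_ν x)(t) = e^{2πiνt} x(t)`, on tempered distributions. -/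
def modulation (ν : ℝ) : 𝓢'(ℝ, ℂ) →L[ℂ] 𝓢'(ℝ, ℂ) :=
  TemperedDistribution.smulLeftCLM ℂ (modChar ν)

/-- An operator of the class `𝓗` is given by its square-integrable spreading function
`s(τ, ν)`; the norm of the operator is by definition the `L²` norm of its spreading function. -/
abbrev SpreadingFunction : Type := Lp ℂ 2 (volume : Measure (ℝ × ℝ))

/-- The square-integrable output signals. -/
abbrev OutputSignal : Type := Lp ℂ 2 (volume : Measure ℝ)

/-- `y = H x`, where `H` is the operator with spreading function `s`, that is,
`H x = ∫∫ s(τ, ν) M_ν T_τ x d(τ, ν)`. The integral is a weak one: for every Schwartz function `φ`,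
`∫ y φ = ∫∫ s(τ, ν) ⟨M_ν T_τ x, φ⟩ d(τ, ν)`, the right hand side converging absolutely. -/
def IsResponse (s : SpreadingFunction) (x : 𝓢'(ℝ, ℂ)) (y : OutputSignal) : Prop :=
  ∀ φ : 𝓢(ℝ, ℂ),
    Integrable (fun p : ℝ × ℝ => s p * (modulation p.2 (translation p.1 x)) φ) ∧
      ∫ p : ℝ × ℝ, s p * (modulation p.2 (translation p.1 x)) φ = ∫ t : ℝ, y t * φ t

/-- The probing signal `x` stably identifies the set `Q` of operators: it maps all of them to
square-integrable signals, and
`α ‖H₁ - H₂‖ ≤ ‖H₁ x - H₂ x‖ ≤ β ‖H₁ - H₂‖` for all `H₁, H₂ ∈ Q`, with fixed `0 < α ≤ β < ∞`. -/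
def StablyIdentifies (x : 𝓢'(ℝ, ℂ)) (Q : Set SpreadingFunction) : Prop :=
  ∃ α β : ℝ, 0 < α ∧ α ≤ β ∧ ∀ s₁ ∈ Q, ∀ s₂ ∈ Q, ∃ y₁ y₂ : OutputSignal,
    IsResponse s₁ x y₁ ∧ IsResponse s₂ x y₂ ∧
      α * ‖s₁ - s₂‖ ≤ ‖y₁ - y₂‖ ∧ ‖y₁ - y₂‖ ≤ β * ‖s₁ - s₂‖

/-- Some probing signal stably identifies `Q`. -/
def StablyIdentifiable (Q : Set SpreadingFunction) : Prop :=
  ∃ x : 𝓢'(ℝ, ℂ), StablyIdentifies x Q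

/-- The cell `[kT, (k+1)T) × [m/(TL), (m+1)/(TL))` of the `(τ, ν)`-plane. -/
def cell (T : ℝ) (L k m : ℕ) : Set (ℝ × ℝ) :=
  Ico ((k : ℝ) * T) (((k : ℝ) + 1) * T) ×ˢ
    Ico ((m : ℝ) / (T * (L : ℝ))) (((m : ℝ) + 1) / (T * (L : ℝ)))

/-- The support region `M_Γ`, the union of the cells with index in `Γ ⊆ {0, …, L-1}²`. -/
def region (T : ℝ) (L : ℕ) (Γ : Finset (Fin L × Fin L)) : Set (ℝ × ℝ) :=
  ⋃ i ∈ Γ, cell T L i.1 i.2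

/-- The area of `M_Γ`. -/
def area (T : ℝ) (L : ℕ) (Γ : Finset (Fin L × Fin L)) : ℝ :=
  (volume : Measure (ℝ × ℝ)).real (region T L Γ)

/-- The operators whose spreading function is supported in the set `M` (up to a null set). -/
def supportedOperators (M : Set (ℝ × ℝ)) : Set SpreadingFunction :=
  {s | ∀ᵐ p : ℝ × ℝ, p ∉ M → s p = 0}

/-- The set `𝒳(Δ)`: the union, over all `Γ` with `area M_Γ ≤ Δ`, of the operators whose spreading
function is supported in `M_Γ`. -/
def blindOperators (T : ℝ) (L : ℕ) (Δ : ℝ) : Set SpreadingFunction :=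
  ⋃ Γ : Finset (Fin L × Fin L), ⋃ _ : area T L Γ ≤ Δ, supportedOperators (region T L Γ)

/-- The tempered distribution `x` is the weighted Dirac train `∑_{k ∈ ℤ} c_k δ(t + kT)`. -/
def IsDiracTrain (T : ℝ) (c : ℤ → ℂ) (x : 𝓢'(ℝ, ℂ)) : Prop :=
  ∀ φ : 𝓢(ℝ, ℂ), HasSum (fun k : ℤ => c k * φ (-((k : ℝ) * T))) (x φ)

end OperatorIdentification

end

/-! The threshold comes from counting cells. If Δ ≤ 1/2, the difference of two operators of the
class lives on at most L cells. If Δ admits a region of area above 1/2, every operator supported on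
a suitable set of L + 1 cells is such a difference. It remains to show that one Dirac train has
responses comparable to all operators on at most L cells, and that no probing signal achieves this
on L + 1 cells.

Sufficiency. Write t = u + (p + rL)T with 0 ≤ u < T and 0 ≤ p < L. For L-periodic weights, the
response to a Dirac train at these points is, as a sequence in r, a sequence of Fourier coefficients
of a function of η in [0, 1/(TL)). Up to unimodular factors, that function is row p of an L × L²
Gabor matrix G applied to the values of the spreading function at the translates of (u, η) to the L²
cells. Parseval's identity (`lintegral_trainResponse`) turns ‖Hx‖² into an integral of ‖Gv‖², so it
suffices that any L columns of G are independent.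

`exists_window` achieves this with weights z^w(d), w(d) = L²d + d², which make each L × L minor a
polynomial in z. After a cyclic rotation and a sorting, the translations of the chosen columns form
a parking sequence, k i ≤ i. In the coefficient of degree ∑ w(i - k i), the term L²d excludes
permutations that wrap around, and the term d² leaves, by the equality case of the rearrangement
inequality, only those preserving the fibers of k. The coefficient is therefore a determinant with
Vandermonde blocks, which is nonzero (`det_parking_ne_zero`).

Necessity. In each of L + 1 cells place n² atoms: a bump times a character, with characters from a
lattice adapted to a slightly smaller rectangle. They satisfy a lower Riesz bound
(`mul_sum_le_norm_sum_sq`), which the assumed lower estimate transfers to the responses.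
Time-frequency shifts of outputs correspond to shifts of spreading functions, so the upper estimate
localizes each response near its point (a, b) of the time-frequency plane, uniformly in (a, b)
(`exists_isLocalized`). Hence all responses are close to a span of about γn² exponentials on an
interval, with γ < L + 1 (`IsLocalized.exists_approx`). A trace estimate (`card_sub_finrank_mul_le`)
forbids (L + 1)n² vectors with a lower Riesz bound from being that close to so small a space. -/

noncomputable section

namespace OperatorIdentification

section

/-! ### Responses -/

/-- The Schwartz function `t ↦ e^{2πiν(t+τ)} φ(t+τ)`. -/
def shiftedTest (p : ℝ × ℝ) (φ : 𝓢(ℝ, ℂ)) : 𝓢(ℝ, ℂ) :=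
  SchwartzMap.compSubConstCLM ℂ (-p.1) (SchwartzMap.smulLeftCLM ℂ (modChar p.2) φ)

theorem shiftedTest_apply (p : ℝ × ℝ) (φ : 𝓢(ℝ, ℂ)) (t : ℝ) :
    shiftedTest p φ t = modChar p.2 (t + p.1) * φ (t + p.1) := by
  simp [shiftedTest, SchwartzMap.smulLeftCLM_apply_apply (modChar_hasTemperateGrowth p.2)]

theorem modulation_translation_apply (p : ℝ × ℝ) (x : 𝓢'(ℝ, ℂ)) (φ : 𝓢(ℝ, ℂ)) :
    (modulation p.2 (translation p.1 x)) φ = x (shiftedTest p φ) := rfl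

theorem modChar_add_left (ν h t : ℝ) : modChar (ν + h) t = modChar ν t * modChar h t := by
  rw [modChar, modChar, modChar, ← Complex.exp_add]
  push_cast
  ring_nf

theorem modChar_add_right (ν t h : ℝ) : modChar ν (t + h) = modChar ν t * modChar ν h := by
  rw [modChar, modChar, modChar, ← Complex.exp_add]
  push_cast
  ring_nf

theorem modChar_comm (ν t : ℝ) : modChar ν t = modChar t ν := by
  rw [modChar, modChar]
  ring_nf

@[simp] theorem modChar_zero_left (t : ℝ) : modChar 0 t = 1 := by simp [modChar]

theorem modChar_neg_mul_self (ν t : ℝ) : modChar (-ν) t * modChar ν t = 1 := by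
  rw [← modChar_add_left]
  simp

theorem continuous_modChar : Continuous fun p : ℝ × ℝ => modChar p.1 p.2 := by
  unfold modChar
  fun_prop

variable {x : 𝓢'(ℝ, ℂ)} {s s₁ s₂ : SpreadingFunction} {y y₁ y₂ : OutputSignal}

theorem integrable_mul_schwartz (y : OutputSignal) (φ : 𝓢(ℝ, ℂ)) :
    Integrable fun t : ℝ => y t * φ t :=
  (Lp.memLp y).integrable_mul (φ.memLp 2 volume)

/-- The response of an operator to a probing signal is unique. -/
theorem IsResponse.unique (h₁ : IsResponse s x y₁) (h₂ : IsResponse s x y₂) : y₁ = y₂ := by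
  have hinj := LinearMap.ker_eq_bot.1
    (Lp.ker_toTemperedDistributionCLM_eq_bot (F := ℂ) (μ := (volume : Measure ℝ)) (p := 2))
  apply hinj
  ext φ
  have h := (h₁ φ).2.symm.trans (h₂ φ).2
  simpa [Lp.toTemperedDistribution_apply, mul_comm] using h

theorem IsResponse.add (h₁ : IsResponse s₁ x y₁) (h₂ : IsResponse s₂ x y₂) :
    IsResponse (s₁ + s₂) x (y₁ + y₂) := by
  intro φ
  have e : (fun p : ℝ × ℝ => (s₁ + s₂) p * (modulation p.2 (translation p.1 x)) φ) =ᵐ[volume]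
      fun p => s₁ p * (modulation p.2 (translation p.1 x)) φ +
        s₂ p * (modulation p.2 (translation p.1 x)) φ := by
    filter_upwards [Lp.coeFn_add s₁ s₂] with p hp
    rw [hp, Pi.add_apply, add_mul]
  have e' : (fun t : ℝ => (y₁ + y₂) t * φ t) =ᵐ[volume] fun t => y₁ t * φ t + y₂ t * φ t := by
    filter_upwards [Lp.coeFn_add y₁ y₂] with p hp
    rw [hp, Pi.add_apply, add_mul]
  refine ⟨((h₁ φ).1.add (h₂ φ).1).congr e.symm, ?_⟩
  rw [integral_congr_ae e, integral_congr_ae e', integral_add (h₁ φ).1 (h₂ φ).1,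
    integral_add (integrable_mul_schwartz _ _) (integrable_mul_schwartz _ _), (h₁ φ).2, (h₂ φ).2]

theorem IsResponse.const_smul (c : ℂ) (h : IsResponse s x y) : IsResponse (c • s) x (c • y) := by
  intro φ
  have e : (fun p : ℝ × ℝ => (c • s) p * (modulation p.2 (translation p.1 x)) φ) =ᵐ[volume]
      fun p => c * (s p * (modulation p.2 (translation p.1 x)) φ) := by
    filter_upwards [Lp.coeFn_smul c s] with p hp
    rw [hp, Pi.smul_apply, smul_eq_mul, mul_assoc]
  have e' : (fun t : ℝ => (c • y) t * φ t) =ᵐ[volume] fun t => c * (y t * φ t) := by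
    filter_upwards [Lp.coeFn_smul c y] with p hp
    rw [hp, Pi.smul_apply, smul_eq_mul, mul_assoc]
  refine ⟨((h φ).1.const_mul c).congr e.symm, ?_⟩
  rw [integral_congr_ae e, integral_congr_ae e', integral_const_mul, integral_const_mul, (h φ).2]

theorem IsResponse.sub (h₁ : IsResponse s₁ x y₁) (h₂ : IsResponse s₂ x y₂) :
    IsResponse (s₁ - s₂) x (y₁ - y₂) := by
  simpa [sub_eq_add_neg] using h₁.add (h₂.const_smul (-1))

theorem isResponse_zero : IsResponse 0 x 0 := by
  intro φ
  simp

theorem IsResponse.sum {ι : Type*} (F : Finset ι) {s : ι → SpreadingFunction}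
    {y : ι → OutputSignal} (h : ∀ i ∈ F, IsResponse (s i) x (y i)) :
    IsResponse (∑ i ∈ F, s i) x (∑ i ∈ F, y i) := by
  classical
  induction F using Finset.induction_on with
  | empty => simpa using isResponse_zero
  | insert a F ha ih =>
    rw [Finset.sum_insert ha, Finset.sum_insert ha]
    exact (h a (by simp)).add (ih fun i hi => h i (by simp [hi]))

/-- The probing signal `x` maps each operator in `Q` to a square-integrable response whose norm is
comparable to that of the operator. -/
def BoundedResponses (x : 𝓢'(ℝ, ℂ)) (α β : ℝ) (Q : Set SpreadingFunction) : Prop :=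
  ∀ s ∈ Q, ∃ y : OutputSignal, IsResponse s x y ∧ α * ‖s‖ ≤ ‖y‖ ∧ ‖y‖ ≤ β * ‖s‖

/-! ### Cells and regions -/

theorem mem_cell_iff {T : ℝ} (hT : 0 < T) {L : ℕ} (hL : 1 ≤ L) (k m : ℕ) (p : ℝ × ℝ) :
    p ∈ cell T L k m ↔ ⌊p.1 / T⌋ = (k : ℤ) ∧ ⌊p.2 * (T * L)⌋ = (m : ℤ) := by
  have hL' : (0 : ℝ) < L := by exact_mod_cast hL
  have hTL : 0 < T * L := mul_pos hT hL'
  rw [cell, mem_prod, mem_Ico, mem_Ico, Int.floor_eq_iff, Int.floor_eq_iff, le_div_iff₀ hT,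
    div_lt_iff₀ hT, div_le_iff₀ hTL, lt_div_iff₀ hTL]
  simp

theorem measurableSet_cell (T : ℝ) (L k m : ℕ) : MeasurableSet (cell T L k m) :=
  measurableSet_Ico.prod measurableSet_Ico

theorem measurableSet_region (T : ℝ) (L : ℕ) (Γ : Finset (Fin L × Fin L)) :
    MeasurableSet (region T L Γ) :=
  Γ.measurableSet_biUnion fun _ _ => measurableSet_cell _ _ _ _

theorem volume_cell {T : ℝ} (hT : 0 < T) {L : ℕ} (hL : 1 ≤ L) (k m : ℕ) :
    volume (cell T L k m) = ENNReal.ofReal (1 / L) := by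
  have hL' : (0 : ℝ) < L := by exact_mod_cast hL
  rw [cell, Measure.volume_eq_prod, Measure.prod_prod, Real.volume_Ico, Real.volume_Ico,
    ← ENNReal.ofReal_mul (by linarith)]
  congr 1
  field_simp
  ring

theorem cell_disjoint {T : ℝ} (hT : 0 < T) {L : ℕ} (hL : 1 ≤ L) {i j : Fin L × Fin L}
    (hij : i ≠ j) : Disjoint (cell T L i.1 i.2) (cell T L j.1 j.2) := by
  rw [Set.disjoint_left]
  intro p hp hp'
  rw [mem_cell_iff hT hL] at hp hp'
  apply hij
  ext
  · have := hp.1.symm.trans hp'.1; exact_mod_cast this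
  · have := hp.2.symm.trans hp'.2; exact_mod_cast this

theorem area_eq {T : ℝ} (hT : 0 < T) {L : ℕ} (hL : 1 ≤ L) (Γ : Finset (Fin L × Fin L)) :
    area T L Γ = Γ.card / L := by
  have hL' : (0 : ℝ) < L := by exact_mod_cast hL
  rw [area, Measure.real, region, measure_biUnion_finset
    (fun i _ j _ hij => cell_disjoint hT hL hij) (fun _ _ => measurableSet_cell _ _ _ _)]
  simp only [volume_cell hT hL, Finset.sum_const, nsmul_eq_mul, ENNReal.toReal_mul,
    ENNReal.toReal_natCast]
  rw [ENNReal.toReal_ofReal (by positivity)]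
  ring

theorem mem_region {T : ℝ} {L : ℕ} {Γ : Finset (Fin L × Fin L)} {p : ℝ × ℝ} :
    p ∈ region T L Γ ↔ ∃ i ∈ Γ, p ∈ cell T L i.1 i.2 := by
  simp [region]

theorem region_mono {T : ℝ} {L : ℕ} {Γ Γ' : Finset (Fin L × Fin L)} (h : Γ ⊆ Γ') :
    region T L Γ ⊆ region T L Γ' :=
  biUnion_subset_biUnion_left h

theorem region_union {T : ℝ} {L : ℕ} [DecidableEq (Fin L × Fin L)]
    (Γ Γ' : Finset (Fin L × Fin L)) :
    region T L (Γ ∪ Γ') = region T L Γ ∪ region T L Γ' := by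
  ext p
  simp only [mem_region, mem_union, Finset.mem_union]
  constructor
  · rintro ⟨i, hi | hi, h⟩
    exacts [Or.inl ⟨i, hi, h⟩, Or.inr ⟨i, hi, h⟩]
  · rintro (⟨i, hi, h⟩ | ⟨i, hi, h⟩)
    exacts [⟨i, Or.inl hi, h⟩, ⟨i, Or.inr hi, h⟩]

theorem mem_blindOperators {T : ℝ} {L : ℕ} {Δ : ℝ} {s : SpreadingFunction} :
    s ∈ blindOperators T L Δ ↔
      ∃ Γ, area T L Γ ≤ Δ ∧ s ∈ supportedOperators (region T L Γ) := by
  simp [blindOperators]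

theorem sub_mem_supportedOperators {M M₁ M₂ : Set (ℝ × ℝ)} (h₁ : M₁ ⊆ M) (h₂ : M₂ ⊆ M)
    (hs₁ : s₁ ∈ supportedOperators M₁) (hs₂ : s₂ ∈ supportedOperators M₂) :
    s₁ - s₂ ∈ supportedOperators M := by
  rw [supportedOperators, mem_ofPred_eq] at *
  filter_upwards [hs₁, hs₂, Lp.coeFn_sub s₁ s₂] with p hp₁ hp₂ hp hpM
  rw [hp, Pi.sub_apply, hp₁ (fun h => hpM (h₁ h)), hp₂ (fun h => hpM (h₂ h)), sub_zero]

/-- If operators supported on at most `L` cells have comparable responses, then operators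
supported on at most `L / 2` cells are stably identified. -/
theorem stablyIdentifies_blindOperators {T : ℝ} (hT : 0 < T) {L : ℕ} (hL : 1 ≤ L) {Δ α β : ℝ}
    (hΔ : Δ ≤ 1 / 2) (hα : 0 < α) (hαβ : α ≤ β)
    (h : ∀ Γ : Finset (Fin L × Fin L), Γ.card ≤ L →
      BoundedResponses x α β (supportedOperators (region T L Γ))) :
    StablyIdentifies x (blindOperators T L Δ) := by
  classical
  have hL' : (0 : ℝ) < L := by exact_mod_cast hL
  have hcard : ∀ Γ : Finset (Fin L × Fin L), area T L Γ ≤ Δ → 2 * Γ.card ≤ L := by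
    intro Γ hΓ
    rw [area_eq hT hL, div_le_iff₀ hL'] at hΓ
    have : (2 : ℝ) * Γ.card ≤ L := by nlinarith
    exact_mod_cast this
  refine ⟨α, β, hα, hαβ, fun s₁ hs₁ s₂ hs₂ => ?_⟩
  obtain ⟨Γ₁, hΓ₁, hs₁⟩ := mem_blindOperators.1 hs₁
  obtain ⟨Γ₂, hΓ₂, hs₂⟩ := mem_blindOperators.1 hs₂
  have c₁ := hcard Γ₁ hΓ₁
  have c₂ := hcard Γ₂ hΓ₂
  obtain ⟨y₁, hy₁, -⟩ := h Γ₁ (by omega) s₁ hs₁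
  obtain ⟨y₂, hy₂, -⟩ := h Γ₂ (by omega) s₂ hs₂
  -- The hypothesis is needed on the union: the difference occupies up to twice as many cells as
  -- either operator, whence the threshold 1/2.
  obtain ⟨y, hy, hb⟩ := h (Γ₁ ∪ Γ₂) ((Finset.card_union_le _ _).trans (by omega)) (s₁ - s₂)
    (sub_mem_supportedOperators (region_mono Finset.subset_union_left)
      (region_mono Finset.subset_union_right) hs₁ hs₂)
  rw [hy.unique (hy₁.sub hy₂)] at hb
  exact ⟨y₁, y₂, hy₁, hy₂, hb⟩

/-- The restriction of a spreading function to a measurable set. -/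
def restrictTo {M : Set (ℝ × ℝ)} (hM : MeasurableSet M) (s : SpreadingFunction) :
    SpreadingFunction :=
  ((Lp.memLp s).indicator hM).toLp _

theorem coeFn_restrictTo {M : Set (ℝ × ℝ)} (hM : MeasurableSet M) (s : SpreadingFunction) :
    restrictTo hM s =ᵐ[volume] M.indicator s :=
  MemLp.coeFn_toLp _

/-- If `𝒳(Δ)` is stably identified and contains regions of area more than `1/2`, then the
operators supported on some `L + 1` cells have comparable responses. -/
theorem boundedResponses_of_stablyIdentifies {T : ℝ} (hT : 0 < T) {L : ℕ} (hL : 2 ≤ L) {Δ : ℝ}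
    {Γ : Finset (Fin L × Fin L)} (hΓ : 1 / 2 < area T L Γ) (hΓΔ : area T L Γ ≤ Δ)
    (hx : StablyIdentifies x (blindOperators T L Δ)) :
    ∃ (α β : ℝ) (U : Finset (Fin L × Fin L)), 0 < α ∧ 0 < β ∧ U.card = L + 1 ∧
      BoundedResponses x α β (supportedOperators (region T L U)) := by
  classical
  have hL1 : 1 ≤ L := by omega
  have hL' : (0 : ℝ) < L := by exact_mod_cast hL1
  obtain ⟨α, β, hα, hαβ, h⟩ := hx
  have hcard : L + 1 ≤ 2 * Γ.card := by
    rw [area_eq hT hL1, lt_div_iff₀ hL'] at hΓ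
    have : (L : ℝ) < 2 * Γ.card := by linarith
    exact_mod_cast this
  have harea : ∀ Γ' : Finset (Fin L × Fin L), Γ'.card ≤ Γ.card → area T L Γ' ≤ Δ := by
    intro Γ' h'
    refine le_trans ?_ hΓΔ
    rw [area_eq hT hL1, area_eq hT hL1]
    gcongr
  -- Here 2 ≤ L enters, through L + 1 ≤ L²; for L = 1 there is only one cell.
  obtain ⟨U, -, hU⟩ := Finset.exists_subset_card_eq
    (s := (Finset.univ : Finset (Fin L × Fin L))) (n := L + 1) (by simp; nlinarith)
  -- The minimum covers the case where Γ has more than L + 1 cells. Since L + 1 ≤ 2|Γ|, the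
  -- remainder of U is also no larger than Γ.
  obtain ⟨Γ₁, hΓ₁, hc₁⟩ := Finset.exists_subset_card_eq (s := U) (n := min Γ.card (L + 1))
    (by omega)
  have hc₂ : (U \ Γ₁).card ≤ Γ.card := by
    rw [Finset.card_sdiff_of_subset hΓ₁]
    omega
  refine ⟨α, β, U, hα, hα.trans_le hαβ, hU, fun s hs => ?_⟩
  set M := region T L Γ₁
  have hM : MeasurableSet M := measurableSet_region _ _ _
  -- Stability compares two members of the class, so the two pieces of s are presented as a
  -- difference.
  have hd : s = restrictTo hM s - -restrictTo hM.compl s := by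
    apply Lp.ext
    filter_upwards [coeFn_restrictTo hM s, coeFn_restrictTo hM.compl s,
      Lp.coeFn_add (restrictTo hM s) (restrictTo hM.compl s)] with p h₁ h₂ h₃
    rw [sub_neg_eq_add, h₃, Pi.add_apply, h₁, h₂]
    by_cases hp : p ∈ M <;> simp [hp]
  have m₁ : restrictTo hM s ∈ blindOperators T L Δ := by
    refine mem_blindOperators.2 ⟨Γ₁, harea _ (by omega), ?_⟩
    rw [supportedOperators, mem_ofPred_eq]
    filter_upwards [coeFn_restrictTo hM s] with p h₁ hp
    rw [h₁, indicator_of_notMem hp]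
  have m₂ : -restrictTo hM.compl s ∈ blindOperators T L Δ := by
    refine mem_blindOperators.2 ⟨U \ Γ₁, harea _ hc₂, ?_⟩
    rw [supportedOperators, mem_ofPred_eq] at hs ⊢
    filter_upwards [coeFn_restrictTo hM.compl s, hs, Lp.coeFn_neg (restrictTo hM.compl s)]
      with p h₁ h₂ h₃ hp
    rw [h₃, Pi.neg_apply, h₁, neg_eq_zero]
    by_cases hpM : p ∈ M
    · simp [hpM]
    · rw [indicator_of_mem hpM]
      apply h₂
      rw [← Finset.union_sdiff_of_subset hΓ₁, region_union]
      rintro (h' | h')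
      exacts [hpM h', hp h']
  obtain ⟨y₁, y₂, hy₁, hy₂, hb⟩ := h _ m₁ _ m₂
  have hy := hy₁.sub hy₂
  rw [← hd] at hb hy
  exact ⟨_, hy, hb⟩

end

/-! ### Gabor systems in general position -/

/-- The exponents of the window of the Gabor system. -/
def windowExponent (L d : ℕ) : ℕ := L ^ 2 * d + d ^ 2

/-- A permutation of `0, …, L - 1` whose cyclic distances to a parking sequence `k` have the same
total weight as those of the identity preserves the fibers of `k`. -/
theorem comp_perm_eq_of_sum_windowExponent {L : ℕ} {k : Fin L → ℕ} (hk : Monotone k)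
    (hki : ∀ i, k i ≤ i) (σ : Equiv.Perm (Fin L))
    (h : ∑ i, windowExponent L ((σ i + L - k i) % L) = ∑ i : Fin L, windowExponent L (i - k i)) :
    ∀ i, k (σ i) = k i := by
  -- ε marks the indices at which the cyclic distance wraps around modulo L.
  set ε : Fin L → ℕ := fun i => if (σ i : ℕ) < k i then 1 else 0 with hε
  set d : Fin L → ℕ := fun i => (σ i + L - k i) % L with hd
  have hdi : ∀ i, d i + k i = σ i + L * ε i := by
    intro i
    have h1 := hki i
    have h2 := (σ i).2
    have h3 := i.2
    simp only [hd, hε]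
    split_ifs with h4
    · rw [Nat.mod_eq_of_lt (by omega)]; omega
    · rw [show (σ i : ℕ) + L - k i = (σ i - k i) + L by omega, Nat.add_mod_right,
        Nat.mod_eq_of_lt (by omega)]; omega
  have hsum : ∑ i, d i = ∑ i : Fin L, ((i : ℕ) - k i) + L * ∑ i, ε i := by
    have e1 : ∑ i, d i + ∑ i, k i = ∑ i : Fin L, (i : ℕ) + L * ∑ i, ε i := by
      rw [← Finset.sum_add_distrib, Finset.sum_congr rfl fun i _ => hdi i,
        Finset.sum_add_distrib, Finset.mul_sum]
      congr 1
      exact Equiv.sum_comp σ fun i : Fin L => (i : ℕ)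
    have e2 : ∑ i : Fin L, ((i : ℕ) - k i) + ∑ i, k i = ∑ i : Fin L, (i : ℕ) := by
      rw [← Finset.sum_add_distrib]
      exact Finset.sum_congr rfl fun i _ => Nat.sub_add_cancel (hki i)
    omega
  have hsq : L ^ 3 * ∑ i, ε i + ∑ i, d i ^ 2 = ∑ i : Fin L, ((i : ℕ) - k i) ^ 2 := by
    simp only [windowExponent, Finset.sum_add_distrib, ← Finset.mul_sum] at h
    change L ^ 2 * ∑ i, d i + ∑ i, d i ^ 2 = _ at h
    rw [hsum] at h
    have : L ^ 3 * ∑ i, ε i = L ^ 2 * (L * ∑ i, ε i) := by ring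
    rw [this]
    rw [mul_add] at h
    omega
  -- A single wrap would contribute L³ to the left side of `hsq`, while the L squares on its right
  -- are each below L².
  have hε0 : ∀ i, ε i = 0 := by
    by_contra! hne
    obtain ⟨i₀, hi₀⟩ := hne
    have h1 : 1 ≤ ∑ i, ε i :=
      (Nat.one_le_iff_ne_zero.2 hi₀).trans (Finset.single_le_sum (fun _ _ => Nat.zero_le _)
        (Finset.mem_univ i₀))
    have h2 : ∑ i : Fin L, ((i : ℕ) - k i) ^ 2 < ∑ _i : Fin L, L ^ 2 := by
      refine Finset.sum_lt_sum_of_nonempty ⟨i₀, Finset.mem_univ _⟩ fun i _ => ?_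
      have := i.2
      exact Nat.pow_lt_pow_left (by omega) (by norm_num)
    simp only [Finset.sum_const, Finset.card_univ, Fintype.card_fin, smul_eq_mul] at h2
    nlinarith [Nat.zero_le (L ^ 3), Nat.zero_le (∑ i, d i ^ 2), Nat.mul_le_mul_left (L ^ 3) h1]
  have hcross : ∑ i, (k i : ℤ) * ((fun j : Fin L => (j : ℤ)) (σ i)) =
      ∑ i : Fin L, (k i : ℤ) * ((fun j : Fin L => (j : ℤ)) i) := by
    simp only [hε0, Finset.sum_const_zero, mul_zero, zero_add] at hsq
    have e1 : ∀ i, (d i : ℤ) ^ 2 = (σ i : ℤ) ^ 2 - 2 * (k i * (σ i : ℤ)) + (k i : ℤ) ^ 2 := by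
      intro i
      have := hdi i
      rw [hε0, mul_zero, add_zero] at this
      have : (d i : ℤ) = σ i - k i := by omega
      rw [this]
      ring
    have e2 : ∀ i : Fin L, (((i : ℕ) - k i : ℕ) : ℤ) ^ 2 =
        (i : ℤ) ^ 2 - 2 * (k i * (i : ℤ)) + (k i : ℤ) ^ 2 := by
      intro i
      rw [Nat.cast_sub (hki i)]
      ring
    have e3 : ∑ i, (d i : ℤ) ^ 2 = ∑ i : Fin L, (((i : ℕ) - k i : ℕ) : ℤ) ^ 2 := by
      exact_mod_cast hsq
    simp only [e1, e2, Finset.sum_add_distrib, Finset.sum_sub_distrib, ← Finset.mul_sum] at e3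
    have e4 : ∑ i, (σ i : ℤ) ^ 2 = ∑ i : Fin L, (i : ℤ) ^ 2 :=
      Equiv.sum_comp σ fun i : Fin L => (i : ℤ) ^ 2
    linarith
  have hmono : Monovary (fun i => (k i : ℤ)) (fun j : Fin L => (j : ℤ)) := by
    intro i j hij
    have hij' : i ≤ j := by
      have : (i : ℤ) < j := hij
      exact Fin.le_def.2 (by omega)
    exact Int.ofNat_le.2 (hk hij')
  -- Equality in the rearrangement inequality: k varies monotonically with σ, so k ∘ σ⁻¹ is a
  -- monotone rearrangement of the monotone k and equals it.
  have hmv := hmono.sum_mul_comp_perm_eq_sum_mul_iff.1 hcross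
  have hm' : Monotone (k ∘ ((σ⁻¹ : Equiv.Perm (Fin L)) : Fin L → Fin L)) := by
    intro a b hab
    rcases hab.eq_or_lt with rfl | hlt
    · exact le_rfl
    have := @hmv (σ⁻¹ a) (σ⁻¹ b) (by simpa using hlt)
    exact Int.ofNat_le.1 this
  have heq := Tuple.unique_monotone (σ := σ⁻¹) (τ := 1) (f := k) hm' (by simpa using hk)
  intro i
  have := congr_fun heq (σ i)
  simpa using this.symm

/-- The block diagonal matrix whose blocks are given by the fibers of a monotone sequence `k`, and
whose entries are powers of nodes that are distinct within each block, is regular. -/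
theorem det_block_pow_ne_zero {L : ℕ} {k : Fin L → ℕ} (hk : Monotone k) {μ : Fin L → ℂ}
    (hμ0 : ∀ i, μ i ≠ 0) (hμ : ∀ i j, k i = k j → μ i = μ j → i = j) :
    (Matrix.of fun i j : Fin L => if k i = k j then μ i ^ (j : ℕ) else 0).det ≠ 0 := by
  classical
  intro hdet
  obtain ⟨v, hv, hMv⟩ := Matrix.exists_mulVec_eq_zero_iff.2 hdet
  obtain ⟨i₀, hi₀⟩ := Function.ne_iff.1 hv
  set B : Finset (Fin L) := Finset.univ.filter fun j => k j = k i₀ with hB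
  have hmemB : ∀ j, j ∈ B ↔ k j = k i₀ := by simp [hB]
  have hne : B.Nonempty := ⟨i₀, by simp [hB]⟩
  set m := B.min' hne with hm
  have hmB : k m = k i₀ := (hmemB _).1 (B.min'_mem hne)
  have hlt : ∀ j ∈ B, (j : ℕ) - m < B.card := by
    intro j hj
    have hmj : m ≤ j := B.min'_le j hj
    -- Monotonicity makes each fiber of k an interval of indices, so the exponents in a block are
    -- consecutive.
    have hsub : Finset.Icc m j ⊆ B := by
      intro l hl
      rw [Finset.mem_Icc] at hl
      rw [hmemB]
      exact le_antisymm ((hk hl.2).trans_eq ((hmemB j).1 hj)) (hmB.symm.trans_le (hk hl.1))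
    have := Finset.card_le_card hsub
    rw [Fin.card_Icc] at this
    have : (m : ℕ) ≤ j := hmj
    omega
  -- The Vandermonde argument: after the factor μ^m is removed, a kernel vector gives a polynomial
  -- of degree below |B| vanishing at the |B| distinct nodes of the block.
  set Q : Polynomial ℂ := ∑ j ∈ B, Polynomial.C (v j) * Polynomial.X ^ ((j : ℕ) - m) with hQ
  have hdeg : Q.natDegree < B.card := by
    have hpos : 0 < B.card := hne.card_pos
    have : Q.natDegree ≤ B.card - 1 :=
      Polynomial.natDegree_sum_le_of_forall_le _ _ fun j hj =>
        (Polynomial.natDegree_C_mul_X_pow_le _ _).trans (by have := hlt j hj; omega)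
    omega
  have hroot : ∀ z ∈ B.image μ, Q.eval z = 0 := by
    intro z hz
    obtain ⟨i, hi, rfl⟩ := Finset.mem_image.1 hz
    have h1 := congr_fun hMv i
    rw [Matrix.mulVec, dotProduct] at h1
    simp only [Matrix.of_apply, Pi.zero_apply, ite_mul, zero_mul] at h1
    have h2 : ∑ j ∈ B, μ i ^ (j : ℕ) * v j = 0 := by
      rw [← h1, ← Finset.sum_filter]
      refine Finset.sum_congr ?_ fun _ _ => rfl
      ext j
      simp [hB, (hmemB i).1 hi, eq_comm]
    have h3 : μ i ^ (m : ℕ) * Q.eval (μ i) = 0 := by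
      rw [← h2, hQ, Polynomial.eval_finsetSum, Finset.mul_sum]
      refine Finset.sum_congr rfl fun j hj => ?_
      have hmj : (m : ℕ) ≤ j := B.min'_le j hj
      simp only [Polynomial.eval_mul, Polynomial.eval_C, Polynomial.eval_pow, Polynomial.eval_X]
      rw [mul_left_comm, ← pow_add, Nat.add_sub_cancel' hmj, mul_comm]
    exact (mul_eq_zero.1 h3).resolve_left (pow_ne_zero _ (hμ0 i))
  have hcard : (B.image μ).card = B.card := by
    refine Finset.card_image_of_injOn fun i hi j hj hij => hμ i j ?_ hij
    rw [(hmemB i).1 hi, (hmemB j).1 hj]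
  have hQ0 : Q = 0 := Polynomial.eq_zero_of_natDegree_lt_card_of_eval_eq_zero' Q (B.image μ)
    hroot (hcard ▸ hdeg)
  apply hi₀
  have hc : Q.coeff ((i₀ : ℕ) - m) = v i₀ := by
    rw [hQ, Polynomial.finsetSum_coeff, Finset.sum_eq_single i₀]
    · simp
    · intro j hj hne'
      have hmj : (m : ℕ) ≤ j := B.min'_le j hj
      have hmi : (m : ℕ) ≤ i₀ := B.min'_le i₀ (by simp [hB])
      rw [Polynomial.coeff_C_mul, Polynomial.coeff_X_pow, if_neg, mul_zero]
      intro he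
      exact hne' (Fin.ext (by omega))
    · simp [hB]
  rw [← hc, hQ0]
  simp

/-- The Gabor determinant attached to a parking sequence of translations is a nonzero polynomial. -/
theorem det_parking_ne_zero {L : ℕ} {k : Fin L → ℕ} (hk : Monotone k) (hki : ∀ i, k i ≤ i)
    {μ : Fin L → ℂ} (hμ0 : ∀ i, μ i ≠ 0) (hμ : ∀ i j, k i = k j → μ i = μ j → i = j) :
    (Matrix.of fun j i : Fin L => Polynomial.C (μ i ^ (j : ℕ)) *
      (Polynomial.X : Polynomial ℂ) ^ windowExponent L ((j + L - k i) % L)).det ≠ 0 := by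
  intro h0
  -- The degree is the weight of the identity permutation; the coefficient collects exactly the
  -- fiber-preserving permutations and so is the block determinant.
  have hc := congr_arg
    (fun P : Polynomial ℂ => P.coeff (∑ i : Fin L, windowExponent L (i - k i))) h0
  simp only [Polynomial.coeff_zero] at hc
  refine det_block_pow_ne_zero hk hμ0 hμ ?_
  refine Eq.trans ?_ hc
  rw [← Matrix.det_transpose, Matrix.det_apply', Matrix.det_apply',
    Polynomial.finsetSum_coeff]
  refine Finset.sum_congr rfl fun σ _ => ?_
  simp only [Matrix.transpose_apply, Matrix.of_apply]
  rw [Finset.prod_mul_distrib, Finset.prod_pow_eq_pow_sum, ← map_prod, ← mul_assoc,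
    ← Polynomial.C_eq_intCast, ← map_mul, Polynomial.coeff_C_mul, Polynomial.coeff_X_pow]
  split_ifs with hσ
  · have := comp_perm_eq_of_sum_windowExponent hk hki σ hσ.symm
    simp [this]
  · rw [mul_zero]
    -- Conversely, a fiber-preserving σ merely permutes the numbers i - k i, so it has the weight of
    -- the identity.
    by_contra hne
    refine hσ ?_
    have hall : ∀ i, k (σ i) = k i := by
      intro i
      by_contra hi
      apply hne
      rw [Finset.prod_eq_zero (Finset.mem_univ i), mul_zero]
      rw [if_neg (fun h => hi h.symm)]
    rw [← Equiv.sum_comp σ]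
    refine Finset.sum_congr rfl fun i _ => ?_
    have h1 := hki (σ i)
    have h2 := (σ i).2
    rw [← hall i, show (σ i : ℕ) + L - k (σ i) = (σ i - k (σ i)) + L by omega, Nat.add_mod_right,
      Nat.mod_eq_of_lt (by omega)]

/-- The cycle lemma: a sequence of `L` residues modulo `L` becomes a parking sequence after a
rotation and a permutation. -/
theorem exists_rotation_parking {L : ℕ} (hL : 1 ≤ L) (q : Fin L → Fin L) :
    ∃ (a : Fin L) (π : Equiv.Perm (Fin L)),
      Monotone (fun i => ((q (π i) : ℕ) + L - a) % L) ∧ ∀ i, ((q (π i) : ℕ) + L - a) % L ≤ i := by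
  have : NeZero L := ⟨by omega⟩
  set N : ℕ → ℤ := fun r => ∑ i, if (q i : ℕ) < r then 1 else 0 with hN
  -- N r counts the residues below r. Started at a minimum of the walk N r - r, every cyclic window
  -- of length r contains at least r of the residues.
  obtain ⟨a, ha⟩ := Finite.exists_min fun r : Fin L => N r - r
  set k : Fin L → ℕ := fun i => ((q i : ℕ) + L - a) % L with hk
  have ha0 : N a - a ≤ 0 := by
    have := ha 0
    simpa [hN] using this
  have hNL : N L = L := by simp [hN]
  have hkcase : ∀ i, ((a : ℕ) ≤ q i ∧ k i + a = q i) ∨ ((q i : ℕ) < a ∧ k i + a = q i + L) := by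
    intro i
    have h1 := (q i).2
    have h2 := a.2
    simp only [hk]
    by_cases h : (a : ℕ) ≤ q i
    · left
      rw [show (q i : ℕ) + L - a = (q i - a) + L by omega, Nat.add_mod_right,
        Nat.mod_eq_of_lt (by omega)]
      omega
    · right
      rw [Nat.mod_eq_of_lt (by omega)]
      omega
  have hcount : ∀ r : ℕ, r ≤ L → (r : ℤ) ≤ ∑ i, if k i < r then 1 else 0 := by
    intro r hr
    rcases le_or_gt ((a : ℕ) + r) L with h | h
    · have e : ∑ i, (if k i < r then (1 : ℤ) else 0) = N (a + r) - N a := by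
        rw [hN, ← Finset.sum_sub_distrib]
        refine Finset.sum_congr rfl fun i _ => ?_
        have := hkcase i
        have := (q i).2
        split_ifs <;> omega
      rw [e]
      rcases h.eq_or_lt with h | h
      · rw [h, hNL]
        omega
      · have := ha ⟨a + r, h⟩
        simp only at this
        push_cast at this
        omega
    · have e : ∑ i, (if k i < r then (1 : ℤ) else 0) = N L - N a + N (a + r - L) := by
        rw [hN, ← Finset.sum_sub_distrib, ← Finset.sum_add_distrib]
        refine Finset.sum_congr rfl fun i _ => ?_
        have := hkcase i
        have := (q i).2
        split_ifs <;> omega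
      rw [e, hNL]
      have h2 := a.2
      have := ha ⟨a + r - L, by omega⟩
      simp only at this
      omega
  refine ⟨a, Tuple.sort k, Tuple.monotone_sort k, fun i => ?_⟩
  change k (Tuple.sort k i) ≤ i
  -- If the sorted value at i exceeded i, only the indices before i could have values at most i,
  -- against `hcount (i + 1)`.
  by_contra! hlt
  have h1 := hcount (i + 1) i.2
  rw [← Equiv.sum_comp (Tuple.sort k)] at h1
  have h2 : ∑ j, (if k (Tuple.sort k j) < (i : ℕ) + 1 then (1 : ℤ) else 0) ≤
      ∑ j, if j ∈ Finset.Iio i then 1 else 0 := by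
    refine Finset.sum_le_sum fun j _ => ?_
    by_cases hj : j < i
    · simp only [Finset.mem_Iio, hj, if_true]
      split_ifs <;> norm_num
    · have := Tuple.monotone_sort k (not_lt.1 hj)
      simp only [Function.comp_apply] at this
      rw [if_neg (by omega), if_neg (by simpa using hj)]
  rw [Finset.sum_ite_mem, Finset.univ_inter, Finset.sum_const, Fin.card_Iio] at h2
  push_cast at h1
  simp only [nsmul_eq_mul, mul_one] at h2
  omega

/-! ### Gabor determinants and the choice of the window -/

/-- The primitive root of unity `e^{2πi/L}`. -/
def rootOfUnity (L : ℕ) : ℂ := Complex.exp (2 * Real.pi * Complex.I / L)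

theorem isPrimitiveRoot_rootOfUnity {L : ℕ} (hL : 1 ≤ L) : IsPrimitiveRoot (rootOfUnity L) L :=
  Complex.isPrimitiveRoot_exp L (by omega)

/-- Every Gabor determinant with monomial window is a nonzero polynomial. -/
theorem det_gabor_ne_zero {L : ℕ} (hL : 1 ≤ L) (l : Fin L → Fin L × Fin L)
    (hl : Function.Injective l) :
    (Matrix.of fun p i : Fin L => Polynomial.C (rootOfUnity L ^ (((l i).2 : ℕ) * p)) *
      (Polynomial.X : Polynomial ℂ) ^ windowExponent L ((p + L - (l i).1) % L)).det ≠ 0 := by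
  have : NeZero L := ⟨by omega⟩
  have hω := isPrimitiveRoot_rootOfUnity hL
  have hω0 : rootOfUnity L ≠ 0 := hω.ne_zero (by omega)
  obtain ⟨a, π, hmono, hpark⟩ := exists_rotation_parking hL fun i => (l i).1
  set k : Fin L → ℕ := fun i => (((l (π i)).1 : ℕ) + L - a) % L with hk
  set μ : Fin L → ℂ := fun i => rootOfUnity L ^ ((l (π i)).2 : ℕ) with hμ
  have hmod : ∀ m n : ℕ, rootOfUnity L ^ (m * (n % L)) = rootOfUnity L ^ (m * n) := by
    intro m n
    conv_rhs => rw [← Nat.mod_add_div n L, mul_add, pow_add, mul_left_comm, pow_mul _ L,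
      hω.pow_eq_one, one_pow, mul_one]
  have key := det_parking_ne_zero hmono hpark (μ := μ) (fun i => pow_ne_zero _ hω0) (by
    intro i j hij hμij
    apply π.injective
    apply hl
    ext
    · have h1 := (l (π i)).1.2
      have h2 := (l (π j)).1.2
      have h3 := a.2
      have h4 : ((l (π i)).1 + (L - a)) % L = ((l (π j)).1 + (L - a)) % L := by
        rw [← Nat.add_sub_assoc h3.le, ← Nat.add_sub_assoc h3.le]
        exact hij
      have h5 : ((l (π i)).1 : ℕ) ≡ (l (π j)).1 [MOD L] := Nat.ModEq.add_right_cancel' _ h4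
      exact Nat.ModEq.eq_of_lt_of_lt h5 h1 h2
    · exact hω.pow_inj (l (π i)).2.2 (l (π j)).2.2 hμij)
  intro h0
  apply key
  set M := (Matrix.of fun p i : Fin L => Polynomial.C (rootOfUnity L ^ (((l i).2 : ℕ) * p)) *
      (Polynomial.X : Polynomial ℂ) ^ windowExponent L ((p + L - (l i).1) % L)) with hM
  -- Rotating the rows by a and permuting the columns by π changes the determinant only by signs;
  -- the result is the parking matrix with columns scaled by the units μ i ^ a.
  have hsub : ((M.submatrix (Equiv.addRight a) id).submatrix id π).det = 0 := by
    rw [Matrix.det_permute', Matrix.det_permute, h0, mul_zero, mul_zero]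
  have hfac : (M.submatrix (Equiv.addRight a) id).submatrix id π =
      Matrix.of fun j i => Polynomial.C (μ i ^ (a : ℕ)) *
        (Matrix.of fun j i : Fin L => Polynomial.C (μ i ^ (j : ℕ)) *
      (Polynomial.X : Polynomial ℂ) ^ windowExponent L ((j + L - k i) % L)) j i := by
    ext1 j i
    simp only [hM, Matrix.submatrix_apply, id, Matrix.of_apply, Equiv.coe_addRight]
    rw [← mul_assoc, ← map_mul, Fin.val_add]
    congr 2
    · simp only [hμ]
      rw [hmod, ← pow_mul, ← pow_mul, ← pow_add, ← mul_add, add_comm (a : ℕ) j]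
    · have h1 := j.2
      have h2 := a.2
      have h3 := (l (π i)).1.2
      have hA : (j + a : ℕ) % L = j + a ∨ (j + a : ℕ) % L + L = j + a := by
        rcases lt_or_ge (j + a : ℕ) L with h | h
        · exact Or.inl (Nat.mod_eq_of_lt h)
        · right
          rw [Nat.mod_eq_sub_mod h, Nat.mod_eq_of_lt (by omega)]
          omega
      have hK : k i + a = (l (π i)).1 ∨ k i + a = (l (π i)).1 + L := by
        simp only [hk]
        rcases lt_or_ge ((l (π i)).1 : ℕ) a with h | h
        · right
          rw [Nat.mod_eq_of_lt (by omega)]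
          omega
        · left
          rw [show ((l (π i)).1 : ℕ) + L - a = ((l (π i)).1 - a) + L by omega, Nat.add_mod_right,
            Nat.mod_eq_of_lt (by omega)]
          omega
      have hKL : k i < L := Nat.mod_lt _ (by omega)
      have hAL : (j + a : ℕ) % L < L := Nat.mod_lt _ (by omega)
      generalize (j + a : ℕ) % L = A at *
      congr 1
      rcases hA with hA | hA <;> rcases hK with hK | hK
      · congr 1; omega
      · rw [show A + L - (l (π i)).1 = (j + L - k i) + L by omega, Nat.add_mod_right]
      · rw [show (j + L - k i : ℕ) = (A + L - (l (π i)).1) + L by omega, Nat.add_mod_right]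
      · congr 1; omega
  rw [hfac, Matrix.det_mul_row] at hsub
  refine (mul_eq_zero.1 hsub).resolve_left (Finset.prod_ne_zero_iff.2 fun i _ => ?_)
  rw [Ne, Polynomial.C_eq_zero]
  exact pow_ne_zero _ (pow_ne_zero _ hω0)

/-- The entry of the Gabor matrix in row `p` and column `(q, m)`. -/
def gaborEntry (L : ℕ) (c : ℤ → ℂ) (p : Fin L) (i : Fin L × Fin L) : ℂ :=
  c ((i.1 : ℤ) - p) * rootOfUnity L ^ ((i.2 : ℕ) * p)

/-- There is an `L`-periodic window such that any `L` columns of the Gabor matrix are linearly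
independent. -/
theorem exists_window {L : ℕ} (hL : 1 ≤ L) : ∃ c : ℤ → ℂ, (∀ k, c (k + L) = c k) ∧
    ∀ Γ : Finset (Fin L × Fin L), Γ.card ≤ L → ∀ v : Fin L × Fin L → ℂ, (∀ i ∉ Γ, v i = 0) →
      (∀ p, ∑ i, gaborEntry L c p i * v i = 0) → v = 0 := by
  classical
  set D : (Fin L → Fin L × Fin L) → Polynomial ℂ := fun l =>
    (Matrix.of fun p i : Fin L => Polynomial.C (rootOfUnity L ^ (((l i).2 : ℕ) * p)) *
      (Polynomial.X : Polynomial ℂ) ^ windowExponent L ((p + L - (l i).1) % L)).det with hD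
  -- There are finitely many minors, so a non-root of the product of their polynomials serves all of
  -- them at once.
  have hP : ∏ l ∈ Finset.univ.filter (fun l : Fin L → Fin L × Fin L => Function.Injective l),
      D l ≠ 0 :=
    Finset.prod_ne_zero_iff.2 fun l hl => det_gabor_ne_zero hL l (Finset.mem_filter.1 hl).2
  obtain ⟨z, hz⟩ : ∃ z, (∏ l ∈ Finset.univ.filter
      (fun l : Fin L → Fin L × Fin L => Function.Injective l), D l).eval z ≠ 0 := by
    by_contra! h
    exact hP (Polynomial.funext fun r => by simpa using h r)
  rw [Polynomial.eval_prod, Finset.prod_ne_zero_iff] at hz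
  -- The sign is reversed because `gaborEntry` evaluates c at q - p, while the polynomial matrix
  -- uses the cyclic distance p - q.
  set c : ℤ → ℂ := fun k => z ^ windowExponent L ((-k) % L).toNat with hc
  refine ⟨c, fun k => ?_, fun Γ hΓ v hv hsum => ?_⟩
  · simp only [hc]
    rw [show -(k + (L : ℤ)) = -k + L * (-1) by ring, Int.add_mul_emod_self_left]
  obtain ⟨Γ', hΓ', hcard⟩ := Finset.exists_superset_card_eq hΓ (by simp; nlinarith)
  let e : Fin L ≃ Γ' := (Γ'.equivFinOfCardEq hcard).symm
  set l : Fin L → Fin L × Fin L := fun i => (e i : Fin L × Fin L) with hl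
  have hinj : Function.Injective l := Subtype.val_injective.comp e.injective
  have hdet := hz l (by simp [hinj])
  rw [hD, ← Polynomial.coe_evalRingHom, RingHom.map_det] at hdet
  have hker : (fun i => v (l i)) = 0 := by
    by_contra hne
    refine hdet (Matrix.exists_mulVec_eq_zero_iff.1 ⟨fun i => v (l i), hne, ?_⟩)
    ext p
    rw [Pi.zero_apply, ← hsum p, Matrix.mulVec, dotProduct]
    have hsub : ∑ i, gaborEntry L c p i * v i = ∑ i ∈ Γ', gaborEntry L c p i * v i := by
      refine (Finset.sum_subset (Finset.subset_univ _) fun i _ hi => ?_).symm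
      rw [hv i fun h => hi (hΓ' h), mul_zero]
    rw [hsub, ← Finset.sum_coe_sort Γ' (fun i => gaborEntry L c p i * v i),
      ← Equiv.sum_comp e (fun i : Γ' => gaborEntry L c p i * v i)]
    refine Finset.sum_congr rfl fun i _ => ?_
    simp only [RingHom.mapMatrix_apply, Matrix.map_apply, Matrix.of_apply, gaborEntry, hc, hl,
      Polynomial.coe_evalRingHom, Polynomial.eval_mul, Polynomial.eval_C, Polynomial.eval_pow,
      Polynomial.eval_X]
    rw [mul_comm (z ^ _)]
    congr 4
    have := (e i).1.1.2
    rw [neg_sub]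
    rw [show ((p : ℤ) - ((e i).1.1 : ℕ)) = ((p + L - ((e i).1.1 : ℕ) : ℕ) : ℤ) + L * (-1) by
      push_cast [Nat.cast_sub (show ((e i).1.1 : ℕ) ≤ p + L by omega)]; ring]
    rw [Int.add_mul_emod_self_left]
    norm_cast
  ext i
  by_cases hi : i ∈ Γ'
  · have := congr_fun hker (e.symm ⟨i, hi⟩)
    simpa [hl] using this
  · exact hv i fun h => hi (hΓ' h)

/-! ### Uniform bounds for the Gabor matrix on sparse vectors -/

theorem enorm_sq_eq_ofReal (z : ℂ) : ‖z‖ₑ ^ 2 = ENNReal.ofReal (‖z‖ ^ 2) := by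
  rw [← ofReal_norm, ENNReal.ofReal_pow (norm_nonneg _)]

/-- If any `L` columns of the Gabor matrix are linearly independent, then the matrix is
uniformly bounded above and below on vectors with at most `L` nonzero entries. -/
theorem exists_gabor_bounds {L : ℕ} {c : ℤ → ℂ}
    (h : ∀ Γ : Finset (Fin L × Fin L), Γ.card ≤ L → ∀ v : Fin L × Fin L → ℂ, (∀ i ∉ Γ, v i = 0) →
      (∀ p, ∑ i, gaborEntry L c p i * v i = 0) → v = 0) :
    ∃ K : ℝ, 0 < K ∧ ∀ Γ : Finset (Fin L × Fin L), Γ.card ≤ L → ∀ v : Fin L × Fin L → ℂ,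
      (∀ i ∉ Γ, v i = 0) →
      ∑ i, ‖v i‖ₑ ^ 2 ≤ ENNReal.ofReal K * ∑ p, ‖∑ i, gaborEntry L c p i * v i‖ₑ ^ 2 ∧
      ∑ p, ‖∑ i, gaborEntry L c p i * v i‖ₑ ^ 2 ≤ ENNReal.ofReal K * ∑ i, ‖v i‖ₑ ^ 2 := by
  classical
  let G : EuclideanSpace ℂ (Fin L × Fin L) →ₗ[ℂ] EuclideanSpace ℂ (Fin L) :=
    Matrix.toEuclideanLin (Matrix.of (gaborEntry L c))
  have hG : ∀ v p, G v p = ∑ i, gaborEntry L c p i * v i := by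
    intro v p
    simp [G, Matrix.toEuclideanLin, Matrix.mulVec, dotProduct]
  have hlow : ∀ Γ : Finset (Fin L × Fin L), ∃ K : ℝ, 0 ≤ K ∧ (Γ.card ≤ L →
      ∀ v : EuclideanSpace ℂ (Fin L × Fin L), (∀ i ∉ Γ, v i = 0) → ‖v‖ ≤ K * ‖G v‖) := by
    intro Γ
    by_cases hΓ : Γ.card ≤ L
    · let V : Submodule ℂ (EuclideanSpace ℂ (Fin L × Fin L)) :=
        { carrier := {v | ∀ i ∉ Γ, v i = 0}
          add_mem' := fun {a b} ha hb i hi => by simp [ha i hi, hb i hi]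
          zero_mem' := fun i _ => by simp
          smul_mem' := fun r a ha i hi => by simp [ha i hi] }
      have hker : LinearMap.ker (G.comp V.subtype) = ⊥ := by
        rw [LinearMap.ker_eq_bot']
        rintro ⟨v, hv⟩ hv0
        have := h Γ hΓ v hv fun p => by
          rw [← hG]
          have : G v = 0 := hv0
          simp [this]
        ext i
        exact congr_fun this i
      obtain ⟨K, -, hK⟩ := (G.comp V.subtype).exists_antilipschitzWith hker
      refine ⟨K, K.2, fun _ v hv => ?_⟩
      have := hK.le_mul_dist ⟨v, hv⟩ 0
      simpa [dist_eq_norm] using this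
    · exact ⟨0, le_rfl, fun h => absurd h hΓ⟩
  choose K hK0 hK using hlow
  -- Injectivity on each coordinate subspace gives a constant depending on Γ; summing over the
  -- finitely many Γ dominates them all.
  set K₁ := ∑ Γ, K Γ
  have hK₁ : 0 ≤ K₁ := Finset.sum_nonneg fun Γ _ => hK0 Γ
  set K₂ := ‖LinearMap.toContinuousLinearMap G‖
  have hsum : ∀ v : EuclideanSpace ℂ (Fin L × Fin L), ∑ i, ‖v i‖ₑ ^ 2 = ENNReal.ofReal (‖v‖ ^ 2) := by
    intro v
    rw [EuclideanSpace.norm_sq_eq, ENNReal.ofReal_sum_of_nonneg fun i _ => by positivity]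
    exact Finset.sum_congr rfl fun i _ => enorm_sq_eq_ofReal _
  have hsum' : ∀ v : EuclideanSpace ℂ (Fin L × Fin L),
      ∑ p, ‖∑ i, gaborEntry L c p i * v i‖ₑ ^ 2 = ENNReal.ofReal (‖G v‖ ^ 2) := by
    intro v
    rw [EuclideanSpace.norm_sq_eq, ENNReal.ofReal_sum_of_nonneg fun i _ => by positivity]
    exact Finset.sum_congr rfl fun i _ => by rw [enorm_sq_eq_ofReal, hG]
  refine ⟨K₁ ^ 2 + K₂ ^ 2 + 1, by positivity, fun Γ hΓ v hv => ?_⟩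
  have e := hsum (WithLp.toLp 2 v)
  have e' := hsum' (WithLp.toLp 2 v)
  simp only at e e'
  rw [e, e', ← ENNReal.ofReal_mul (by positivity), ← ENNReal.ofReal_mul (by positivity)]
  set w : EuclideanSpace ℂ (Fin L × Fin L) := WithLp.toLp 2 v
  constructor <;> apply ENNReal.ofReal_le_ofReal
  · have h1 : ‖w‖ ≤ K₁ * ‖G w‖ := (hK Γ hΓ w hv).trans
      (mul_le_mul_of_nonneg_right (Finset.single_le_sum (fun Γ _ => hK0 Γ) (Finset.mem_univ Γ))
        (norm_nonneg _))
    have h2 : ‖w‖ ^ 2 ≤ (K₁ * ‖G w‖) ^ 2 := pow_le_pow_left₀ (norm_nonneg _) h1 2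
    nlinarith [sq_nonneg (K₂ * ‖G w‖), sq_nonneg ‖G w‖]
  · have h1 : ‖G w‖ ≤ K₂ * ‖w‖ := (LinearMap.toContinuousLinearMap G).le_opNorm w
    have h2 : ‖G w‖ ^ 2 ≤ (K₂ * ‖w‖) ^ 2 := pow_le_pow_left₀ (norm_nonneg _) h1 2
    nlinarith [sq_nonneg (K₁ * ‖w‖), sq_nonneg ‖w‖]

/-! ### Weighted Dirac trains -/

/-- The constant is independent of φ, which enters only through a Schwartz seminorm; this is what
makes the Dirac train continuous. The weight in T + |t| has no singularity at the lattice point 0.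
-/
theorem exists_schwartz_decay (T : ℝ) (hT : 0 < T) : ∃ C : ℝ, 0 ≤ C ∧ ∀ (φ : 𝓢(ℝ, ℂ)) (t : ℝ),
    ‖φ t‖ ≤ C * ((Finset.Iic ((2, 0) : ℕ × ℕ)).sup (schwartzSeminormFamily ℂ ℝ ℂ)) φ *
      (1 / (T + |t|) ^ 2) := by
  refine ⟨(1 + T) ^ 2 * 2 ^ 2, by positivity, fun φ t => ?_⟩
  have h := SchwartzMap.one_add_le_sup_seminorm_apply (𝕜 := ℂ) (m := (2, 0)) (k := 2) (n := 0)
    le_rfl le_rfl φ t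
  rw [norm_iteratedFDeriv_zero, Real.norm_eq_abs] at h
  have h1 : 0 < (T + |t|) ^ 2 := by positivity
  rw [mul_one_div, le_div_iff₀ h1]
  have h2 : (T + |t|) ^ 2 ≤ (1 + T) ^ 2 * (1 + |t|) ^ 2 := by
    rw [← mul_pow]
    apply pow_le_pow_left₀ (by positivity)
    nlinarith [abs_nonneg t]
  calc ‖φ t‖ * (T + |t|) ^ 2 ≤ ‖φ t‖ * ((1 + T) ^ 2 * (1 + |t|) ^ 2) := by gcongr
    _ = (1 + T) ^ 2 * ((1 + |t|) ^ 2 * ‖φ t‖) := by ring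
    _ ≤ (1 + T) ^ 2 * (2 ^ 2 * ((Finset.Iic ((2, 0) : ℕ × ℕ)).sup
          (schwartzSeminormFamily ℂ ℝ ℂ)) φ) := mul_le_mul_of_nonneg_left h (by positivity)
    _ = _ := by ring

theorem summable_one_div_add_abs_sq {T : ℝ} (hT : 0 < T) :
    Summable fun k : ℤ => 1 / (T + |(k : ℝ) * T|) ^ 2 := by
  have h0 : Summable fun k : ℤ => T⁻¹ ^ 2 * (1 / (k : ℝ) ^ 2) :=
    (Real.summable_one_div_int_pow.2 one_lt_two).mul_left _
  refine Summable.of_norm_bounded_eventually h0 ?_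
  filter_upwards [Filter.eventually_cofinite_ne (0 : ℤ)] with k hk
  have hk' : 0 < |(k : ℝ)| := abs_pos.2 (by exact_mod_cast hk)
  rw [Real.norm_of_nonneg (by positivity), inv_pow, ← one_div, one_div_mul_one_div, abs_mul,
    abs_of_pos hT, ← mul_pow, ← sq_abs (T * k), abs_mul, abs_of_pos hT]
  apply one_div_le_one_div_of_le (by positivity)
  apply pow_le_pow_left₀ (by positivity)
  nlinarith

/-- The samples of a Schwartz function along translates of a lattice are uniformly summable. -/
theorem exists_summable_bound {T : ℝ} (hT : 0 < T) (R : ℝ) (φ : 𝓢(ℝ, ℂ)) :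
    ∃ b : ℤ → ℝ, Summable b ∧ ∀ (k : ℤ) (τ : ℝ), |τ| ≤ R → ‖φ (τ - k * T)‖ ≤ b k := by
  obtain ⟨C, hC, h⟩ := exists_schwartz_decay T hT
  set S := ((Finset.Iic ((2, 0) : ℕ × ℕ)).sup (schwartzSeminormFamily ℂ ℝ ℂ)) φ
  have hS : 0 ≤ S := apply_nonneg _ _
  refine ⟨fun k => C * S * (1 + |R| / T) ^ 2 * (1 / (T + |(k : ℝ) * T|) ^ 2),
    (summable_one_div_add_abs_sq hT).mul_left _, fun k τ hτ => (h φ _).trans ?_⟩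
  change C * S * _ ≤ C * S * (1 + |R| / T) ^ 2 * _
  rw [mul_assoc (C * S)]
  refine mul_le_mul_of_nonneg_left ?_ (by positivity)
  rw [mul_one_div, div_le_div_iff₀ (by positivity) (by positivity), one_mul, ← mul_pow]
  apply pow_le_pow_left₀ (by positivity)
  have h1 : |(k : ℝ) * T| ≤ |R| + |τ - k * T| := by
    have := abs_sub_abs_le_abs_sub ((k : ℝ) * T) τ
    rw [abs_sub_comm] at this
    linarith [le_abs_self R]
  have h2 : |R| / T * T = |R| := by field_simp
  have h3 : 0 ≤ |R| / T * |τ - k * T| := by positivity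
  nlinarith

theorem exists_diracTrain {T : ℝ} (hT : 0 < T) {c : ℤ → ℂ} {B : ℝ} (hc : ∀ k, ‖c k‖ ≤ B) :
    ∃ x : 𝓢'(ℝ, ℂ), IsDiracTrain T c x := by
  obtain ⟨C, hC, h⟩ := exists_schwartz_decay T hT
  have hB : 0 ≤ B := (norm_nonneg _).trans (hc 0)
  set S : 𝓢(ℝ, ℂ) → ℝ :=
    fun φ => ((Finset.Iic ((2, 0) : ℕ × ℕ)).sup (schwartzSeminormFamily ℂ ℝ ℂ)) φ
  have hb : ∀ (φ : 𝓢(ℝ, ℂ)) (k : ℤ), ‖c k * φ (-((k : ℝ) * T))‖ ≤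
      B * C * S φ * (1 / (T + |(k : ℝ) * T|) ^ 2) := by
    intro φ k
    have := h φ (-((k : ℝ) * T))
    rw [abs_neg] at this
    rw [norm_mul]
    calc _ ≤ B * (C * S φ * (1 / (T + |(k : ℝ) * T|) ^ 2)) :=
          mul_le_mul (hc k) this (norm_nonneg _) hB
      _ = _ := by ring
  have hs : ∀ φ : 𝓢(ℝ, ℂ), Summable fun k : ℤ => c k * φ (-((k : ℝ) * T)) := fun φ =>
    Summable.of_norm_bounded ((summable_one_div_add_abs_sq hT).mul_left _) (hb φ)
  let x : 𝓢(ℝ, ℂ) →L[ℂ] ℂ := SchwartzMap.mkCLMtoNormedSpace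
    (fun φ => ∑' k : ℤ, c k * φ (-((k : ℝ) * T)))
    (fun φ ψ => by
      rw [← (hs φ).tsum_add (hs ψ)]
      simp [mul_add])
    (fun a φ => by
      rw [RingHom.id_apply, smul_eq_mul, ← tsum_mul_left]
      simp [mul_left_comm])
    ⟨Finset.Iic (2, 0), B * C * ∑' k : ℤ, 1 / (T + |(k : ℝ) * T|) ^ 2, by positivity, fun φ => by
      have := tsum_of_norm_bounded
        ((summable_one_div_add_abs_sq hT).mul_left (B * C * S φ)).hasSum (hb φ)
      rw [tsum_mul_left] at this
      refine this.trans_eq ?_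
      ring⟩
  exact ⟨ContinuousLinearMap.toPointwiseConvergenceCLM _ _ _ _ x, fun φ => (hs φ).hasSum⟩

/-- A Dirac train acts on the time-frequency shifts of a test function by sampling. -/
theorem IsDiracTrain.hasSum_shift {T : ℝ} {c : ℤ → ℂ} {x : 𝓢'(ℝ, ℂ)} (hx : IsDiracTrain T c x)
    (φ : 𝓢(ℝ, ℂ)) (p : ℝ × ℝ) :
    HasSum (fun k : ℤ => c k * (modChar p.2 (p.1 - k * T) * φ (p.1 - k * T)))
      ((modulation p.2 (translation p.1 x)) φ) := by
  rw [modulation_translation_apply]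
  convert hx (shiftedTest p φ) using 4 with k
  rw [shiftedTest_apply]
  ring_nf

/-! ### Periodic decompositions of integrals and Parseval's identity -/

theorem tsum_int_eq_sum_fin {M : Type*} [AddCommMonoid M] [TopologicalSpace M] {L : ℕ}
    {f : ℤ → M} (hf : ∀ k : ℤ, ¬(0 ≤ k ∧ k < L) → f k = 0) :
    ∑' k, f k = ∑ q : Fin L, f (q : ℕ) := by
  rw [← tsum_fintype (L := .unconditional _)]
  refine (Function.Injective.tsum_eq (g := fun q : Fin L => ((q : ℕ) : ℤ)) ?_ ?_).symm
  · intro a b hab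
    exact Fin.ext (Int.ofNat.inj hab)
  · intro k hk
    by_contra hne
    refine hk (hf k fun h => hne ⟨⟨k.toNat, by omega⟩, ?_⟩)
    simp [h.1]

theorem restrict_Ico_map_add (T a : ℝ) :
    MeasurePreserving (fun u : ℝ => u + a) (volume.restrict (Ico 0 T))
      (volume.restrict (Ico a (a + T))) := by
  have := (measurePreserving_add_right (volume : Measure ℝ) a).restrict_preimage
    (measurableSet_Ico (a := a) (b := a + T))
  simpa [add_comm] using this

theorem pairwise_disjoint_Ico_mul (T : ℝ) :
    Pairwise (Function.onFun Disjoint fun k : ℤ => Ico ((k : ℝ) * T) (k * T + T)) := by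
  have := pairwise_disjoint_Ico_zsmul T
  simpa [add_mul] using this

theorem iUnion_Ico_mul {T : ℝ} (hT : 0 < T) :
    ⋃ k : ℤ, Ico ((k : ℝ) * T) (k * T + T) = univ := by
  have := iUnion_Ico_zsmul hT
  simpa [add_mul] using this

theorem lintegral_eq_tsum_Ico {T : ℝ} (hT : 0 < T) (g : ℝ → ENNReal) :
    ∫⁻ t, g t = ∑' k : ℤ, ∫⁻ u in Ico 0 T, g (u + k * T) := by
  rw [← setLIntegral_univ, ← iUnion_Ico_mul hT, lintegral_iUnion (fun _ => measurableSet_Ico)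
    (pairwise_disjoint_Ico_mul T)]
  refine tsum_congr fun k => ?_
  exact ((restrict_Ico_map_add T (k * T)).lintegral_comp_emb
    (measurableEmbedding_addRight _) _).symm

theorem integral_eq_tsum_Ico {T : ℝ} (hT : 0 < T) {g : ℝ → ℂ} (hg : Integrable g) :
    ∫ t, g t = ∑' k : ℤ, ∫ u in Ico 0 T, g (u + k * T) := by
  rw [← setIntegral_univ, ← iUnion_Ico_mul hT, integral_iUnion (fun _ => measurableSet_Ico)
    (pairwise_disjoint_Ico_mul T) hg.integrableOn]
  refine tsum_congr fun k => ?_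
  exact ((restrict_Ico_map_add T (k * T)).integral_comp
    (measurableEmbedding_addRight _) _).symm

theorem add_mul_notMem_Ico {T u : ℝ} (hT : 0 < T) {L : ℕ} (hu : u ∈ Ico 0 T) {k : ℤ}
    (hk : ¬(0 ≤ k ∧ k < L)) : u + k * T ∉ Ico 0 (L * T) := by
  intro h
  refine hk ⟨?_, ?_⟩
  · by_contra! hlt
    have : (k : ℝ) ≤ -1 := by exact_mod_cast (by omega : k ≤ -1)
    nlinarith [h.1, hu.2]
  · by_contra! hle
    have : (L : ℝ) ≤ k := by exact_mod_cast hle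
    nlinarith [h.2, hu.1]

theorem lintegral_eq_sum_Ico {T : ℝ} (hT : 0 < T) (L : ℕ) {g : ℝ → ENNReal}
    (hg : ∀ t ∉ Ico 0 (L * T), g t = 0) :
    ∫⁻ t, g t = ∑ q : Fin L, ∫⁻ u in Ico 0 T, g (u + (q : ℕ) * T) := by
  rw [lintegral_eq_tsum_Ico hT, tsum_int_eq_sum_fin (L := L) fun k hk => ?_]
  · simp
  · rw [setLIntegral_congr_fun measurableSet_Ico fun u hu => hg _ (add_mul_notMem_Ico hT hu hk)]
    simp

theorem integral_eq_sum_Ico {T : ℝ} (hT : 0 < T) (L : ℕ) {g : ℝ → ℂ} (hgi : Integrable g)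
    (hg : ∀ t ∉ Ico 0 (L * T), g t = 0) :
    ∫ t, g t = ∑ q : Fin L, ∫ u in Ico 0 T, g (u + (q : ℕ) * T) := by
  rw [integral_eq_tsum_Ico hT hgi, tsum_int_eq_sum_fin (L := L) fun k hk => ?_]
  · simp
  · rw [setIntegral_congr_fun measurableSet_Ico fun u hu => hg _ (add_mul_notMem_Ico hT hu hk)]
    simp

/-- Parseval's identity on the interval `[0, l)`. -/
theorem tsum_enorm_sq_integral_modChar {l : ℝ} (hl : 0 < l) {f : ℝ → ℂ}
    (hf : MemLp f 2 (volume.restrict (Ico 0 l))) :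
    ∑' r : ℤ, ‖∫ η in Ico 0 l, f η * modChar η (r / l)‖ₑ ^ 2 =
      ENNReal.ofReal l * ∫⁻ η in Ico 0 l, ‖f η‖ₑ ^ 2 := by
  have hf' : MemLp f 2 (volume.restrict (Ioc 0 l)) := by
    rwa [← restrict_Ico_eq_restrict_Ioc]
  have h := hasSum_sq_fourierCoeffOn hl hf'
  have e : ∀ r : ℤ, ‖fourierCoeffOn hl f r‖ ^ 2 =
      l⁻¹ ^ 2 * ‖∫ η in Ico 0 l, f η * modChar η ((-r : ℤ) / l)‖ ^ 2 := by
    intro r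
    rw [fourierCoeffOn_eq_integral, norm_smul, mul_pow, intervalIntegral.integral_of_le hl.le,
      restrict_Ico_eq_restrict_Ioc]
    congr 2
    · simp [abs_of_pos hl]
    · congr 1
      refine integral_congr_ae (Filter.Eventually.of_forall fun η => ?_)
      simp only [fourier_coe_apply, smul_eq_mul, modChar]
      rw [mul_comm]
      congr 2
      push_cast
      ring
  have h2 : ∫ η in (0 : ℝ)..l, ‖f η‖ ^ 2 = (∫⁻ η in Ico 0 l, ‖f η‖ₑ ^ 2).toReal := by
    rw [intervalIntegral.integral_of_le hl.le, ← restrict_Ico_eq_restrict_Ioc,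
      integral_eq_lintegral_of_nonneg_ae (f := fun η => ‖f η‖ ^ 2)
        (Filter.Eventually.of_forall fun _ => sq_nonneg _) (hf.1.norm.pow 2)]
    simp_rw [enorm_sq_eq_ofReal]
  have hfin : ∫⁻ η in Ico 0 l, ‖f η‖ₑ ^ 2 ≠ ⊤ := by
    have := hf.2
    have h3 := lintegral_rpow_enorm_lt_top_of_eLpNorm_lt_top two_ne_zero ENNReal.ofNat_ne_top this
    simpa using h3.ne
  simp_rw [e, h2] at h
  have h4 := h.mul_left (l ^ 2)
  have h5 : HasSum (fun r : ℤ => ‖∫ η in Ico 0 l, f η * modChar η (r / l)‖ ^ 2)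
      (l * (∫⁻ η in Ico 0 l, ‖f η‖ₑ ^ 2).toReal) := by
    -- `fourierCoeffOn` pairs with the conjugate exponential, so the index is reflected.
    rw [← (Equiv.neg ℤ).hasSum_iff]
    have e1 : (fun r : ℤ => ‖∫ η in Ico 0 l, f η * modChar η (r / l)‖ ^ 2) ∘ Equiv.neg ℤ =
        fun i : ℤ => l ^ 2 * (l⁻¹ ^ 2 * ‖∫ η in Ico 0 l, f η * modChar η ((-i : ℤ) / l)‖ ^ 2) := by
      ext r
      rw [← mul_assoc, ← mul_pow, mul_inv_cancel₀ hl.ne', one_pow, one_mul]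
      rfl
    have e2 : ∀ A : ℝ, l * A = l ^ 2 * (l - 0)⁻¹ • A := by
      intro A
      rw [smul_eq_mul, sub_zero]
      field_simp
    rw [e1, e2]
    exact h4
  simp_rw [enorm_sq_eq_ofReal]
  rw [← ENNReal.ofReal_tsum_of_nonneg (fun _ => by positivity) h5.summable, h5.tsum_eq,
    ENNReal.ofReal_mul hl.le]
  congr 1
  simp_rw [← enorm_sq_eq_ofReal]
  exact ENNReal.ofReal_toReal hfin

/-! ### The response to a weighted Dirac train -/

theorem region_subset_box {T : ℝ} (hT : 0 < T) {L : ℕ} (hL : 1 ≤ L)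
    {Γ : Finset (Fin L × Fin L)} {p : ℝ × ℝ} (hp : p ∈ region T L Γ) :
    p.1 ∈ Ico 0 (L * T) ∧ p.2 ∈ Ico 0 (L * (1 / (T * L))) := by
  obtain ⟨i, -, h⟩ := mem_region.1 hp
  have hL' : (0 : ℝ) < L := by exact_mod_cast hL
  have hTL : 0 < T * L := mul_pos hT hL'
  have h1 : ((i.1 : ℕ) : ℝ) + 1 ≤ L := by exact_mod_cast i.1.2
  have h2 : ((i.2 : ℕ) : ℝ) + 1 ≤ L := by exact_mod_cast i.2.2
  rw [cell, mem_prod, mem_Ico, mem_Ico] at h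
  refine ⟨⟨le_trans (by positivity) h.1.1, h.1.2.trans_le (by gcongr)⟩,
    ⟨le_trans (by positivity) h.2.1, h.2.2.trans_le ?_⟩⟩
  rw [mul_one_div]
  gcongr

/-- The response to the Dirac train with weights `c` of the operator with spreading function `σ`. -/
def trainResponse (T : ℝ) (L : ℕ) (c : ℤ → ℂ) (σ : ℝ × ℝ → ℂ) (t : ℝ) : ℂ :=
  ∑ q : Fin L, c ((q : ℕ) - ⌊t / T⌋) *
    ∫ ν, σ (t - ⌊t / T⌋ * T + (q : ℕ) * T, ν) * modChar ν t

theorem floor_add_mul_div {T u : ℝ} (hT : 0 < T) (hu : u ∈ Ico 0 T) (p : ℤ) :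
    ⌊(u + p * T) / T⌋ = p := by
  rw [Int.floor_eq_iff, le_div_iff₀ hT, div_lt_iff₀ hT]
  constructor <;> nlinarith [hu.1, hu.2]

theorem trainResponse_add_mul {T u : ℝ} (hT : 0 < T) (L : ℕ) (c : ℤ → ℂ) (σ : ℝ × ℝ → ℂ)
    (hu : u ∈ Ico 0 T) (p : ℤ) :
    trainResponse T L c σ (u + p * T) =
      ∑ q : Fin L, c ((q : ℕ) - p) * ∫ ν, σ (u + (q : ℕ) * T, ν) * modChar ν (u + p * T) := by
  rw [trainResponse, floor_add_mul_div hT hu, add_sub_cancel_right]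

theorem sub_floor_mem_Ico {T : ℝ} (hT : 0 < T) (t : ℝ) : t - ⌊t / T⌋ * T ∈ Ico 0 T := by
  have h1 := Int.floor_le (t / T)
  have h2 := Int.lt_floor_add_one (t / T)
  rw [le_div_iff₀ hT] at h1
  rw [div_lt_iff₀ hT] at h2
  constructor <;> linarith

/-- The support of σ in τ, [0, LT), leaves only L terms at a given t, namely those with k + ⌊t / T⌋
between 0 and L - 1. Reindexing by q = k + ⌊t / T⌋ makes the sum finite. -/
theorem tsum_eq_trainResponse {T : ℝ} (hT : 0 < T) {L : ℕ} (c : ℤ → ℂ) {σ : ℝ × ℝ → ℂ}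
    (hσ : ∀ p : ℝ × ℝ, p.1 ∉ Ico 0 (L * T) → σ p = 0) (t : ℝ) :
    ∑' k : ℤ, c k * ∫ ν, σ (t + k * T, ν) * modChar ν t = trainResponse T L c σ t := by
  rw [← (Equiv.subRight ⌊t / T⌋).tsum_eq, tsum_int_eq_sum_fin (L := L) fun k hk => ?_]
  · rw [trainResponse]
    refine Finset.sum_congr rfl fun q _ => ?_
    simp only [Equiv.subRight_apply]
    congr 3
    ext ν
    congr 3
    push_cast
    ring
  · simp only [Equiv.subRight_apply]
    have : ∀ ν, σ (t + ((k - ⌊t / T⌋ : ℤ) : ℝ) * T, ν) = 0 := fun ν => hσ _ (by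
      have := add_mul_notMem_Ico hT (sub_floor_mem_Ico hT t) hk
      convert this using 1
      push_cast
      ring_nf)
    simp only [this, zero_mul, integral_zero, mul_zero]

theorem stronglyMeasurable_trainResponse (T : ℝ) (L : ℕ) (c : ℤ → ℂ) {σ : ℝ × ℝ → ℂ}
    (hσ : StronglyMeasurable σ) : StronglyMeasurable (trainResponse T L c σ) := by
  unfold trainResponse
  refine Finset.stronglyMeasurable_fun_sum _ fun q _ => StronglyMeasurable.mul ?_ ?_
  · have h1 : Measurable fun t : ℝ => ⌊t / T⌋ := Int.measurable_floor.comp (by fun_prop)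
    exact ((measurable_from_top (f := fun n : ℤ => c ((q : ℕ) - n))).comp h1).stronglyMeasurable
  · have h1 : Measurable fun t : ℝ => (⌊t / T⌋ : ℝ) :=
      (measurable_from_top (f := fun n : ℤ => (n : ℝ))).comp
        (Int.measurable_floor.comp (by fun_prop))
    refine StronglyMeasurable.integral_prod_right (f := fun t ν : ℝ =>
      σ (t - ⌊t / T⌋ * T + (q : ℕ) * T, ν) * modChar ν t) ?_
    refine StronglyMeasurable.mul ?_ ?_
    · refine hσ.comp_measurable (Measurable.prodMk ?_ measurable_snd)
      exact ((measurable_fst.sub ((h1.comp measurable_fst).mul_const T)).add_const _)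
    · exact (continuous_modChar.comp continuous_swap).stronglyMeasurable

/-- By Tonelli. It justifies Parseval's identity in ν at almost every fixed τ. -/
theorem ae_memLp_slice {σ : ℝ × ℝ → ℂ} (hσm : StronglyMeasurable σ) (hσ2 : MemLp σ 2) :
    ∀ᵐ τ : ℝ, MemLp (fun ν => σ (τ, ν)) 2 := by
  have h := lintegral_rpow_enorm_lt_top_of_eLpNorm_lt_top two_ne_zero ENNReal.ofNat_ne_top hσ2.2
  rw [Measure.volume_eq_prod, lintegral_prod _ (by
    exact (hσm.enorm.pow_const _).aemeasurable)] at h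
  have hm : Measurable fun τ : ℝ => ∫⁻ ν : ℝ, ‖σ (τ, ν)‖ₑ ^ (2 : ENNReal).toReal :=
    Measurable.lintegral_prod_right' (f := fun p : ℝ × ℝ => ‖σ p‖ₑ ^ (2 : ENNReal).toReal)
      (hσm.enorm.pow_const _)
  filter_upwards [ae_lt_top hm h.ne] with τ hτ
  refine ⟨(hσm.comp_measurable measurable_prodMk_left).aestronglyMeasurable, ?_⟩
  rw [eLpNorm_lt_top_iff_lintegral_rpow_enorm_lt_top two_ne_zero ENNReal.ofNat_ne_top]
  exact hτ

theorem ae_memLp_slice_translates {σ : ℝ × ℝ → ℂ} (hσm : StronglyMeasurable σ)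
    (hσ2 : MemLp σ 2) (T : ℝ) (L : ℕ) :
    ∀ᵐ u : ℝ, ∀ q : Fin L, MemLp (fun ν => σ (u + (q : ℕ) * T, ν)) 2 := by
  rw [ae_all_iff]
  intro q
  exact (measurePreserving_add_right volume ((q : ℕ) * T)).quasiMeasurePreserving.ae
    (ae_memLp_slice hσm hσ2)

theorem periodic_sub_mul {L : ℕ} {c : ℤ → ℂ} (hc : ∀ k, c (k + L) = c k) (n r : ℤ) :
    c (n - r * L) = c n := by
  have : Function.Periodic c (L : ℤ) := hc
  exact this.sub_int_mul_eq r

/-- The offset m/(TL) against pT produces the root of unity in the Gabor matrix, and against rLT an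
integer phase. Thus r survives only in the last factor, as the index of a Fourier exponential on [0,
1/(TL)). -/
theorem modChar_sample {T : ℝ} (hT : 0 < T) {L : ℕ} (hL : 1 ≤ L) (u η : ℝ) (m p : ℕ) (r : ℤ) :
    modChar (η + m * (1 / (T * L))) (u + (p + r * L : ℤ) * T) =
      modChar η (u + p * T) * modChar (m * (1 / (T * L))) u * rootOfUnity L ^ (m * p) *
        modChar η (r / (1 / (T * L))) := by
  have hL' : (0 : ℝ) < L := by exact_mod_cast hL
  have hTL : 0 < T * L := mul_pos hT hL'
  have e1 : (u + (p + r * L : ℤ) * T : ℝ) = u + p * T + r / (1 / (T * L)) := by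
    push_cast
    field_simp
    ring
  have e2 : modChar (m * (1 / (T * L))) (p * T) = rootOfUnity L ^ (m * p) := by
    rw [rootOfUnity, ← Complex.exp_nat_mul, modChar]
    congr 1
    have h1 : (L : ℂ) ≠ 0 := by exact_mod_cast hL'.ne'
    have h2 : (T : ℂ) ≠ 0 := by exact_mod_cast hT.ne'
    push_cast
    field_simp
  have e3 : modChar (m * (1 / (T * L))) (r / (1 / (T * L))) = 1 := by
    rw [modChar]
    refine Complex.exp_eq_one_iff.2 ⟨m * r, ?_⟩
    have h1 : (L : ℂ) ≠ 0 := by exact_mod_cast hL'.ne'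
    have h2 : (T : ℂ) ≠ 0 := by exact_mod_cast hT.ne'
    push_cast
    field_simp
  rw [e1, modChar_add_left, modChar_add_right η, modChar_add_right (m * (1 / (T * L))),
    modChar_add_right (m * (1 / (T * L))), e2, e3]
  ring

theorem integrable_of_memLp_two_of_support {g : ℝ → ℂ} {R : ℝ} (hg : MemLp g 2)
    (h0 : ∀ t ∉ Ico 0 R, g t = 0) : Integrable g := by
  have h1 : IntegrableOn g (Ico 0 R) := (hg.restrict _).integrable one_le_two
  rw [← integrable_indicator_iff measurableSet_Ico] at h1
  refine h1.congr (Filter.Eventually.of_forall fun t => ?_)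
  by_cases ht : t ∈ Ico 0 R
  · rw [indicator_of_mem ht]
  · rw [indicator_of_notMem ht, h0 t ht]

theorem enorm_modChar_mul (ν t : ℝ) (z : ℂ) : ‖modChar ν t * z‖ₑ = ‖z‖ₑ := by
  rw [enorm_mul, ← ofReal_norm (modChar _ _), modChar_norm, ENNReal.ofReal_one, one_mul]

theorem memLp_modChar_mul {μ : Measure ℝ} {g : ℝ → ℂ} (hg : MemLp g 2 μ) (a : ℝ) :
    MemLp (fun η => modChar η a * g η) 2 μ := by
  refine hg.of_le (AEStronglyMeasurable.mul ?_ hg.1) (Filter.Eventually.of_forall fun η => ?_)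
  · exact (continuous_modChar.comp (continuous_id.prodMk continuous_const)).aestronglyMeasurable
  · rw [norm_mul, modChar_norm, one_mul]

/-- The values of the response along a coset of the lattice `LTℤ` are Fourier coefficients. -/
theorem trainResponse_eq_fourier {T : ℝ} (hT : 0 < T) {L : ℕ} (hL : 1 ≤ L) {c : ℤ → ℂ}
    (hc : ∀ k, c (k + L) = c k) {σ : ℝ × ℝ → ℂ}
    (hσ : ∀ p : ℝ × ℝ, p.2 ∉ Ico 0 (L * (1 / (T * L))) → σ p = 0) {u : ℝ} (hu : u ∈ Ico 0 T)
    (hu2 : ∀ q : Fin L, MemLp (fun ν => σ (u + (q : ℕ) * T, ν)) 2) (p : Fin L) (r : ℤ) :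
    trainResponse T L c σ (u + (p + r * L : ℤ) * T) =
      ∫ η in Ico 0 (1 / (T * L)), (modChar η (u + (p : ℕ) * T) * ∑ i, gaborEntry L c p i *
        (modChar ((i.2 : ℕ) * (1 / (T * L))) u *
          σ (u + (i.1 : ℕ) * T, η + (i.2 : ℕ) * (1 / (T * L))))) *
            modChar η (r / (1 / (T * L))) := by
  have hL' : (0 : ℝ) < L := by exact_mod_cast hL
  have hl : 0 < 1 / (T * L) := one_div_pos.2 (mul_pos hT hL')
  set t : ℝ := u + (p + r * L : ℤ) * T with ht
  have hgi : ∀ q : Fin L, Integrable fun ν => σ (u + (q : ℕ) * T, ν) * modChar ν t := by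
    intro q
    have h1 := memLp_modChar_mul (hu2 q) t
    simp_rw [mul_comm (modChar _ t)] at h1
    exact integrable_of_memLp_two_of_support h1 fun ν hν => by rw [hσ _ hν, zero_mul]
  rw [trainResponse_add_mul hT L c σ hu, ← ht]
  -- Periodicity of c removes r from the weights, and the ν-integral is folded onto one cell height.
  have e1 : ∀ q : Fin L, c ((q : ℕ) - (p + r * L : ℤ)) * ∫ ν, σ (u + (q : ℕ) * T, ν) * modChar ν t
      = ∑ m : Fin L, ∫ η in Ico 0 (1 / (T * L)), c ((q : ℕ) - (p : ℕ)) *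
        (σ (u + (q : ℕ) * T, η + (m : ℕ) * (1 / (T * L))) *
          modChar (η + (m : ℕ) * (1 / (T * L))) t) := by
    intro q
    rw [← sub_sub, periodic_sub_mul hc, integral_eq_sum_Ico hl L (hgi q) fun ν hν => by
      rw [hσ _ hν, zero_mul], Finset.mul_sum]
    exact Finset.sum_congr rfl fun m _ => (integral_const_mul _ _).symm
  rw [Finset.sum_congr rfl fun q _ => e1 q, ← Fintype.sum_prod_type' (f := fun q m : Fin L =>
    ∫ η in Ico 0 (1 / (T * L)), c ((q : ℕ) - (p : ℕ)) *
        (σ (u + (q : ℕ) * T, η + (m : ℕ) * (1 / (T * L))) *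
          modChar (η + (m : ℕ) * (1 / (T * L))) t)), ← integral_finsetSum]
  · refine integral_congr_ae (Filter.Eventually.of_forall fun η => ?_)
    simp only
    rw [mul_right_comm, Finset.mul_sum]
    refine Finset.sum_congr rfl fun i _ => ?_
    rw [ht, modChar_sample hT hL, gaborEntry]
    ring
  · intro i _
    exact (((hgi i.1).comp_add_right ((i.2 : ℕ) * (1 / (T * L)))).const_mul _).integrableOn

/-- The energy of the response to a Dirac train, expressed through the Gabor matrix. -/
theorem lintegral_trainResponse {T : ℝ} (hT : 0 < T) {L : ℕ} (hL : 1 ≤ L) {c : ℤ → ℂ}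
    (hc : ∀ k, c (k + L) = c k) {σ : ℝ × ℝ → ℂ} (hσm : StronglyMeasurable σ) (hσ2 : MemLp σ 2)
    (hσ : ∀ p : ℝ × ℝ, p.2 ∉ Ico 0 (L * (1 / (T * L))) → σ p = 0) :
    ∫⁻ t, ‖trainResponse T L c σ t‖ₑ ^ 2 = ENNReal.ofReal (1 / (T * L)) *
      ∫⁻ u in Ico 0 T, ∫⁻ η in Ico 0 (1 / (T * L)), ∑ p : Fin L, ‖∑ i, gaborEntry L c p i *
        (modChar ((i.2 : ℕ) * (1 / (T * L))) u *
          σ (u + (i.1 : ℕ) * T, η + (i.2 : ℕ) * (1 / (T * L))))‖ₑ ^ 2 := by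
  have : NeZero L := ⟨by omega⟩
  have hL' : (0 : ℝ) < L := by exact_mod_cast hL
  have hl : 0 < 1 / (T * L) := one_div_pos.2 (mul_pos hT hL')
  rw [lintegral_eq_tsum_Ico hT, ← lintegral_tsum, ← lintegral_const_mul' _ _ ENNReal.ofReal_ne_top]
  · refine lintegral_congr_ae ?_
    filter_upwards [ae_restrict_of_ae (ae_memLp_slice_translates hσm hσ2 T L),
      ae_restrict_mem measurableSet_Ico] with u hu2 hu
    have hmem : ∀ i : Fin L × Fin L, MemLp (fun η =>
        σ (u + (i.1 : ℕ) * T, η + (i.2 : ℕ) * (1 / (T * L)))) 2 := fun i =>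
      (hu2 i.1).comp_measurePreserving (measurePreserving_add_right volume _)
    -- The index of the time interval is written as p + rL: p becomes the row of the Gabor matrix,
    -- and the sum over r is evaluated by Parseval.
    rw [← (Int.divModEquiv L).symm.tsum_eq, ENNReal.tsum_prod', ENNReal.tsum_comm, tsum_fintype,
      lintegral_finsetSum', Finset.mul_sum]
    · refine Finset.sum_congr rfl fun p _ => ?_
      have hf : MemLp (fun η => modChar η (u + (p : ℕ) * T) * ∑ i, gaborEntry L c p i *
          (modChar ((i.2 : ℕ) * (1 / (T * L))) u *
            σ (u + (i.1 : ℕ) * T, η + (i.2 : ℕ) * (1 / (T * L))))) 2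
          (volume.restrict (Ico 0 (1 / (T * L)))) :=
        memLp_modChar_mul (memLp_finsetSum _ fun i _ =>
          (((hmem i).restrict _).const_mul _).const_mul _) _
      have hP := tsum_enorm_sq_integral_modChar hl hf
      simp only [enorm_modChar_mul] at hP
      rw [← hP]
      refine tsum_congr fun r => ?_
      rw [← trainResponse_eq_fourier hT hL hc hσ hu hu2 p r]
      have e : (Int.divModEquiv L).symm (r, p) = p + r * L := by
        simp [Int.divModEquiv]
        ring
      rw [e]
    · intro p _
      refine AEMeasurable.pow_const (AEStronglyMeasurable.enorm ?_) _
      exact (memLp_finsetSum _ fun i _ =>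
          (((hmem i).restrict _).const_mul _).const_mul _).1
  · intro k
    exact (((stronglyMeasurable_trainResponse T L c hσm).comp_measurable
      (measurable_id.add_const _)).enorm.pow_const _).aemeasurable

/-- The energy of a spreading function, decomposed into cells. -/
theorem lintegral_eq_cells {T : ℝ} (hT : 0 < T) {L : ℕ} (hL : 1 ≤ L) {σ : ℝ × ℝ → ℂ}
    (hσm : StronglyMeasurable σ)
    (hσ : ∀ p : ℝ × ℝ, ¬(p.1 ∈ Ico 0 (L * T) ∧ p.2 ∈ Ico 0 (L * (1 / (T * L)))) → σ p = 0) :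
    ∫⁻ p, ‖σ p‖ₑ ^ 2 = ∫⁻ u in Ico 0 T, ∫⁻ η in Ico 0 (1 / (T * L)), ∑ i : Fin L × Fin L,
      ‖σ (u + (i.1 : ℕ) * T, η + (i.2 : ℕ) * (1 / (T * L)))‖ₑ ^ 2 := by
  have hL' : (0 : ℝ) < L := by exact_mod_cast hL
  have hl : 0 < 1 / (T * L) := one_div_pos.2 (mul_pos hT hL')
  have hm : Measurable fun p : ℝ × ℝ => ‖σ p‖ₑ ^ 2 := hσm.enorm.pow_const _
  rw [Measure.volume_eq_prod, lintegral_prod _ hm.aemeasurable, lintegral_eq_sum_Ico hT L,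
    ← lintegral_finsetSum]
  · refine lintegral_congr fun u => ?_
    rw [lintegral_finsetSum, Fintype.sum_prod_type]
    · refine Finset.sum_congr rfl fun q _ => ?_
      exact lintegral_eq_sum_Ico hl L fun ν hν => by rw [hσ _ fun h => hν h.2]; simp
    · intro i _
      exact hm.comp (measurable_const.prodMk (measurable_id.add_const _))
  · intro q _
    exact (Measurable.lintegral_prod_right' hm).comp (measurable_id.add_const _)
  · intro t ht
    simp [fun ν => hσ (t, ν) fun h => ht h.1]

/-- The function `trainResponse` is the response to the Dirac train. -/
theorem isResponse_trainResponse {T : ℝ} (hT : 0 < T) {L : ℕ} {c : ℤ → ℂ} {B : ℝ}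
    (hB : ∀ k, ‖c k‖ ≤ B) {x : 𝓢'(ℝ, ℂ)} (hx : IsDiracTrain T c x) {s : SpreadingFunction}
    {σ : ℝ × ℝ → ℂ} (hs : s =ᵐ[volume] σ) (hσm : StronglyMeasurable σ) (hσ1 : Integrable σ)
    (hσ : ∀ p : ℝ × ℝ, p.1 ∉ Ico 0 (L * T) → σ p = 0) {y : OutputSignal}
    (hy : y =ᵐ[volume] trainResponse T L c σ) : IsResponse s x y := by
  intro φ
  set K : ℝ × ℝ → ℂ := fun p => (modulation p.2 (translation p.1 x)) φ with hK
  set F : ℤ → ℝ × ℝ → ℂ := fun k p =>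
    σ p * (c k * (modChar p.2 (p.1 - k * T) * φ (p.1 - k * T))) with hF
  have hsum : ∀ p, HasSum (fun k => F k p) (σ p * K p) := fun p =>
    (hx.hasSum_shift φ p).mul_left (σ p)
  obtain ⟨b, hb, hbφ⟩ := exists_summable_bound hT (L * T) φ
  have hB0 : 0 ≤ B := (norm_nonneg _).trans (hB 0)
  -- This bound, summable in k and integrable in p, justifies all exchanges of sum and integral
  -- below.
  have hFb : ∀ k p, ‖F k p‖ ≤ ‖σ p‖ * (B * b k) := by
    intro k p
    by_cases hp : p.1 ∈ Ico 0 (L * T)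
    · simp only [hF, norm_mul, modChar_norm, one_mul]
      gcongr
      · exact hB k
      · exact hbφ k p.1 (by rw [abs_of_nonneg hp.1]; exact hp.2.le)
    · simp [hF, hσ p hp]
  have hFm : ∀ k, AEStronglyMeasurable (F k) volume := by
    intro k
    refine hσm.aestronglyMeasurable.mul (Continuous.aestronglyMeasurable ?_)
    have h1 : Continuous fun p : ℝ × ℝ => modChar p.2 (p.1 - k * T) :=
      continuous_modChar.comp (by fun_prop : Continuous fun p : ℝ × ℝ => (p.2, p.1 - k * T))
    have h2 : Continuous fun p : ℝ × ℝ => φ (p.1 - k * T) := φ.continuous.comp (by fun_prop)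
    exact continuous_const.mul (h1.mul h2)
  have hFi : ∀ k, Integrable (F k) := fun k =>
    (hσ1.norm.mul_const (B * b k)).mono' (hFm k) (Filter.Eventually.of_forall (hFb k))
  have hFs : Summable fun k => ∫ p, ‖F k p‖ := by
    refine Summable.of_nonneg_of_le (fun k => integral_nonneg fun p => norm_nonneg _) (fun k => ?_)
      ((hb.mul_left B).mul_left (∫ p, ‖σ p‖))
    rw [← integral_mul_const]
    exact integral_mono (hFi k).norm (hσ1.norm.mul_const _) (hFb k)
  have h1 := hasSum_integral_of_summable_integral_norm hFi hFs
  simp only [fun p => (hsum p).tsum_eq] at h1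
  have hKi : Integrable fun p => σ p * K p := by
    refine (hσ1.norm.mul_const (∑' k, B * b k)).mono' ?_ ?_
    · refine aestronglyMeasurable_of_tendsto_ae Filter.atTop
        (f := fun (A : Finset ℤ) p => ∑ k ∈ A, F k p) (fun A => ?_)
        (Filter.Eventually.of_forall fun p => hsum p)
      exact Finset.aestronglyMeasurable_fun_sum _ fun k _ => hFm k
    · refine Filter.Eventually.of_forall fun p => ?_
      rw [← (hsum p).tsum_eq, ← tsum_mul_left]
      exact tsum_of_norm_bounded ((hb.mul_left B).mul_left _).hasSum fun k => hFb k p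
  -- Substituting τ = t + kT moves the k-th sampling point to t, so φ t factors out of the
  -- ν-integral.
  have hshift : ∀ k t ν, F k ((t, ν) + ((k : ℝ) * T, 0)) =
      c k * (σ (t + k * T, ν) * modChar ν t) * φ t := by
    intro k t ν
    simp only [hF, Prod.mk_add_mk, add_zero, add_sub_cancel_right]
    ring
  have hFi' : ∀ k : ℤ, Integrable (fun p : ℝ × ℝ => F k (p + ((k : ℝ) * T, 0)))
      ((volume : Measure ℝ).prod volume) := fun k => (hFi k).comp_add_right _
  have hinner : ∀ (k : ℤ) (t : ℝ), ∫ ν, F k ((t, ν) + ((k : ℝ) * T, 0)) =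
      c k * (∫ ν, σ (t + k * T, ν) * modChar ν t) * φ t := by
    intro k t
    simp_rw [hshift]
    rw [integral_mul_const, integral_const_mul]
  have hFint : ∀ k : ℤ, ∫ p, F k p = ∫ t, c k * (∫ ν, σ (t + k * T, ν) * modChar ν t) * φ t := by
    intro k
    rw [← integral_add_right_eq_self (F k) ((k : ℝ) * T, 0), Measure.volume_eq_prod,
      integral_prod _ (hFi' k)]
    simp_rw [hinner]
  have hGi : ∀ k : ℤ, Integrable fun t : ℝ =>
      c k * (∫ ν, σ (t + k * T, ν) * modChar ν t) * φ t := by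
    intro k
    have := (hFi' k).integral_prod_left
    simpa only [hinner] using this
  have hGs : Summable fun k : ℤ =>
      ∫ t : ℝ, ‖c k * (∫ ν, σ (t + k * T, ν) * modChar ν t) * φ t‖ := by
    refine Summable.of_nonneg_of_le (fun k => integral_nonneg fun p => norm_nonneg _)
      (fun k => ?_) hFs
    rw [← integral_add_right_eq_self (fun p => ‖F k p‖) ((k : ℝ) * T, 0), Measure.volume_eq_prod,
      integral_prod _ (hFi' k).norm]
    refine integral_mono (hGi k).norm (hFi' k).norm.integral_prod_left fun t => ?_
    simp only
    rw [← hinner]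
    exact norm_integral_le_integral_norm _
  have h2 := hasSum_integral_of_summable_integral_norm hGi hGs
  simp only [tsum_mul_right, tsum_eq_trainResponse hT c hσ] at h2
  have e1 : (fun p : ℝ × ℝ => s p * K p) =ᵐ[volume] fun p => σ p * K p := by
    filter_upwards [hs] with p hp
    rw [hp]
  have e2 : (fun t : ℝ => y t * φ t) =ᵐ[volume] fun t => trainResponse T L c σ t * φ t := by
    filter_upwards [hy] with t ht
    rw [ht]
  refine ⟨hKi.congr e1.symm, ?_⟩
  rw [integral_congr_ae e1, integral_congr_ae e2]
  refine h1.unique ?_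
  simpa only [hFint] using h2

/-! ### Energy bounds for Dirac train responses -/

theorem lintegral_enorm_sq_eq {α : Type*} [MeasurableSpace α] {μ : Measure α} (f : Lp ℂ 2 μ) :
    ∫⁻ a, ‖f a‖ₑ ^ 2 ∂μ = ENNReal.ofReal (‖f‖ ^ 2) := by
  have h := eLpNorm_nnreal_pow_eq_lintegral (f := f) (μ := μ) (p := 2) two_ne_zero
  rw [Lp.norm_def, ← ENNReal.toReal_pow, ENNReal.ofReal_toReal
    (ENNReal.pow_ne_top (Lp.eLpNorm_ne_top f))]
  simpa using h.symm

/-- If any `L` columns of the Gabor matrix are independent, then the Dirac train with the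
corresponding weights has responses comparable to the spreading functions on `L` cells. -/
theorem exists_boundedResponses {T : ℝ} (hT : 0 < T) {L : ℕ} (hL : 1 ≤ L) {c : ℤ → ℂ} {B : ℝ}
    (hB : ∀ k, ‖c k‖ ≤ B) (hc : ∀ k, c (k + L) = c k) {x : 𝓢'(ℝ, ℂ)} (hx : IsDiracTrain T c x)
    (h : ∀ Γ : Finset (Fin L × Fin L), Γ.card ≤ L → ∀ v : Fin L × Fin L → ℂ, (∀ i ∉ Γ, v i = 0) →
      (∀ p, ∑ i, gaborEntry L c p i * v i = 0) → v = 0) :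
    ∃ α β : ℝ, 0 < α ∧ α ≤ β ∧ ∀ Γ : Finset (Fin L × Fin L), Γ.card ≤ L →
      BoundedResponses x α β (supportedOperators (region T L Γ)) := by
  obtain ⟨K, hK, hbd⟩ := exists_gabor_bounds h
  have hL' : (0 : ℝ) < L := by exact_mod_cast hL
  set l : ℝ := 1 / (T * L) with hldef
  have hl : 0 < l := one_div_pos.2 (mul_pos hT hL')
  -- K' ≥ 1 ensures that the lower constant √(l / K') does not exceed the upper one √(l K').
  set K' := max K 1
  have hK' : 0 < K' := lt_max_of_lt_left hK
  refine ⟨Real.sqrt (l / K'), Real.sqrt (l * K'), by positivity, ?_, fun Γ hΓ s hs => ?_⟩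
  · apply Real.sqrt_le_sqrt
    rw [div_le_iff₀ hK']
    have : 1 ≤ K' := le_max_right _ _
    nlinarith [mul_le_mul this this zero_le_one hK'.le]
  have hΓm := measurableSet_region T L Γ
  -- A representative vanishing everywhere off the region, so that the matrix bounds apply at every
  -- (u, η) and not merely almost everywhere.
  set σ : ℝ × ℝ → ℂ := (region T L Γ).indicator s with hσdef
  have hσm : StronglyMeasurable σ := (Lp.stronglyMeasurable s).indicator hΓm
  have hσ2 : MemLp σ 2 := (Lp.memLp s).indicator hΓm
  have hσ0 : ∀ p ∉ region T L Γ, σ p = 0 := fun p hp => indicator_of_notMem hp _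
  have hsσ : s =ᵐ[volume] σ := by
    filter_upwards [hs] with p hp
    by_cases hpM : p ∈ region T L Γ
    · rw [hσdef, indicator_of_mem hpM]
    · rw [hσ0 p hpM, hp hpM]
  have hσ1 : Integrable σ := by
    rw [hσdef, integrable_indicator_iff hΓm]
    have hfin : IsFiniteMeasure ((volume : Measure (ℝ × ℝ)).restrict (region T L Γ)) := by
      refine ⟨?_⟩
      rw [Measure.restrict_apply_univ]
      refine (measure_biUnion_finset_le _ _).trans_lt ?_
      simp [volume_cell hT hL, ENNReal.mul_lt_top]
    exact ((Lp.memLp s).restrict _).integrable one_le_two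
  have hbox : ∀ p : ℝ × ℝ, ¬(p.1 ∈ Ico 0 (L * T) ∧ p.2 ∈ Ico 0 (L * l)) → σ p = 0 :=
    fun p hp => hσ0 p fun h => hp (region_subset_box hT hL h)
  have hcell : ∀ u ∈ Ico 0 T, ∀ η ∈ Ico 0 l, ∀ i ∉ Γ,
      modChar ((i.2 : ℕ) * l) u * σ (u + (i.1 : ℕ) * T, η + (i.2 : ℕ) * l) = 0 := by
    intro u hu η hη i hi
    rw [hσ0, mul_zero]
    intro hmem
    obtain ⟨j, hj, hmem⟩ := mem_region.1 hmem
    refine hi ?_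
    have hmi : (u + (i.1 : ℕ) * T, η + (i.2 : ℕ) * l) ∈ cell T L i.1 i.2 := by
      have e2 : ((i.2 : ℕ) : ℝ) / (T * L) = (i.2 : ℕ) * l := by rw [hldef]; ring
      have e3 : (((i.2 : ℕ) : ℝ) + 1) / (T * L) = (i.2 : ℕ) * l + l := by rw [hldef]; ring
      rw [cell, mem_prod, e2, e3]
      refine ⟨⟨?_, ?_⟩, ⟨?_, ?_⟩⟩ <;> simp only <;> linarith [hu.1, hu.2, hη.1, hη.2]
    by_contra hne
    exact Set.disjoint_left.1 (cell_disjoint hT hL (fun h : j = i => hne (h ▸ hj))) hmem hmi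
  set E := ∫⁻ p, ‖σ p‖ₑ ^ 2 with hE
  set E' := ∫⁻ t, ‖trainResponse T L c σ t‖ₑ ^ 2 with hE'
  have hEs : E = ENNReal.ofReal (‖s‖ ^ 2) := by
    rw [← lintegral_enorm_sq_eq]
    refine lintegral_congr_ae ?_
    filter_upwards [hsσ] with p hp
    rw [hp]
  have eE := lintegral_eq_cells hT hL hσm hbox
  have eE' := lintegral_trainResponse hT hL hc hσm hσ2 fun p hp => hbox p fun h => hp h.2
  rw [← hldef, ← hE] at eE
  rw [← hldef, ← hE'] at eE'
  have hup : E' ≤ ENNReal.ofReal (l * K') * E := by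
    rw [eE', eE, ENNReal.ofReal_mul hl.le, mul_assoc]
    gcongr
    rw [← lintegral_const_mul' _ _ ENNReal.ofReal_ne_top]
    refine setLIntegral_mono' measurableSet_Ico fun u hu => ?_
    rw [← lintegral_const_mul' _ _ ENNReal.ofReal_ne_top]
    refine setLIntegral_mono' measurableSet_Ico fun η hη => ?_
    refine ((hbd Γ hΓ _ (hcell u hu η hη)).2).trans ?_
    simp only [enorm_modChar_mul]
    gcongr
    exact le_max_left _ _
  have hlow : ENNReal.ofReal l * E ≤ ENNReal.ofReal K' * E' := by
    rw [eE', eE, mul_left_comm]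
    gcongr
    rw [← lintegral_const_mul' _ _ ENNReal.ofReal_ne_top]
    refine setLIntegral_mono' measurableSet_Ico fun u hu => ?_
    rw [← lintegral_const_mul' _ _ ENNReal.ofReal_ne_top]
    refine setLIntegral_mono' measurableSet_Ico fun η hη => ?_
    have := (hbd Γ hΓ _ (hcell u hu η hη)).1
    simp only [enorm_modChar_mul] at this
    refine this.trans ?_
    gcongr
    exact le_max_left _ _
  have hmem : MemLp (trainResponse T L c σ) 2 := by
    refine ⟨(stronglyMeasurable_trainResponse T L c hσm).aestronglyMeasurable, ?_⟩
    rw [eLpNorm_lt_top_iff_lintegral_rpow_enorm_lt_top two_ne_zero ENNReal.ofNat_ne_top]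
    have : E' < ⊤ := hup.trans_lt (by rw [hEs]; exact ENNReal.mul_lt_top (by simp) (by simp))
    simpa using this
  set y : OutputSignal := hmem.toLp _ with hydef
  have hy : y =ᵐ[volume] trainResponse T L c σ := hmem.coeFn_toLp
  have hEy : E' = ENNReal.ofReal (‖y‖ ^ 2) := by
    rw [← lintegral_enorm_sq_eq]
    refine lintegral_congr_ae ?_
    filter_upwards [hy] with t ht
    rw [ht]
  rw [hEs, hEy, ← ENNReal.ofReal_mul (by positivity),
    ENNReal.ofReal_le_ofReal_iff (by positivity)] at hup
  rw [hEs, hEy, ← ENNReal.ofReal_mul (by positivity), ← ENNReal.ofReal_mul (by positivity),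
    ENNReal.ofReal_le_ofReal_iff (by positivity)] at hlow
  refine ⟨y, isResponse_trainResponse hT hB hx hsσ hσm hσ1 (fun p hp => hbox p fun h => hp h.1) hy,
    ?_, ?_⟩
  · refine le_of_sq_le_sq ?_ (norm_nonneg _)
    rw [mul_pow, Real.sq_sqrt (by positivity), div_mul_eq_mul_div, div_le_iff₀ hK']
    linarith
  · refine le_of_sq_le_sq ?_ (by positivity)
    rw [mul_pow, Real.sq_sqrt (by positivity)]
    exact hup

/-- Operators of area at most `1/2` are stably identified by a weighted Dirac train. -/
theorem exists_diracTrain_stablyIdentifies {T : ℝ} (hT : 0 < T) {L : ℕ} (hL : 1 ≤ L) {Δ : ℝ}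
    (hΔ : Δ ≤ 1 / 2) : ∃ (c : ℤ → ℂ) (x : 𝓢'(ℝ, ℂ)), (∀ k : ℤ, c (k + L) = c k) ∧
      IsDiracTrain T c x ∧ StablyIdentifies x (blindOperators T L Δ) := by
  obtain ⟨c, hc, h⟩ := exists_window hL
  obtain ⟨B, hB⟩ : ∃ B, ∀ k, ‖c k‖ ≤ B := by
    refine ⟨∑ q ∈ Finset.Ico (0 : ℤ) L, ‖c q‖, fun k => ?_⟩
    have hL' : (0 : ℤ) < L := by exact_mod_cast hL
    have e : c k = c (k % L) := by
      rw [Int.emod_def, mul_comm, periodic_sub_mul hc]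
    rw [e]
    exact Finset.single_le_sum (f := fun q => ‖c q‖) (fun _ _ => norm_nonneg _)
      (Finset.mem_Ico.2 ⟨Int.emod_nonneg _ hL'.ne', Int.emod_lt_of_pos _ hL'⟩)
  obtain ⟨x, hx⟩ := exists_diracTrain hT hB
  obtain ⟨α, β, hα, hαβ, hb⟩ := exists_boundedResponses hT hL hB hc hx h
  exact ⟨c, x, hc, hx, stablyIdentifies_blindOperators hT hL hΔ hα hαβ hb⟩

section

/-! ### Covariance of responses -/

variable {x : 𝓢'(ℝ, ℂ)} {s s' : SpreadingFunction} {y y' : OutputSignal}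

/-- Because M_h M_ν = M_{ν+h}, modulating the output translates the spreading function in ν. -/
theorem IsResponse.shift_frequency (h : ℝ) (hr : IsResponse s x y)
    (hs : s' =ᵐ[volume] fun p => s (p - (0, h))) (hy : y' =ᵐ[volume] fun t => modChar h t * y t) :
    IsResponse s' x y' := by
  intro φ
  set φ' : 𝓢(ℝ, ℂ) := SchwartzMap.smulLeftCLM ℂ (modChar h) φ
  have hφ' : ∀ t, φ' t = modChar h t * φ t := fun t => by
    simp [φ', SchwartzMap.smulLeftCLM_apply_apply (modChar_hasTemperateGrowth h)]
  set K : ℝ × ℝ → ℂ := fun p => (modulation p.2 (translation p.1 x)) φ with hK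
  have hKs : ∀ p : ℝ × ℝ, K (p + (0, h)) = (modulation p.2 (translation p.1 x)) φ' := by
    intro p
    rw [hK, modulation_translation_apply]
    simp only [modulation_translation_apply]
    congr 1
    ext t
    simp only [shiftedTest_apply, hφ', Prod.fst_add, Prod.snd_add, add_zero, modChar_add_left]
    ring
  have e1 : (fun p => s' p * K p) =ᵐ[volume]
      fun p => (fun q => s q * K (q + (0, h))) (p - (0, h)) := by
    filter_upwards [hs] with p hp
    simp only [hp, sub_add_cancel]
  have e2 : (fun t => y' t * φ t) =ᵐ[volume] fun t => y t * φ' t := by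
    filter_upwards [hy] with t ht
    rw [ht, hφ']
    ring
  obtain ⟨h1, h2⟩ := hr φ'
  simp only [← hKs] at h1 h2
  refine ⟨(h1.comp_sub_right (0, h)).congr e1.symm, ?_⟩
  rw [integral_congr_ae e1, integral_congr_ae e2, ← h2]
  exact integral_sub_right_eq_self (fun q => s q * K (q + (0, h))) (0, h)

/-- Because T_h M_ν T_τ = e^{-2πiνh} M_ν T_{τ+h}, translating the output translates the spreading
function in τ; the commutation phase is the extra character in ν. -/
theorem IsResponse.shift_time (h : ℝ) (hr : IsResponse s x y)
    (hs : s' =ᵐ[volume] fun p => modChar (-h) p.2 * s (p - (h, 0)))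
    (hy : y' =ᵐ[volume] fun t => y (t - h)) :
    IsResponse s' x y' := by
  intro φ
  set φ' : 𝓢(ℝ, ℂ) := SchwartzMap.compSubConstCLM ℂ (-h) φ
  have hφ' : ∀ t, φ' t = φ (t + h) := fun t => by simp [φ']
  set K : ℝ × ℝ → ℂ := fun p => (modulation p.2 (translation p.1 x)) φ with hK
  have hKs : ∀ p : ℝ × ℝ, modChar (-h) p.2 * K (p + (h, 0)) =
      (modulation p.2 (translation p.1 x)) φ' := by
    intro p
    rw [hK, modulation_translation_apply]
    simp only [modulation_translation_apply]
    rw [← smul_eq_mul, ← map_smul]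
    congr 1
    ext t
    simp only [shiftedTest_apply, hφ', Prod.fst_add, Prod.snd_add, add_zero, smul_apply,
      smul_eq_mul]
    rw [← add_assoc, modChar_add_right p.2 (t + p.1) h, modChar_comm p.2 h]
    linear_combination (modChar p.2 (t + p.1) * φ (t + p.1 + h)) * modChar_neg_mul_self h p.2
  have e1 : (fun p => s' p * K p) =ᵐ[volume]
      fun p => (fun q : ℝ × ℝ => s q * (modChar (-h) q.2 * K (q + (h, 0)))) (p - (h, 0)) := by
    filter_upwards [hs] with p hp
    simp only [hp, sub_add_cancel, Prod.snd_sub, sub_zero]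
    ring
  have e2 : (fun t => y' t * φ t) =ᵐ[volume] fun t => (fun u => y u * φ' u) (t - h) := by
    filter_upwards [hy] with t ht
    simp only [ht, hφ', sub_add_cancel]
  obtain ⟨h1, h2⟩ := hr φ'
  simp only [← hKs] at h1 h2
  refine ⟨(h1.comp_sub_right (h, 0)).congr e1.symm, ?_⟩
  rw [integral_congr_ae e1, integral_congr_ae e2,
    integral_sub_right_eq_self (fun u => y u * φ' u) h, ← h2]
  exact integral_sub_right_eq_self
    (fun q : ℝ × ℝ => s q * (modChar (-h) q.2 * K (q + (h, 0)))) (h, 0)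

/-! ### Bump functions -/

/-- `ψ` is a Lipschitz bump function that vanishes outside `[a + δ, b - δ]` and is `1` on
`[a + 2δ, b - 2δ]`. -/
structure IsBump (ψ : ℝ → ℝ) (a b δ : ℝ) : Prop where
  nonneg : ∀ t, 0 ≤ ψ t
  le_one : ∀ t, ψ t ≤ 1
  eq_zero : ∀ t ∉ Icc (a + δ) (b - δ), ψ t = 0
  eq_one : ∀ t ∈ Icc (a + 2 * δ) (b - 2 * δ), ψ t = 1
  lipschitz : ∀ t u, |ψ t - ψ u| ≤ |t - u| / δ

theorem exists_isBump (a b : ℝ) {δ : ℝ} (hδ : 0 < δ) : ∃ ψ, IsBump ψ a b δ := by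
  refine ⟨fun t => max 0 (min 1 (min (t - a - δ) (b - δ - t) / δ)), fun t => le_max_left _ _,
    fun t => max_le zero_le_one (min_le_left _ _), fun t ht => ?_, fun t ht => ?_, fun t u => ?_⟩
  · apply max_eq_left
    refine (min_le_right _ _).trans (div_nonpos_of_nonpos_of_nonneg ?_ hδ.le)
    by_contra! h
    rw [lt_min_iff] at h
    exact ht ⟨by linarith [h.1], by linarith [h.2]⟩
  · have : 1 ≤ min (t - a - δ) (b - δ - t) / δ := by
      rw [le_div_iff₀ hδ, one_mul, le_min_iff]
      exact ⟨by linarith [ht.1], by linarith [ht.2]⟩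
    rw [min_eq_left this]
    exact max_eq_right zero_le_one
  · have h1 : |min (t - a - δ) (b - δ - t) - min (u - a - δ) (b - δ - u)| ≤ |t - u| := by
      refine (abs_min_sub_min_le_max _ _ _ _).trans (max_le (le_of_eq ?_) (le_of_eq ?_))
      · congr 1; ring
      · rw [abs_sub_comm]; congr 1; ring
    have h2 : ∀ p q : ℝ, |max 0 (min 1 p) - max 0 (min 1 q)| ≤ |p - q| := by
      intro p q
      refine (abs_max_sub_max_le_max _ _ _ _).trans (max_le (by simp) ?_)
      exact (abs_min_sub_min_le_max _ _ _ _).trans (max_le (by simp) le_rfl)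
    refine (h2 _ _).trans ?_
    rw [← sub_div, abs_div, abs_of_pos hδ]
    gcongr

theorem IsBump.continuous {ψ : ℝ → ℝ} {a b δ : ℝ} (h : IsBump ψ a b δ) (hδ : 0 < δ) :
    Continuous ψ := by
  refine (LipschitzWith.of_dist_le_mul (K := (1 / δ).toNNReal) fun t u => ?_).continuous
  rw [Real.coe_toNNReal _ (by positivity), Real.dist_eq, Real.dist_eq]
  exact (h.lipschitz t u).trans_eq (by ring)

theorem IsBump.norm_le_one {ψ : ℝ → ℝ} {a b δ : ℝ} (h : IsBump ψ a b δ) (t : ℝ) :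
    ‖(ψ t : ℂ)‖ ≤ 1 := by
  rw [Complex.norm_real, Real.norm_of_nonneg (h.nonneg t)]
  exact h.le_one t

theorem norm_modChar_sub_one_le (ν t : ℝ) : ‖modChar ν t - 1‖ ≤ 2 * Real.pi * |ν * t| := by
  have h := Real.norm_exp_I_mul_ofReal_sub_one_le (x := 2 * Real.pi * (ν * t))
  have e : modChar ν t = Complex.exp (Complex.I * (2 * Real.pi * (ν * t) : ℝ)) := by
    rw [modChar]
    push_cast
    ring_nf
  rw [e]
  refine h.trans_eq ?_
  rw [Real.norm_eq_abs, abs_mul, abs_of_pos Real.two_pi_pos]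

/-- On the unit circle, small arcs are controlled by chords. -/
theorem le_norm_modChar_sub_one {ν t : ℝ} (h : |ν * t| ≤ 1 / 2) :
    4 * |ν * t| ≤ ‖modChar ν t - 1‖ := by
  have e : modChar ν t = Complex.exp (Complex.I * (2 * Real.pi * (ν * t) : ℝ)) := by
    rw [modChar]
    push_cast
    ring_nf
  rw [e, Complex.norm_exp_I_mul_ofReal_sub_one, Real.norm_eq_abs, abs_mul 2, abs_two]
  have h1 : |Real.sin (2 * Real.pi * (ν * t) / 2)| = Real.sin (Real.pi * |ν * t|) := by
    rw [show 2 * Real.pi * (ν * t) / 2 = Real.pi * (ν * t) by ring,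
      ← abs_of_nonneg (Real.sin_nonneg_of_nonneg_of_le_pi (x := Real.pi * |ν * t|) (by positivity)
        (by nlinarith [Real.pi_pos]))]
    rcases abs_cases (ν * t) with h' | h' <;> rw [h'.1]
    rw [mul_neg, Real.sin_neg, abs_neg]
  rw [h1]
  have h2 := Real.mul_le_sin (x := Real.pi * |ν * t|) (by positivity) (by nlinarith [Real.pi_pos])
  have h3 : 2 / Real.pi * (Real.pi * |ν * t|) = 2 * |ν * t| := by
    field_simp
  linarith

/-! ### Time-frequency atoms and the localization of their responses -/

/-- The time-frequency atom `ψ₁(τ) ψ₂(ν) e^{2πi(bτ - aν)}`. -/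
def atom (ψ₁ ψ₂ : ℝ → ℝ) (a b : ℝ) (p : ℝ × ℝ) : ℂ :=
  ψ₁ p.1 * ψ₂ p.2 * (modChar b p.1 * modChar (-a) p.2)

section Atom

variable {ψ₁ ψ₂ : ℝ → ℝ} {a₁ b₁ δ₁ a₂ b₂ δ₂ : ℝ}

theorem continuous_atom (h₁ : IsBump ψ₁ a₁ b₁ δ₁) (h₂ : IsBump ψ₂ a₂ b₂ δ₂) (hδ₁ : 0 < δ₁)
    (hδ₂ : 0 < δ₂) (a b : ℝ) : Continuous (atom ψ₁ ψ₂ a b) := by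
  have c₁ := h₁.continuous hδ₁
  have c₂ := h₂.continuous hδ₂
  have c₃ : Continuous fun p : ℝ × ℝ => modChar b p.1 :=
    continuous_modChar.comp (by fun_prop : Continuous fun p : ℝ × ℝ => (b, p.1))
  have c₄ : Continuous fun p : ℝ × ℝ => modChar (-a) p.2 :=
    continuous_modChar.comp (by fun_prop : Continuous fun p : ℝ × ℝ => (-a, p.2))
  unfold atom
  fun_prop

theorem atom_eq_zero (h₁ : IsBump ψ₁ a₁ b₁ δ₁) (h₂ : IsBump ψ₂ a₂ b₂ δ₂) (a b : ℝ) {p : ℝ × ℝ}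
    (hp : p ∉ Icc (a₁ + δ₁) (b₁ - δ₁) ×ˢ Icc (a₂ + δ₂) (b₂ - δ₂)) : atom ψ₁ ψ₂ a b p = 0 := by
  rw [mem_prod, not_and_or] at hp
  rcases hp with hp | hp
  · simp [atom, h₁.eq_zero _ hp]
  · simp [atom, h₂.eq_zero _ hp]

theorem memLp_atom (h₁ : IsBump ψ₁ a₁ b₁ δ₁) (h₂ : IsBump ψ₂ a₂ b₂ δ₂) (hδ₁ : 0 < δ₁)
    (hδ₂ : 0 < δ₂) (a b : ℝ) : MemLp (atom ψ₁ ψ₂ a b) 2 :=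
  (continuous_atom h₁ h₂ hδ₁ hδ₂ a b).memLp_of_hasCompactSupport
    (HasCompactSupport.intro (isCompact_Icc.prod isCompact_Icc) fun _ hp =>
      atom_eq_zero h₁ h₂ a b hp)

end Atom

theorem norm_sq_le_of_bound {f : SpreadingFunction} {M : Set (ℝ × ℝ)} (hM : MeasurableSet M)
    {c V : ℝ} (hV : 0 ≤ V) (hMV : volume M ≤ ENNReal.ofReal V) (h : ∀ᵐ p, ‖f p‖ ≤ c)
    (h0 : ∀ᵐ p, p ∉ M → f p = 0) : ‖f‖ ^ 2 ≤ c ^ 2 * V := by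
  rw [← ENNReal.ofReal_le_ofReal_iff (by positivity), ← lintegral_enorm_sq_eq,
    ENNReal.ofReal_mul (by positivity)]
  calc ∫⁻ p, ‖f p‖ₑ ^ 2 ≤ ∫⁻ p, M.indicator (fun _ => ENNReal.ofReal (c ^ 2)) p := by
        refine lintegral_mono_ae ?_
        filter_upwards [h, h0] with p hp hp0
        by_cases hpM : p ∈ M
        · rw [indicator_of_mem hpM, enorm_sq_eq_ofReal]
          exact ENNReal.ofReal_le_ofReal (pow_le_pow_left₀ (norm_nonneg _) hp 2)
        · rw [indicator_of_notMem hpM, hp0 hpM]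
          simp
    _ = ENNReal.ofReal (c ^ 2) * volume M := lintegral_indicator_const hM _
    _ ≤ _ := by gcongr

/-- The signal `y` is localized near the point `(a, b)` of the time-frequency plane. -/
structure IsLocalized (C h₀ a b : ℝ) (y : OutputSignal) : Prop where
  norm_le : ‖y‖ ≤ C
  time : ∀ h, 0 < h → h < h₀ →
    ∫⁻ t, ‖modChar h (t - a) * y t - y t‖ₑ ^ 2 ≤ ENNReal.ofReal ((C * h) ^ 2)
  frequency : ∀ h, 0 < h → h < h₀ →
    ∫⁻ t, ‖modChar b h * y (t - h) - y t‖ₑ ^ 2 ≤ ENNReal.ofReal ((C * h) ^ 2)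

theorem lintegral_sub_le {y₁ y₂ : OutputSignal} {f : ℝ → ℂ}
    (h : f =ᵐ[volume] y₁) {c : ℝ} (hc : ‖y₁ - y₂‖ ≤ c) :
    ∫⁻ t, ‖f t - y₂ t‖ₑ ^ 2 ≤ ENNReal.ofReal (c ^ 2) := by
  have e : ∫⁻ t, ‖f t - y₂ t‖ₑ ^ 2 = ∫⁻ t, ‖(y₁ - y₂) t‖ₑ ^ 2 := by
    refine lintegral_congr_ae ?_
    filter_upwards [h, Lp.coeFn_sub y₁ y₂] with t h1 h2
    rw [h2, Pi.sub_apply, h1]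
  rw [e, lintegral_enorm_sq_eq]
  exact ENNReal.ofReal_le_ofReal (pow_le_pow_left₀ (norm_nonneg _) hc 2)

/-- By linearity and uniqueness, y' - y is the response of s' - s, whose L² norm is at most c √V.
Only the upper estimate on responses is used. -/
theorem BoundedResponses.norm_sub_le {α β : ℝ} {M : Set (ℝ × ℝ)} (hβ : 0 < β)
    (hbd : BoundedResponses x α β (supportedOperators M)) (hr : IsResponse s x y)
    (hr' : IsResponse s' x y') {N : Set (ℝ × ℝ)} (hNM : N ⊆ M) (hN : MeasurableSet N)
    {V : ℝ} (hV : 0 ≤ V) (hNV : volume N ≤ ENNReal.ofReal V) {c : ℝ} (hc : 0 ≤ c)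
    (h : ∀ᵐ p, ‖s' p - s p‖ ≤ c) (h0 : ∀ᵐ p, p ∉ N → s' p - s p = 0) :
    ‖y' - y‖ ≤ β * (c * Real.sqrt V) := by
  have e := Lp.coeFn_sub s' s
  obtain ⟨z, hz, -, hzβ⟩ := hbd (s' - s) (by
    rw [supportedOperators, mem_ofPred_eq]
    filter_upwards [e, h0] with p hp hp0 hpM
    rw [hp, Pi.sub_apply, hp0 fun h => hpM (hNM h)])
  rw [(hr'.sub hr).unique hz]
  refine hzβ.trans (mul_le_mul_of_nonneg_left ?_ hβ.le)
  refine le_of_sq_le_sq ?_ (by positivity)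
  rw [mul_pow, Real.sq_sqrt hV]
  refine norm_sq_le_of_bound hN hV hNV ?_ ?_
  · filter_upwards [e, h] with p hp hp0
    rwa [hp]
  · filter_upwards [e, h0] with p hp hp0 hpM
    rw [hp, Pi.sub_apply, hp0 hpM]

/-- Responses to time-frequency atoms are uniformly localized. -/
theorem exists_isLocalized {α β : ℝ} {M : Set (ℝ × ℝ)} (hβ : 0 < β)
    (hbd : BoundedResponses x α β (supportedOperators M)) {ψ₁ ψ₂ : ℝ → ℝ}
    {a₁ b₁ δ₁ a₂ b₂ δ₂ : ℝ} (h₁ : IsBump ψ₁ a₁ b₁ δ₁) (h₂ : IsBump ψ₂ a₂ b₂ δ₂) (hδ₁ : 0 < δ₁)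
    (hδ₂ : 0 < δ₂) (hM : Ico a₁ b₁ ×ˢ Ico a₂ b₂ ⊆ M) :
    ∃ C h₀ : ℝ, 0 < h₀ ∧ ∀ (a b : ℝ) (s : SpreadingFunction) (y : OutputSignal),
      s =ᵐ[volume] atom ψ₁ ψ₂ a b → IsResponse s x y → IsLocalized C h₀ a b y := by
  set N : Set (ℝ × ℝ) := Ico a₁ b₁ ×ˢ Ico a₂ b₂ with hNdef
  have hN : MeasurableSet N := measurableSet_Ico.prod measurableSet_Ico
  set V : ℝ := (volume N).toReal
  have hV : 0 ≤ V := ENNReal.toReal_nonneg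
  have hNV : volume N ≤ ENNReal.ofReal V := by
    rw [ENNReal.ofReal_toReal]
    rw [hNdef, Measure.volume_eq_prod, Measure.prod_prod, Real.volume_Ico, Real.volume_Ico]
    exact ENNReal.mul_ne_top ENNReal.ofReal_ne_top ENNReal.ofReal_ne_top
  -- D bounds |ν| on the support. The terms of c cover, in order, the norm of an atom, the slopes of
  -- the two bumps, and the commutation phase of a time shift; none depends on a or b.
  set D : ℝ := |a₂| + |b₂| with hD
  set c : ℝ := 1 + 1 / δ₁ + 1 / δ₂ + 2 * Real.pi * D with hc
  have hc0 : 0 ≤ c := by positivity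
  have hz : ∀ (a b : ℝ) (p q : ℝ × ℝ), p ∉ N → |p.1 - q.1| < δ₁ → |p.2 - q.2| < δ₂ →
      atom ψ₁ ψ₂ a b q = 0 := by
    intro a b p q hp h1 h2
    refine atom_eq_zero h₁ h₂ a b fun hq => hp ?_
    rw [mem_prod, mem_Icc, mem_Icc] at hq
    rw [abs_lt] at h1 h2
    rw [hNdef, mem_prod, mem_Ico, mem_Ico]
    exact ⟨⟨by linarith [hq.1.1], by linarith [hq.1.2]⟩, ⟨by linarith [hq.2.1], by linarith [hq.2.2]⟩⟩
  -- Shifts shorter than the margins of the bumps keep the atom inside the rectangle N.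
  refine ⟨β * (c * Real.sqrt V), min δ₁ δ₂, lt_min hδ₁ hδ₂, fun a b s y hs hr => ?_⟩
  have hchar : ∀ p : ℝ × ℝ, ‖modChar b p.1 * modChar (-a) p.2‖ = 1 := fun p => by
    rw [norm_mul, modChar_norm, modChar_norm, one_mul]
  refine ⟨?_, fun h hh hh0 => ?_, fun h hh hh0 => ?_⟩
  · have hr0 := hbd.norm_sub_le (s := 0) (y := 0) hβ isResponse_zero hr hM hN hV hNV
      (c := c) hc0 ?_ ?_
    · simpa using hr0
    · filter_upwards [hs, Lp.coeFn_zero ℂ 2 (volume : Measure (ℝ × ℝ))] with p hp hp0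
      rw [hp, hp0, Pi.zero_apply, sub_zero, atom, norm_mul, norm_mul, hchar, mul_one]
      have := mul_le_one₀ (h₁.norm_le_one p.1) (norm_nonneg _) (h₂.norm_le_one p.2)
      have : 0 ≤ 1 / δ₁ + 1 / δ₂ + 2 * Real.pi * D := by positivity
      linarith
    · filter_upwards [hs, Lp.coeFn_zero ℂ 2 (volume : Measure (ℝ × ℝ))] with p hp hp0 hpN
      rw [hp, hp0, Pi.zero_apply, sub_zero]
      exact hz a b p p hpN (by simpa using hδ₁) (by simpa using hδ₂)
  · have hq := (measurePreserving_sub_right (volume : Measure (ℝ × ℝ)) (0, h))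
    have hs0 : MemLp (fun p => s (p - (0, h))) 2 := (Lp.memLp s).comp_measurePreserving hq
    have hy0 : MemLp (fun t => modChar h t * y t) 2 := by
      have := memLp_modChar_mul (Lp.memLp y) h
      simpa only [modChar_comm] using this
    -- The scalar phase cancels the effect of the shift on the character of the atom, leaving only
    -- the variation of ψ₂; hence the uniformity in a and b.
    have hr1 := (hr.shift_frequency h hs0.coeFn_toLp hy0.coeFn_toLp).const_smul (modChar (-a) h)
    have key := hbd.norm_sub_le (c := c * h) hβ hr hr1 hM hN hV hNV (by positivity) ?_ ?_
    · refine lintegral_sub_le (y₁ := modChar (-a) h • hy0.toLp _) ?_ (key.trans_eq (by ring))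
      filter_upwards [Lp.coeFn_smul (modChar (-a) h) (hy0.toLp _), hy0.coeFn_toLp] with t ht ht'
      rw [ht, Pi.smul_apply, ht', smul_eq_mul, ← mul_assoc, sub_eq_add_neg, modChar_add_right,
        modChar_comm h (-a), mul_comm (modChar h t)]
    all_goals
      filter_upwards [hs, hs0.coeFn_toLp, hq.quasiMeasurePreserving.ae hs,
        Lp.coeFn_smul (modChar (-a) h) (hs0.toLp _)] with p hp1 hp2 hp3 hp4
      rw [hp4, Pi.smul_apply, hp2, hp3, hp1, smul_eq_mul]
    · have e : modChar (-a) h * atom ψ₁ ψ₂ a b (p - (0, h)) - atom ψ₁ ψ₂ a b p =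
          ψ₁ p.1 * ((ψ₂ (p.2 - h) - ψ₂ p.2 : ℝ) : ℂ) * (modChar b p.1 * modChar (-a) p.2) := by
        simp only [atom, Prod.fst_sub, Prod.snd_sub, sub_zero]
        have : modChar (-a) p.2 = modChar (-a) (p.2 - h) * modChar (-a) h := by
          rw [← modChar_add_right, sub_add_cancel]
        rw [this]
        push_cast
        ring
      rw [e, norm_mul, hchar, mul_one, norm_mul, Complex.norm_real (_ - _), Real.norm_eq_abs]
      have h3 := h₂.lipschitz (p.2 - h) p.2
      rw [sub_sub_cancel_left, abs_neg, abs_of_pos hh] at h3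
      have h4 : ‖(ψ₁ p.1 : ℂ)‖ * |ψ₂ (p.2 - h) - ψ₂ p.2| ≤ 1 * (h / δ₂) :=
        mul_le_mul (h₁.norm_le_one _) h3 (abs_nonneg _) zero_le_one
      refine h4.trans ?_
      have : 0 ≤ (1 + 1 / δ₁ + 2 * Real.pi * D) * h := by positivity
      calc 1 * (h / δ₂) ≤ 1 * (h / δ₂) + (1 + 1 / δ₁ + 2 * Real.pi * D) * h := by linarith
        _ = c * h := by rw [hc]; ring
    · intro hpN
      rw [hz a b p p hpN (by simpa using hδ₁) (by simpa using hδ₂), hz a b p (p - (0, h)) hpN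
        (by simpa using hδ₁) (by simpa [abs_of_pos hh] using hh0.trans_le (min_le_right _ _))]
      simp
  · have hq := (measurePreserving_sub_right (volume : Measure (ℝ × ℝ)) (h, 0))
    have hs0 : MemLp (fun p : ℝ × ℝ => modChar (-h) p.2 * s (p - (h, 0))) 2 := by
      have h5 : MemLp (fun p => s (p - (h, 0))) 2 := (Lp.memLp s).comp_measurePreserving hq
      refine h5.of_le (AEStronglyMeasurable.mul ?_ h5.1) (Filter.Eventually.of_forall fun p => ?_)
      · exact (continuous_modChar.comp
          (by fun_prop : Continuous fun p : ℝ × ℝ => (-h, p.2))).aestronglyMeasurable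
      · rw [norm_mul, modChar_norm, one_mul]
    have hy0 : MemLp (fun t => y (t - h)) 2 :=
      (Lp.memLp y).comp_measurePreserving (measurePreserving_sub_right volume h)
    have hr1 := (hr.shift_time h hs0.coeFn_toLp hy0.coeFn_toLp).const_smul (modChar b h)
    have key := hbd.norm_sub_le (c := c * h) hβ hr hr1 hM hN hV hNV (by positivity) ?_ ?_
    · refine lintegral_sub_le (y₁ := modChar b h • hy0.toLp _) ?_ (key.trans_eq (by ring))
      filter_upwards [Lp.coeFn_smul (modChar b h) (hy0.toLp _), hy0.coeFn_toLp] with t ht ht'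
      rw [ht, Pi.smul_apply, ht', smul_eq_mul]
    all_goals
      filter_upwards [hs, hs0.coeFn_toLp, hq.quasiMeasurePreserving.ae hs,
        Lp.coeFn_smul (modChar b h) (hs0.toLp _)] with p hp1 hp2 hp3 hp4
      rw [hp4, Pi.smul_apply, hp2, hp3, hp1, smul_eq_mul]
    · have e : modChar b h * (modChar (-h) p.2 * atom ψ₁ ψ₂ a b (p - (h, 0))) -
            atom ψ₁ ψ₂ a b p =
          (((ψ₁ (p.1 - h) - ψ₁ p.1 : ℝ) : ℂ) * (ψ₂ p.2 * modChar (-h) p.2) +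
            ψ₁ p.1 * (ψ₂ p.2 * (modChar (-h) p.2 - 1))) * (modChar b p.1 * modChar (-a) p.2) := by
        simp only [atom, Prod.fst_sub, Prod.snd_sub, sub_zero]
        have : modChar b p.1 = modChar b (p.1 - h) * modChar b h := by
          rw [← modChar_add_right, sub_add_cancel]
        rw [this]
        push_cast
        ring
      rw [e, norm_mul, hchar, mul_one]
      have h3 := h₁.lipschitz (p.1 - h) p.1
      rw [sub_sub_cancel_left, abs_neg, abs_of_pos hh] at h3
      have h4 : ‖((ψ₁ (p.1 - h) - ψ₁ p.1 : ℝ) : ℂ) * (ψ₂ p.2 * modChar (-h) p.2)‖ ≤ h / δ₁ * 1 := by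
        rw [norm_mul, norm_mul, modChar_norm, mul_one, Complex.norm_real (_ - _), Real.norm_eq_abs]
        exact mul_le_mul h3 (h₂.norm_le_one _) (norm_nonneg _) (by positivity)
      -- The phase from time-shift covariance is not cancelled by a scalar, but ν is bounded on the
      -- support of ψ₂.
      have h5 : ‖(ψ₂ p.2 : ℂ) * (modChar (-h) p.2 - 1)‖ ≤ 2 * Real.pi * D * h := by
        by_cases hp : p.2 ∈ Icc (a₂ + δ₂) (b₂ - δ₂)
        · have h6 : |p.2| ≤ D := by
            rw [abs_le]
            constructor
            · linarith [hp.1, neg_abs_le a₂, abs_nonneg b₂]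
            · linarith [hp.2, le_abs_self b₂, abs_nonneg a₂]
          have h7 := norm_modChar_sub_one_le (-h) p.2
          rw [abs_mul, abs_neg, abs_of_pos hh] at h7
          rw [norm_mul]
          calc _ ≤ 1 * (2 * Real.pi * (h * |p.2|)) :=
                mul_le_mul (h₂.norm_le_one _) h7 (norm_nonneg _) zero_le_one
            _ ≤ 1 * (2 * Real.pi * (h * D)) := by gcongr
            _ = _ := by ring
        · rw [h₂.eq_zero _ hp]
          simp only [Complex.ofReal_zero, zero_mul, norm_zero]
          positivity
      have h8 : ‖(ψ₁ p.1 : ℂ) * (ψ₂ p.2 * (modChar (-h) p.2 - 1))‖ ≤ 1 * (2 * Real.pi * D * h) := by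
        rw [norm_mul]
        exact mul_le_mul (h₁.norm_le_one _) h5 (norm_nonneg _) zero_le_one
      refine (norm_add_le _ _).trans ((add_le_add h4 h8).trans ?_)
      have : 0 ≤ (1 + 1 / δ₂) * h := by positivity
      calc h / δ₁ * 1 + 1 * (2 * Real.pi * D * h)
          ≤ h / δ₁ * 1 + 1 * (2 * Real.pi * D * h) + (1 + 1 / δ₂) * h := by linarith
        _ = c * h := by rw [hc]; ring
    · intro hpN
      rw [hz a b p p hpN (by simpa using hδ₁) (by simpa using hδ₂), hz a b p (p - (h, 0)) hpN
        (by simpa [abs_of_pos hh] using hh0.trans_le (min_le_left _ _)) (by simpa using hδ₂)]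
      simp

end

section

/-! ### Exponentials on an interval -/

theorem conj_modChar (ν t : ℝ) : (starRingEnd ℂ) (modChar ν t) = modChar (-ν) t := by
  rw [modChar, modChar, ← Complex.exp_conj]
  simp [map_ofNat]

theorem integral_modChar_period {P : ℝ} (hP : 0 < P) (a : ℝ) (k : ℤ) :
    ∫ t in Ico a (a + P), modChar (k / P) t = if k = 0 then (P : ℂ) else 0 := by
  rw [restrict_Ico_eq_restrict_Ioc, ← intervalIntegral.integral_of_le (by linarith)]
  split_ifs with hk
  · simp [hk]
  · have hP' : (P : ℂ) ≠ 0 := by exact_mod_cast hP.ne'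
    have hc : 2 * (Real.pi : ℂ) * Complex.I * ((k / P : ℝ) : ℂ) ≠ 0 := by
      have : (k : ℂ) ≠ 0 := by exact_mod_cast hk
      simp [Real.pi_ne_zero, this, hP']
    simp only [modChar]
    rw [integral_exp_mul_complex hc]
    have e : Complex.exp (2 * (Real.pi : ℂ) * Complex.I * ((k / P : ℝ) : ℂ) * ((a + P : ℝ) : ℂ)) =
        Complex.exp (2 * (Real.pi : ℂ) * Complex.I * ((k / P : ℝ) : ℂ) * (a : ℂ)) := by
      have e1 : 2 * (Real.pi : ℂ) * Complex.I * ((k / P : ℝ) : ℂ) * ((a + P : ℝ) : ℂ) =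
          2 * (Real.pi : ℂ) * Complex.I * ((k / P : ℝ) : ℂ) * (a : ℂ) +
            k * (2 * Real.pi * Complex.I) := by
        push_cast
        field_simp
      rw [e1, Complex.exp_add, Complex.exp_int_mul_two_pi_mul_I, mul_one]
    rw [e, sub_self, zero_div]

theorem memLp_exponential (P : ℝ) (n : ℤ) :
    MemLp ((Ico 0 P).indicator fun t => modChar (n / P) t) 2 := by
  rw [memLp_indicator_iff_restrict measurableSet_Ico]
  refine MemLp.of_bound ?_ 1 (Filter.Eventually.of_forall fun t => (modChar_norm _ _).le)
  exact (continuous_modChar.comp (by fun_prop : Continuous fun t : ℝ =>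
    (n / P, t))).aestronglyMeasurable

/-- The normalized exponential of frequency `n / P` on the interval `[0, P)`. -/
def exponential (P : ℝ) (n : ℤ) : OutputSignal :=
  (((Real.sqrt P)⁻¹ : ℝ) : ℂ) • (memLp_exponential P n).toLp _

theorem inner_toLp_exponential (P : ℝ) (n : ℤ) (z : OutputSignal) :
    inner ℂ ((memLp_exponential P n).toLp _) z = ∫ t in Ico 0 P, z t * modChar (-(n / P)) t := by
  rw [L2.inner_def, ← integral_indicator measurableSet_Ico]
  refine integral_congr_ae ?_
  filter_upwards [(memLp_exponential P n).coeFn_toLp] with t ht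
  rw [ht, RCLike.inner_apply]
  by_cases h : t ∈ Ico 0 P
  · rw [indicator_of_mem h, indicator_of_mem h, conj_modChar]
  · rw [indicator_of_notMem h, indicator_of_notMem h]
    simp

theorem inner_exponential (P : ℝ) (n : ℤ) (z : OutputSignal) :
    inner ℂ (exponential P n) z =
      (((Real.sqrt P)⁻¹ : ℝ) : ℂ) * ∫ t in Ico 0 P, z t * modChar (-(n / P)) t := by
  rw [exponential, inner_smul_left, inner_toLp_exponential, Complex.conj_ofReal]

theorem orthonormal_exponential {P : ℝ} (hP : 0 < P) : Orthonormal ℂ (exponential P) := by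
  rw [orthonormal_iff_ite]
  intro m n
  rw [inner_exponential]
  have e : ∫ t in Ico 0 P, exponential P n t * modChar (-(m / P)) t =
      ∫ t in Ico 0 P, (((Real.sqrt P)⁻¹ : ℝ) : ℂ) * modChar ((n - m : ℤ) / P) t := by
    refine setIntegral_congr_ae measurableSet_Ico ?_
    filter_upwards [Lp.coeFn_smul (((Real.sqrt P)⁻¹ : ℝ) : ℂ) ((memLp_exponential P n).toLp _),
      (memLp_exponential P n).coeFn_toLp] with t h1 h2 ht
    rw [exponential, h1, Pi.smul_apply, h2, indicator_of_mem ht, smul_eq_mul, mul_assoc,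
      ← modChar_add_left]
    congr 3
    push_cast
    ring
  have h := integral_modChar_period hP 0 (n - m)
  rw [zero_add] at h
  rw [e, integral_const_mul, h]
  by_cases hmn : m = n
  · subst hmn
    simp only [sub_self, if_true]
    rw [← mul_assoc]
    norm_cast
    rw [← mul_inv, Real.mul_self_sqrt hP.le, inv_mul_cancel₀ hP.ne']
  · rw [if_neg (by omega), if_neg hmn]
    simp

theorem _root_.Orthonormal.norm_sub_sum_inner_sq {H ι : Type*} [NormedAddCommGroup H]
    [InnerProductSpace ℂ H] {e : ι → H} (he : Orthonormal ℂ e) (J : Finset ι) (z : H) :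
    ‖z - ∑ n ∈ J, inner ℂ (e n) z • e n‖ ^ 2 = ‖z‖ ^ 2 - ∑ n ∈ J, ‖inner ℂ (e n) z‖ ^ 2 := by
  have h1 : inner ℂ z (∑ n ∈ J, inner ℂ (e n) z • e n) =
      ((∑ n ∈ J, ‖inner ℂ (e n) z‖ ^ 2 : ℝ) : ℂ) := by
    rw [inner_sum, Complex.ofReal_sum]
    refine Finset.sum_congr rfl fun n _ => ?_
    rw [inner_smul_right, ← inner_conj_symm z, RCLike.mul_conj]
    norm_cast
  have h2 : inner ℂ (∑ n ∈ J, inner ℂ (e n) z • e n) (∑ n ∈ J, inner ℂ (e n) z • e n) =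
      ((∑ n ∈ J, ‖inner ℂ (e n) z‖ ^ 2 : ℝ) : ℂ) := by
    rw [he.inner_sum, Complex.ofReal_sum]
    refine Finset.sum_congr rfl fun n _ => ?_
    rw [RCLike.conj_mul]
    norm_cast
  have h3 : ‖∑ n ∈ J, inner ℂ (e n) z • e n‖ ^ 2 = ∑ n ∈ J, ‖inner ℂ (e n) z‖ ^ 2 := by
    rw [← inner_self_eq_norm_sq (𝕜 := ℂ), h2, RCLike.re_eq_complex_re, Complex.ofReal_re]
  rw [norm_sub_sq (𝕜 := ℂ), h1, h3, RCLike.re_eq_complex_re, Complex.ofReal_re]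
  ring

/-! ### Localized signals are close to few exponentials -/

section Localized

variable {C h₀ a b : ℝ} {y : OutputSignal}

theorem IsLocalized.nonneg (hy : IsLocalized C h₀ a b y) : 0 ≤ C :=
  (norm_nonneg _).trans hy.norm_le

/-- Where |t - a| ≥ R and h|t - a| ≤ 1/2, the factor e^{2πih(t-a)} - 1 has modulus at least 4Rh.
Dividing the time estimate by h² gives a bound independent of h, and h → 0 exhausts the tail. -/
theorem IsLocalized.lintegral_tail_le (hy : IsLocalized C h₀ a b y) (hh₀ : 0 < h₀) {R : ℝ}
    (hR : 0 < R) :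
    ∫⁻ t in {t | R ≤ |t - a|}, ‖y t‖ₑ ^ 2 ≤ ENNReal.ofReal ((C / (4 * R)) ^ 2) := by
  set S : ℕ → Set ℝ := fun k => {t | R ≤ |t - a| ∧ h₀ / (k + 2) * |t - a| ≤ 1 / 2} with hS
  have hU : {t | R ≤ |t - a|} = ⋃ k, S k := by
    ext t
    simp only [mem_iUnion, hS, mem_ofPred_eq, exists_and_left, iff_self_and]
    intro _
    obtain ⟨k, hk⟩ := exists_nat_ge (2 * h₀ * |t - a|)
    refine ⟨k, ?_⟩
    rw [div_mul_eq_mul_div, div_le_iff₀ (by positivity)]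
    linarith
  have hmono : Monotone S := by
    intro k l hkl t ht
    refine ⟨ht.1, le_trans ?_ ht.2⟩
    gcongr
  rw [hU, setLIntegral_iUnion_of_directed _ hmono.directed_le]
  refine iSup_le fun k => ?_
  set h := h₀ / (k + 2) with hh
  have hpos : 0 < h := by positivity
  have hlt : h < h₀ := by
    rw [hh, div_lt_iff₀ (by positivity)]
    nlinarith [(Nat.cast_nonneg k : (0 : ℝ) ≤ k)]
  have hm : MeasurableSet (S k) := by
    have m₁ : Measurable fun t : ℝ => |t - a| := by fun_prop
    exact (measurableSet_le measurable_const m₁).inter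
      (measurableSet_le (m₁.const_mul _) measurable_const)
  have h1 : ENNReal.ofReal ((4 * R * h) ^ 2) * ∫⁻ t in S k, ‖y t‖ₑ ^ 2 ≤
      ENNReal.ofReal ((C * h) ^ 2) := by
    refine le_trans ?_ (hy.time h hpos hlt)
    rw [← lintegral_const_mul' _ _ ENNReal.ofReal_ne_top]
    refine (setLIntegral_mono' hm fun t ht => ?_).trans (setLIntegral_le_lintegral _ _)
    rw [enorm_sq_eq_ofReal, enorm_sq_eq_ofReal, ← ENNReal.ofReal_mul (by positivity), ← mul_pow]
    apply ENNReal.ofReal_le_ofReal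
    apply pow_le_pow_left₀ (by positivity)
    rw [show modChar h (t - a) * y t - y t = (modChar h (t - a) - 1) * y t by ring, norm_mul]
    refine mul_le_mul_of_nonneg_right ?_ (norm_nonneg _)
    have h2 := le_norm_modChar_sub_one (ν := h) (t := t - a) (by
      rw [abs_mul, abs_of_pos hpos]; exact ht.2)
    rw [abs_mul, abs_of_pos hpos] at h2
    nlinarith [ht.1, mul_le_mul_of_nonneg_left ht.1 hpos.le]
  have h3 : (C * h) ^ 2 = (4 * R * h) ^ 2 * (C / (4 * R)) ^ 2 := by
    field_simp
  rw [h3, ENNReal.ofReal_mul (by positivity)] at h1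
  exact (ENNReal.mul_le_mul_iff_right (by
    rw [Ne, ENNReal.ofReal_eq_zero, not_le]; positivity) ENNReal.ofReal_ne_top).1 h1

theorem enorm_add_sq_le (p q : ℂ) : ‖p + q‖ₑ ^ 2 ≤ 2 * ‖p‖ₑ ^ 2 + 2 * ‖q‖ₑ ^ 2 := by
  have e : (2 : ENNReal) = ENNReal.ofReal 2 := by simp
  rw [enorm_sq_eq_ofReal, enorm_sq_eq_ofReal, enorm_sq_eq_ofReal, e,
    ← ENNReal.ofReal_mul zero_le_two, ← ENNReal.ofReal_mul zero_le_two,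
    ← ENNReal.ofReal_add (by positivity) (by positivity)]
  apply ENNReal.ofReal_le_ofReal
  have := pow_le_pow_left₀ (norm_nonneg _) (norm_add_le p q) 2
  nlinarith [sq_nonneg (‖p‖ - ‖q‖)]

variable {P R : ℝ} {χ : ℝ → ℝ}

/-- The cut-off of a localized signal moves little under small translations. -/
theorem IsLocalized.lintegral_cutoff_le (hy : IsLocalized C h₀ a b y) (hR : 1 ≤ R)
    (hχ : IsBump χ 0 P R) {h : ℝ} (hh : 0 < h) (hh₀ : h < h₀) :
    ∫⁻ t, ‖modChar b h * (χ (t - h) * y (t - h)) - χ t * y t‖ₑ ^ 2 ≤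
      ENNReal.ofReal ((2 * C * h) ^ 2) := by
  calc _ ≤ ∫⁻ t, (2 * ‖modChar b h * y (t - h) - y t‖ₑ ^ 2 +
        2 * (ENNReal.ofReal (h ^ 2) * ‖y t‖ₑ ^ 2)) := by
        refine lintegral_mono fun t => ?_
        have e : modChar b h * (χ (t - h) * y (t - h)) - χ t * y t =
            χ (t - h) * (modChar b h * y (t - h) - y t) +
              ((χ (t - h) - χ t : ℝ) : ℂ) * y t := by
          push_cast
          ring
        simp only [e]
        refine (enorm_add_sq_le _ _).trans ?_
        gcongr
        · rw [enorm_mul]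
          refine mul_le_of_le_one_left' ?_
          rw [← ofReal_norm]
          exact ENNReal.ofReal_le_one.2 (hχ.norm_le_one _)
        · rw [enorm_mul, mul_pow, enorm_sq_eq_ofReal ((_ : ℝ) : ℂ)]
          gcongr
          rw [Complex.norm_real, Real.norm_eq_abs]
          refine (hχ.lipschitz _ _).trans ?_
          rw [sub_sub_cancel_left, abs_neg, abs_of_pos hh]
          exact div_le_self hh.le hR
    _ = 2 * (∫⁻ t, ‖modChar b h * y (t - h) - y t‖ₑ ^ 2) +
        2 * (ENNReal.ofReal (h ^ 2) * ∫⁻ t, ‖y t‖ₑ ^ 2) := by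
        rw [lintegral_add_right', lintegral_const_mul' _ _ ENNReal.ofNat_ne_top,
          lintegral_const_mul' _ _ ENNReal.ofNat_ne_top,
          lintegral_const_mul' _ _ ENNReal.ofReal_ne_top]
        exact ((((Lp.stronglyMeasurable y).enorm.pow_const _).const_mul _).const_mul
          _).aemeasurable
    _ ≤ 2 * ENNReal.ofReal ((C * h) ^ 2) + 2 * (ENNReal.ofReal (h ^ 2) *
        ENNReal.ofReal (C ^ 2)) := by
        refine add_le_add (mul_le_mul' le_rfl (hy.frequency h hh hh₀))
          (mul_le_mul' le_rfl (mul_le_mul' le_rfl ?_))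
        rw [lintegral_enorm_sq_eq]
        exact ENNReal.ofReal_le_ofReal (pow_le_pow_left₀ (norm_nonneg _) hy.norm_le 2)
    _ = _ := by
        have e : (2 : ENNReal) = ENNReal.ofReal 2 := by simp
        rw [← ENNReal.ofReal_mul (by positivity), e, ← ENNReal.ofReal_mul zero_le_two,
          ← ENNReal.ofReal_mul zero_le_two, ← ENNReal.ofReal_add (by positivity) (by positivity)]
        congr 1
        ring

theorem memLp_cutoff (hR : 0 < R) (hχ : IsBump χ 0 P R) (y : OutputSignal) :
    MemLp (fun t => (χ t : ℂ) * y t) 2 := by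
  refine (Lp.memLp y).of_le (AEStronglyMeasurable.mul ?_ (Lp.aestronglyMeasurable y))
    (Filter.Eventually.of_forall fun t => ?_)
  · exact (Complex.continuous_ofReal.comp (hχ.continuous hR)).aestronglyMeasurable
  · rw [norm_mul]
    exact mul_le_of_le_one_left (norm_nonneg _) (hχ.norm_le_one t)

theorem cutoff_eq_zero (hR : 0 < R) (hχ : IsBump χ 0 P R) {h : ℝ} (hh : 0 ≤ h) (hhR : h < R)
    {t : ℝ} (ht : t ∉ Ico 0 P) : χ (t - h) = 0 := by
  refine hχ.eq_zero _ fun hm => ht ⟨?_, ?_⟩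
  · linarith [hm.1]
  · linarith [hm.2]

/-- The Fourier coefficients of the cut-off of a localized signal are small away from `-b`. -/
theorem IsLocalized.sum_coeff_le (hy : IsLocalized C h₀ a b y) (hh₀ : 0 < h₀) (hP : 0 < P)
    (hR : 1 ≤ R) (hχ : IsBump χ 0 P R) (F : Finset ℤ) (hF : ∀ r ∈ F, R ≤ |b + r / P|) :
    ∑ r ∈ F, ‖∫ t in Ico 0 P, (χ t * y t) * modChar t (r / P)‖ₑ ^ 2 ≤
      ENNReal.ofReal (P * (C / (2 * R)) ^ 2) := by
  have hR0 : 0 < R := by linarith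
  set B : ℝ := 1 + ∑ r ∈ F, |b + r / P| with hB
  have hB0 : 0 < B := by positivity
  -- Small enough for the frequency estimate, for the shifted cut-off to stay in [0, P), and for the
  -- chord bound at every r in the finite set F. The factor h² cancels at the end.
  set h : ℝ := min (min h₀ R / 2) (1 / (2 * B)) with hh
  have hpos : 0 < h := by positivity
  have hm : 0 < min h₀ R := lt_min hh₀ hR0
  have hlt : h < min h₀ R := (min_le_left _ _).trans_lt (by linarith)
  have hhh₀ : h < h₀ := hlt.trans_le (min_le_left _ _)
  have hhR : h < R := hlt.trans_le (min_le_right _ _)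
  have hhF : ∀ r ∈ F, |(b + r / P) * h| ≤ 1 / 2 := by
    intro r hr
    rw [abs_mul, abs_of_pos hpos]
    have h1 : |b + r / P| ≤ B := by
      have := Finset.single_le_sum (f := fun r : ℤ => |b + r / P|) (fun _ _ => abs_nonneg _) hr
      linarith
    calc |b + r / P| * h ≤ B * (1 / (2 * B)) :=
          mul_le_mul h1 (min_le_right _ _) hpos.le hB0.le
      _ = 1 / 2 := by field_simp
  set z : ℝ → ℂ := fun t => χ t * y t with hz
  have hz2 : MemLp z 2 := memLp_cutoff hR0 hχ y
  have hz2' : MemLp (fun t => z (t - h)) 2 :=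
    hz2.comp_measurePreserving (measurePreserving_sub_right volume h)
  have hz0 : ∀ t ∉ Ico 0 P, z t = 0 := fun t ht => by
    have := cutoff_eq_zero hR0 hχ le_rfl hR0 ht
    rw [sub_zero] at this
    simp [hz, this]
  have hz0' : ∀ t ∉ Ico 0 P, z (t - h) = 0 := fun t ht => by
    simp [hz, cutoff_eq_zero hR0 hχ hpos.le hhR ht]
  have hd2 : MemLp (fun t => modChar b h * z (t - h) - z t) 2 := (hz2'.const_mul _).sub hz2
  have hzi : ∀ r : ℤ, Integrable fun t => z t * modChar t (r / P) := by
    intro r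
    have h1 := memLp_modChar_mul hz2 (r / P)
    simp_rw [mul_comm (modChar _ (r / P))] at h1
    exact integrable_of_memLp_two_of_support h1 fun ν hν => by rw [hz0 _ hν, zero_mul]
  have hzi' : ∀ r : ℤ, Integrable fun t => z (t - h) * modChar t (r / P) := by
    intro r
    have h1 := memLp_modChar_mul hz2' (r / P)
    simp_rw [mul_comm (modChar _ (r / P))] at h1
    exact integrable_of_memLp_two_of_support h1 fun ν hν => by rw [hz0' _ hν, zero_mul]
  have hshift : ∀ r : ℤ, ∫ t in Ico 0 P, z (t - h) * modChar t (r / P) =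
      modChar h (r / P) * ∫ t in Ico 0 P, z t * modChar t (r / P) := by
    intro r
    rw [setIntegral_eq_integral_of_forall_compl_eq_zero fun t ht => by rw [hz0' t ht, zero_mul],
      setIntegral_eq_integral_of_forall_compl_eq_zero fun t ht => by rw [hz0 t ht, zero_mul],
      ← integral_const_mul,
      ← integral_sub_right_eq_self (fun t => modChar h (r / P) * (z t * modChar t (r / P))) h]
    refine integral_congr_ae (Filter.Eventually.of_forall fun t => ?_)
    have : modChar t (r / P) = modChar (t - h) (r / P) * modChar h (r / P) := by
      rw [← modChar_add_left, sub_add_cancel]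
    simp only [this]
    ring
  -- A translation acts on Fourier coefficients by a phase, so coefficients with b + r/P far from 0
  -- are amplified in the small difference.
  have hcoef : ∀ r : ℤ, ∫ t in Ico 0 P, (modChar b h * z (t - h) - z t) * modChar t (r / P) =
      (modChar (b + r / P) h - 1) * ∫ t in Ico 0 P, z t * modChar t (r / P) := by
    intro r
    have e : ∀ t, (modChar b h * z (t - h) - z t) * modChar t (r / P) =
        modChar b h * (z (t - h) * modChar t (r / P)) - z t * modChar t (r / P) := fun t => by ring
    simp_rw [e]
    rw [integral_sub ((hzi' r).integrableOn.const_mul _) (hzi r).integrableOn, integral_const_mul,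
      hshift, modChar_add_left, modChar_comm h]
    ring
  have hpars := tsum_enorm_sq_integral_modChar hP (hd2.restrict (Ico 0 P))
  have h1 : ∑ r ∈ F, ENNReal.ofReal ((4 * R * h) ^ 2) *
      ‖∫ t in Ico 0 P, z t * modChar t (r / P)‖ₑ ^ 2 ≤
        ENNReal.ofReal P * ENNReal.ofReal ((2 * C * h) ^ 2) := by
    calc _ ≤ ∑ r ∈ F, ‖∫ t in Ico 0 P,
          (modChar b h * z (t - h) - z t) * modChar t (r / P)‖ₑ ^ 2 := by
          refine Finset.sum_le_sum fun r hr => ?_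
          rw [hcoef, enorm_mul, mul_pow ‖modChar (b + r / P) h - 1‖ₑ, enorm_sq_eq_ofReal (modChar _ _ - 1)]
          gcongr
          refine le_trans ?_ (le_norm_modChar_sub_one (hhF r hr))
          rw [abs_mul, abs_of_pos hpos]
          nlinarith [mul_le_mul_of_nonneg_right (hF r hr) hpos.le]
      _ ≤ ∑' r : ℤ, ‖∫ t in Ico 0 P,
          (modChar b h * z (t - h) - z t) * modChar t (r / P)‖ₑ ^ 2 := ENNReal.sum_le_tsum _
      _ ≤ _ := by
          rw [hpars]
          gcongr
          exact (setLIntegral_le_lintegral _ _).trans (hy.lintegral_cutoff_le hR hχ hpos hhh₀)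
  rw [← Finset.mul_sum] at h1
  have h3 : P * (2 * C * h) ^ 2 = (4 * R * h) ^ 2 * (P * (C / (2 * R)) ^ 2) := by
    field_simp
    ring
  rw [← ENNReal.ofReal_mul hP.le, h3, ENNReal.ofReal_mul (by positivity)] at h1
  exact (ENNReal.mul_le_mul_iff_right (by
    rw [Ne, ENNReal.ofReal_eq_zero, not_le]; positivity) ENNReal.ofReal_ne_top).1 h1

/-- A signal that is localized near `(a, b)` is close to the span of the exponentials on `[0, P)`
with frequencies near `b`, provided that `a` lies well inside `[0, P)`. -/
theorem IsLocalized.exists_approx (hy : IsLocalized C h₀ a b y) (hh₀ : 0 < h₀) (hP : 0 < P)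
    (hR : 1 ≤ R) (ha : a ∈ Icc (3 * R) (P - 3 * R)) (J : Finset ℤ)
    (hJ : ∀ n : ℤ, |b - n / P| < R → n ∈ J) :
    ∃ w ∈ Submodule.span ℂ (exponential P '' J), ‖y - w‖ ≤ C / R := by
  classical
  have hR0 : 0 < R := by linarith
  have hC := hy.nonneg
  obtain ⟨χ, hχ⟩ := exists_isBump 0 P hR0
  have hz2 := memLp_cutoff hR0 hχ y
  set z : OutputSignal := hz2.toLp _ with hz
  have hzae : z =ᵐ[volume] fun t => (χ t : ℂ) * y t := hz2.coeFn_toLp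
  have h1 : ‖y - z‖ ≤ C / (4 * R) := by
    refine le_of_sq_le_sq ?_ (by positivity)
    rw [← ENNReal.ofReal_le_ofReal_iff (by positivity), ← lintegral_enorm_sq_eq]
    refine le_trans ?_ (hy.lintegral_tail_le hh₀ hR0)
    have hm : MeasurableSet {t : ℝ | R ≤ |t - a|} :=
      measurableSet_le measurable_const (by fun_prop)
    rw [← lintegral_indicator hm]
    refine lintegral_mono_ae ?_
    filter_upwards [Lp.coeFn_sub y z, hzae] with t e1 e2
    rw [e1, Pi.sub_apply, e2]
    by_cases ht : R ≤ |t - a|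
    · rw [indicator_of_mem (by exact ht)]
      rw [show y t - χ t * y t = ((1 - χ t : ℝ) : ℂ) * y t by push_cast; ring, enorm_mul, mul_pow]
      refine mul_le_of_le_one_left' (pow_le_one₀ (by positivity) ?_)
      rw [← ofReal_norm, Complex.norm_real, Real.norm_eq_abs]
      refine ENNReal.ofReal_le_one.2 ?_
      rw [abs_le]
      constructor <;> linarith [hχ.nonneg t, hχ.le_one t]
    · rw [not_le, abs_lt] at ht
      -- Since a is at distance at least 3R from both ends, |t - a| < R puts t where the cut-off
      -- equals 1.
      rw [hχ.eq_one t ⟨by linarith [ha.1], by linarith [ha.2]⟩]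
      simp
  set Z : ℤ → ℂ := fun r => ∫ t in Ico 0 P, (χ t * y t) * modChar t (r / P) with hZ
  have hinner : ∀ n : ℤ, ‖inner ℂ (exponential P n) z‖ ^ 2 = P⁻¹ * ‖Z (-n)‖ ^ 2 := by
    intro n
    rw [inner_exponential, norm_mul, mul_pow, Complex.norm_real, Real.norm_of_nonneg (by positivity),
      inv_pow, Real.sq_sqrt hP.le]
    congr 3
    refine setIntegral_congr_ae measurableSet_Ico ?_
    filter_upwards [hzae] with t ht _
    rw [ht, modChar_comm]
    congr 2
    push_cast
    ring
  have hpars := tsum_enorm_sq_integral_modChar hP (hz2.restrict (Ico 0 P))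
  have hzn : ∫⁻ t in Ico 0 P, ‖(χ t : ℂ) * y t‖ₑ ^ 2 = ENNReal.ofReal (‖z‖ ^ 2) := by
    rw [← lintegral_enorm_sq_eq, ← lintegral_indicator measurableSet_Ico]
    refine lintegral_congr_ae ?_
    filter_upwards [hzae] with t ht
    by_cases htI : t ∈ Ico 0 P
    · rw [indicator_of_mem htI, ht]
    · have := cutoff_eq_zero hR0 hχ le_rfl hR0 htI
      rw [sub_zero] at this
      rw [indicator_of_notMem htI, ht, this]
      simp
  have hle : ∑' r : ℤ, ‖Z r‖ₑ ^ 2 ≤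
      ∑ n ∈ J, ‖Z (-n)‖ₑ ^ 2 + ENNReal.ofReal (P * (C / (2 * R)) ^ 2) := by
    rw [ENNReal.tsum_eq_iSup_sum]
    refine iSup_le fun F => ?_
    -- The coefficient Z r pairs with the exponential of frequency -r/P, hence the reflection.
    set J' : Finset ℤ := J.image Neg.neg with hJ'
    have e1 : ∑ n ∈ J, ‖Z (-n)‖ₑ ^ 2 = ∑ r ∈ J', ‖Z r‖ₑ ^ 2 := by
      rw [hJ', Finset.sum_image fun _ _ _ _ h => neg_injective h]
    rw [e1, ← Finset.sum_inter_add_sum_sdiff F J']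
    gcongr
    · exact Finset.inter_subset_right
    · refine hy.sum_coeff_le hh₀ hP hR hχ (F \ J') fun r hr => ?_
      by_contra! hlt
      refine (Finset.mem_sdiff.1 hr).2 (Finset.mem_image.2 ⟨-r, hJ _ ?_, neg_neg r⟩)
      rwa [show b - ((-r : ℤ) : ℝ) / P = b + r / P by push_cast; ring]
  rw [hpars, hzn] at hle
  have hle' : P * ‖z‖ ^ 2 ≤ ∑ n ∈ J, ‖Z (-n)‖ ^ 2 + P * (C / (2 * R)) ^ 2 := by
    simp_rw [enorm_sq_eq_ofReal] at hle
    rw [← ENNReal.ofReal_mul hP.le, ← ENNReal.ofReal_sum_of_nonneg (fun _ _ => by positivity),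
      ← ENNReal.ofReal_add (Finset.sum_nonneg fun _ _ => by positivity) (by positivity),
      ENNReal.ofReal_le_ofReal_iff (add_nonneg (Finset.sum_nonneg fun _ _ => by positivity)
        (by positivity))] at hle
    exact hle
  refine ⟨∑ n ∈ J, inner ℂ (exponential P n) z • exponential P n, ?_, ?_⟩
  · exact Submodule.sum_mem _ fun n hn => Submodule.smul_mem _ _
      (Submodule.subset_span ⟨n, hn, rfl⟩)
  have h2 : ‖z - ∑ n ∈ J, inner ℂ (exponential P n) z • exponential P n‖ ≤ C / (2 * R) := by
    refine le_of_sq_le_sq ?_ (by positivity)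
    rw [(orthonormal_exponential hP).norm_sub_sum_inner_sq]
    simp_rw [hinner]
    rw [← Finset.mul_sum, sub_le_iff_le_add]
    have := mul_le_mul_of_nonneg_left hle' (inv_nonneg.2 hP.le)
    rw [mul_add, inv_mul_cancel_left₀ hP.ne', inv_mul_cancel_left₀ hP.ne'] at this
    linarith
  calc _ = ‖(y - z) + (z - ∑ n ∈ J, inner ℂ (exponential P n) z • exponential P n)‖ := by
        congr 1; abel
    _ ≤ C / (4 * R) + C / (2 * R) := (norm_add_le _ _).trans (add_le_add h1 h2)
    _ ≤ C / R := by
        have : 0 ≤ C / R := by positivity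
        rw [show C / (4 * R) = C / R / 4 by field_simp, show C / (2 * R) = C / R / 2 by field_simp]
        linarith

end Localized

end

/-! ### Counting dimensions -/

/-- A family that is bounded below and close to a finite-dimensional subspace cannot have many more
members than the dimension of the subspace. -/
theorem card_sub_finrank_mul_le {H ι : Type*} [NormedAddCommGroup H] [InnerProductSpace ℂ H]
    [CompleteSpace H] [Fintype ι] {y w : ι → H} (W : Submodule ℂ H) [FiniteDimensional ℂ W]
    (hw : ∀ i, w i ∈ W) {κ ε : ℝ} (hκ0 : 0 ≤ κ)
    (hκ : ∀ c : ι → ℂ, κ * ∑ i, ‖c i‖ ^ 2 ≤ ‖∑ i, c i • y i‖ ^ 2)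
    (hε : ∀ i, ‖y i - w i‖ ^ 2 ≤ ε) :
    ((Fintype.card ι : ℝ) - Module.finrank ℂ W) * κ ≤ Fintype.card ι * ε := by
  classical
  let E := EuclideanSpace ℂ ι
  -- S combines the approximants and R₀ the errors. On the kernel of S the errors combine to the
  -- same vector as the y i, where the lower bound κ applies.
  let S : E →ₗ[ℂ] W := (Fintype.linearCombination ℂ fun i => (⟨w i, hw i⟩ : W)).comp
    (WithLp.linearEquiv 2 ℂ (ι → ℂ)).toLinearMap
  let R₀ : E →ₗ[ℂ] H := (Fintype.linearCombination ℂ fun i => y i - w i).comp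
    (WithLp.linearEquiv 2 ℂ (ι → ℂ)).toLinearMap
  let R : E →L[ℂ] H := LinearMap.toContinuousLinearMap R₀
  have hS : ∀ c : E, ((S c : W) : H) = ∑ i, c i • w i := by
    intro c
    simp [S, Fintype.linearCombination_apply]
    rfl
  have hR : ∀ c : E, R c = ∑ i, c i • (y i - w i) := by
    intro c
    simp [R, R₀, Fintype.linearCombination_apply]
    rfl
  let A : E →ₗ[ℂ] E := (ContinuousLinearMap.adjoint R ∘L R : E →L[ℂ] E)
  have hA : ∀ v : E, inner ℂ v (A v) = ((‖R v‖ ^ 2 : ℝ) : ℂ) := by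
    intro v
    change inner ℂ v (ContinuousLinearMap.adjoint R (R v)) = _
    rw [ContinuousLinearMap.adjoint_inner_right, inner_self_eq_norm_sq_to_K]
    norm_cast
  -- The trace of R*R is computed in two orthonormal bases: the standard one bounds it by card · ε,
  -- and one extending a basis of ker S bounds it below by dim ker S · κ.
  have htr : ∀ {κ' : Type _} [Fintype κ'] (b : OrthonormalBasis κ' ℂ E),
      LinearMap.trace ℂ E A = ((∑ i, ‖R (b i)‖ ^ 2 : ℝ) : ℂ) := by
    intro κ' _ b
    rw [LinearMap.trace_eq_sum_inner A b]
    push_cast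
    refine Finset.sum_congr rfl fun i _ => ?_
    rw [hA]
    norm_cast
  set K := LinearMap.ker S
  let b := stdOrthonormalBasis ℂ K
  have hv : Orthonormal ℂ (fun l => (b l : E)) :=
    b.orthonormal.comp_linearIsometry K.subtypeₗᵢ
  obtain ⟨u, b', hu, hb'⟩ := hv.toSubtypeRange.exists_orthonormalBasis_extension
  have h1 : ∑ x : u, ‖R (b' x)‖ ^ 2 = ∑ i, ‖R (EuclideanSpace.basisFun ι ℂ i)‖ ^ 2 := by
    have := (htr b').symm.trans (htr (EuclideanSpace.basisFun ι ℂ))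
    exact_mod_cast this
  have h2 : ∑ i, ‖R (EuclideanSpace.basisFun ι ℂ i)‖ ^ 2 ≤ Fintype.card ι * ε := by
    rw [← nsmul_eq_mul, ← Finset.card_univ]
    refine Finset.sum_le_card_nsmul _ _ _ fun i _ => ?_
    rw [hR]
    refine le_of_eq_of_le ?_ (hε i)
    congr 2
    simp
  have h3 : ∑ l, ‖R (b l : E)‖ ^ 2 ≤ ∑ x : u, ‖R (b' x)‖ ^ 2 := by
    rw [hb', Finset.sum_coe_sort u (fun x => ‖R x‖ ^ 2)]
    have hinj : Function.Injective fun l => (b l : E) := hv.linearIndependent.injective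
    rw [← Finset.sum_image (f := fun x : E => ‖R x‖ ^ 2) (g := fun l => (b l : E))
      (s := Finset.univ) fun _ _ _ _ h => hinj h]
    refine Finset.sum_le_sum_of_subset_of_nonneg (fun x hx => ?_) fun _ _ _ => by positivity
    obtain ⟨l, -, rfl⟩ := Finset.mem_image.1 hx
    exact hu ⟨l, rfl⟩
  have h4 : (Module.finrank ℂ K : ℝ) * κ ≤ ∑ l, ‖R (b l : E)‖ ^ 2 := by
    have hle := Finset.card_nsmul_le_sum Finset.univ (fun l => ‖R (b l : E)‖ ^ 2) κ fun l _ => ?_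
    · rwa [Finset.card_univ, Fintype.card_fin, nsmul_eq_mul] at hle
    have hk : ((S (b l : E) : W) : H) = 0 := by
      rw [LinearMap.mem_ker.1 (b l).2]
      rfl
    have e : R (b l : E) = ∑ i, (b l : E) i • y i := by
      rw [hR]
      simp_rw [smul_sub]
      rw [Finset.sum_sub_distrib, ← hS, hk, sub_zero]
    rw [e]
    refine le_trans ?_ (hκ fun i => (b l : E) i)
    rw [← EuclideanSpace.norm_sq_eq, show ‖(b l : E)‖ = 1 from hv.1 l]
    simp
  have h5 : (Fintype.card ι : ℝ) - Module.finrank ℂ W ≤ Module.finrank ℂ K := by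
    have e1 := LinearMap.finrank_range_add_finrank_ker S
    have e2 := Submodule.finrank_le (LinearMap.range S)
    rw [finrank_euclideanSpace] at e1
    have : Fintype.card ι ≤ Module.finrank ℂ W + Module.finrank ℂ K := by
      rw [← e1]
      exact Nat.add_le_add_right e2 _
    have : (Fintype.card ι : ℝ) ≤ Module.finrank ℂ W + Module.finrank ℂ K := by exact_mod_cast this
    linarith
  calc _ ≤ (Module.finrank ℂ K : ℝ) * κ := mul_le_mul_of_nonneg_right h5 hκ0
    _ ≤ _ := h4.trans (h3.trans (h1.trans_le h2))

/-! ### Characters on rectangles -/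

theorem modChar_lattice_integral {P : ℝ} (hP : 0 < P) (a : ℝ) (m n : ℤ) :
    ∫ t in Ico a (a + P), modChar (n / P) t * modChar (-(m / P)) t =
      if m = n then (P : ℂ) else 0 := by
  have h := integral_modChar_period hP a (n - m)
  simp_rw [← modChar_add_left]
  convert h using 2
  · ext t
    congr 1
    push_cast
    ring
  · simp only [sub_eq_zero, eq_comm]

/-- The rectangle `[a₁, a₁ + P₁) × [a₂, a₂ + P₂)`. -/
def rectangle (a₁ P₁ a₂ P₂ : ℝ) : Set (ℝ × ℝ) := Ico a₁ (a₁ + P₁) ×ˢ Ico a₂ (a₂ + P₂)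

theorem measurableSet_rectangle (a₁ P₁ a₂ P₂ : ℝ) : MeasurableSet (rectangle a₁ P₁ a₂ P₂) :=
  measurableSet_Ico.prod measurableSet_Ico

/-- The character of the plane with frequencies `(v / P₁, -u / P₂)`. -/
def planeChar (P₁ P₂ : ℝ) (k : ℤ × ℤ) (p : ℝ × ℝ) : ℂ :=
  modChar (k.2 / P₁) p.1 * modChar (-(k.1 / P₂)) p.2

theorem continuous_planeChar (P₁ P₂ : ℝ) (k : ℤ × ℤ) : Continuous (planeChar P₁ P₂ k) := by
  have c₁ : Continuous fun p : ℝ × ℝ => modChar (k.2 / P₁) p.1 :=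
    continuous_modChar.comp (by fun_prop : Continuous fun p : ℝ × ℝ => ((k.2 : ℝ) / P₁, p.1))
  have c₂ : Continuous fun p : ℝ × ℝ => modChar (-(k.1 / P₂)) p.2 :=
    continuous_modChar.comp (by fun_prop : Continuous fun p : ℝ × ℝ => (-((k.1 : ℝ) / P₂), p.2))
  exact c₁.mul c₂

theorem integral_planeChar {P₁ P₂ : ℝ} (hP₁ : 0 < P₁) (hP₂ : 0 < P₂) (a₁ a₂ : ℝ) (k l : ℤ × ℤ) :
    ∫ p in rectangle a₁ P₁ a₂ P₂, planeChar P₁ P₂ l p * (starRingEnd ℂ) (planeChar P₁ P₂ k p) =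
      if k = l then ((P₁ * P₂ : ℝ) : ℂ) else 0 := by
  have e : ∀ p : ℝ × ℝ, planeChar P₁ P₂ l p * (starRingEnd ℂ) (planeChar P₁ P₂ k p) =
      (modChar (l.2 / P₁) p.1 * modChar (-(k.2 / P₁)) p.1) *
        (modChar (k.1 / P₂) p.2 * modChar (-(l.1 / P₂)) p.2) := by
    intro p
    rw [planeChar, planeChar, map_mul, conj_modChar, conj_modChar, neg_neg]
    ring
  simp_rw [e]
  rw [rectangle, Measure.volume_eq_prod, setIntegral_prod_mul
    (fun t => modChar (l.2 / P₁) t * modChar (-(k.2 / P₁)) t)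
    (fun t => modChar (k.1 / P₂) t * modChar (-(l.1 / P₂)) t),
    modChar_lattice_integral hP₁, modChar_lattice_integral hP₂]
  by_cases h1 : k.2 = l.2 <;> by_cases h2 : l.1 = k.1
  · rw [if_pos h1, if_pos h2, if_pos (Prod.ext h2.symm h1)]
    push_cast
    rfl
  · rw [if_neg h2, if_neg fun h : k = l => h2 (by rw [h]), mul_zero]
  · rw [if_neg h1, if_neg fun h : k = l => h1 (by rw [h]), zero_mul]
  · rw [if_neg h2, if_neg fun h : k = l => h2 (by rw [h]), mul_zero]

/-- Bessel's inequality for the characters of disjoint rectangles: a combination of functions that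
agree with characters on one rectangle and vanish on the others is bounded below. -/
theorem mul_sum_le_norm_sum_sq {ι κ : Type*} [Fintype ι] [Fintype κ] {P₁ P₂ : ℝ} (hP₁ : 0 < P₁) (hP₂ : 0 < P₂)
    {a₁ a₂ : ι → ℝ} {k : κ → ℤ × ℤ} (hk : Function.Injective k)
    (hdisj : ∀ i j, i ≠ j → Disjoint (rectangle (a₁ i) P₁ (a₂ i) P₂) (rectangle (a₁ j) P₁ (a₂ j) P₂))
    {s : ι × κ → SpreadingFunction}
    (hs : ∀ i m, ∀ᵐ p, p ∈ rectangle (a₁ i) P₁ (a₂ i) P₂ → s (i, m) p = planeChar P₁ P₂ (k m) p)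
    (hs0 : ∀ i j m, i ≠ j → ∀ᵐ p, p ∈ rectangle (a₁ j) P₁ (a₂ j) P₂ → s (i, m) p = 0)
    (c : ι × κ → ℂ) :
    P₁ * P₂ * ∑ i, ‖c i‖ ^ 2 ≤ ‖∑ i, c i • s i‖ ^ 2 := by
  classical
  set Q : ι → Set (ℝ × ℝ) := fun i => rectangle (a₁ i) P₁ (a₂ i) P₂ with hQ
  have hQm : ∀ i, MeasurableSet (Q i) := fun i => measurableSet_rectangle _ _ _ _
  have hP : 0 < P₁ * P₂ := mul_pos hP₁ hP₂
  have hmem : ∀ i m, MemLp ((Q i).indicator (planeChar P₁ P₂ (k m))) 2 := by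
    intro i m
    rw [memLp_indicator_iff_restrict (hQm i)]
    have hfin : IsFiniteMeasure ((volume : Measure (ℝ × ℝ)).restrict (Q i)) := by
      refine ⟨?_⟩
      rw [Measure.restrict_apply_univ]
      change volume (Ico (a₁ i) (a₁ i + P₁) ×ˢ Ico (a₂ i) (a₂ i + P₂)) < ⊤
      rw [Measure.volume_eq_prod, Measure.prod_prod, Real.volume_Ico, Real.volume_Ico]
      exact ENNReal.mul_lt_top ENNReal.ofReal_lt_top ENNReal.ofReal_lt_top
    refine MemLp.of_bound (continuous_planeChar _ _ _).aestronglyMeasurable 1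
      (Filter.Eventually.of_forall fun p => ?_)
    rw [planeChar, norm_mul, modChar_norm, modChar_norm, one_mul]
  let e : ι × κ → SpreadingFunction := fun j => (hmem j.1 j.2).toLp _
  have hinner : ∀ (j : ι × κ) (f : SpreadingFunction), inner ℂ (e j) f =
      ∫ p in Q j.1, f p * (starRingEnd ℂ) (planeChar P₁ P₂ (k j.2) p) := by
    intro j f
    rw [L2.inner_def, ← integral_indicator (hQm _)]
    refine integral_congr_ae ?_
    filter_upwards [(hmem j.1 j.2).coeFn_toLp] with p hp
    rw [hp, RCLike.inner_apply]
    by_cases h : p ∈ Q j.1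
    · rw [indicator_of_mem h, indicator_of_mem h]
    · rw [indicator_of_notMem h, indicator_of_notMem h]
      simp
  -- Applied to e itself it gives orthogonality, and to s it gives the coefficients; the values of s
  -- off the rectangles do not matter.
  have hpair : ∀ (f : ι × κ → SpreadingFunction),
      (∀ i m, ∀ᵐ p, p ∈ Q i → f (i, m) p = planeChar P₁ P₂ (k m) p) →
      (∀ i j m, i ≠ j → ∀ᵐ p, p ∈ Q j → f (i, m) p = 0) →
      ∀ j l : ι × κ, inner ℂ (e j) (f l) = if j = l then ((P₁ * P₂ : ℝ) : ℂ) else 0 := by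
    intro f hf hf0 j l
    rw [hinner]
    by_cases h : l.1 = j.1
    · have e1 : ∫ p in Q j.1, f l p * (starRingEnd ℂ) (planeChar P₁ P₂ (k j.2) p) =
          ∫ p in Q j.1, planeChar P₁ P₂ (k l.2) p *
            (starRingEnd ℂ) (planeChar P₁ P₂ (k j.2) p) := by
        refine setIntegral_congr_ae (hQm _) ?_
        filter_upwards [hf l.1 l.2] with p hp hpQ
        rw [hp (h ▸ hpQ)]
      rw [e1, integral_planeChar hP₁ hP₂]
      refine if_congr ⟨fun h' => Prod.ext h.symm (hk h'), fun h' => by rw [h']⟩ rfl rfl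
    · rw [if_neg fun h' => h (by rw [h'])]
      have e1 : ∫ p in Q j.1, f l p * (starRingEnd ℂ) (planeChar P₁ P₂ (k j.2) p) =
          ∫ p in Q j.1, (0 : ℂ) := by
        refine setIntegral_congr_ae (hQm _) ?_
        filter_upwards [hf0 l.1 j.1 l.2 h] with p hp hpQ
        rw [hp hpQ, zero_mul]
      rw [e1, integral_zero]
  have hee := hpair e
    (fun i m => by
      filter_upwards [(hmem i m).coeFn_toLp] with p hp hpQ
      rw [hp, indicator_of_mem hpQ])
    (fun i j m hij => by
      filter_upwards [(hmem i m).coeFn_toLp] with p hp hpQ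
      rw [hp, indicator_of_notMem (Set.disjoint_right.1 (hdisj i j hij) hpQ)])
  have hes := hpair s hs hs0
  set r : ℂ := (((Real.sqrt (P₁ * P₂))⁻¹ : ℝ) : ℂ) with hr
  have hrr : r * r * ((P₁ * P₂ : ℝ) : ℂ) = 1 := by
    rw [hr]
    norm_cast
    rw [← mul_inv, Real.mul_self_sqrt hP.le, inv_mul_cancel₀ hP.ne']
  have hrn : ‖r * ((P₁ * P₂ : ℝ) : ℂ)‖ ^ 2 = P₁ * P₂ := by
    rw [hr, ← Complex.ofReal_mul, Complex.norm_real, Real.norm_eq_abs, sq_abs, mul_pow, inv_pow,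
      Real.sq_sqrt hP.le]
    field_simp
  have hon : Orthonormal ℂ fun j => r • e j := by
    rw [orthonormal_iff_ite]
    intro i j
    rw [inner_smul_left, inner_smul_right, hee, hr, Complex.conj_ofReal, ← hr, ← mul_assoc]
    split_ifs
    · exact hrr
    · rw [mul_zero]
  have hB := hon.sum_inner_products_le (∑ i, c i • s i) (s := Finset.univ)
  have hco : ∀ j, inner ℂ (r • e j) (∑ i, c i • s i) = c j * (r * ((P₁ * P₂ : ℝ) : ℂ)) := by
    intro j
    rw [inner_smul_left, inner_sum, hr, Complex.conj_ofReal, ← hr]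
    simp_rw [inner_smul_right, hes]
    simp only [mul_ite, mul_zero, Finset.sum_ite_eq, Finset.mem_univ, if_true]
    ring
  refine le_trans (le_of_eq ?_) hB
  rw [Finset.mul_sum]
  refine Finset.sum_congr rfl fun j _ => ?_
  rw [hco, norm_mul, mul_pow, hrn]
  ring

/-! ### Operators of area more than one are not identifiable -/

theorem sum_smul_mem_supportedOperators {ι : Type*} {M : Set (ℝ × ℝ)} (F : Finset ι) (c : ι → ℂ)
    {s : ι → SpreadingFunction} (hs : ∀ i, s i ∈ supportedOperators M) :
    ∑ i ∈ F, c i • s i ∈ supportedOperators M := by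
  classical
  rw [supportedOperators, mem_ofPred_eq]
  induction F using Finset.induction_on with
  | empty =>
    filter_upwards [Lp.coeFn_zero ℂ 2 (volume : Measure (ℝ × ℝ))] with p hp _
    rw [Finset.sum_empty, hp, Pi.zero_apply]
  | insert a F ha ih =>
    rw [Finset.sum_insert ha]
    have hsa := hs a
    rw [supportedOperators, mem_ofPred_eq] at hsa
    filter_upwards [ih, hsa, Lp.coeFn_smul (c a) (s a),
      Lp.coeFn_add (c a • s a) (∑ i ∈ F, c i • s i)] with p h1 h2 h3 h4 hp
    rw [h4, Pi.add_apply, h3, Pi.smul_apply, h2 hp, h1 hp, smul_zero, add_zero]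

/-- The leading coefficients are compared as n grows; A, B and the constant 1 are boundary effects
of lower order. -/
theorem le_of_forall_quadratic {κ γ A B : ℝ} (hγ : 0 < γ) (hA : 0 ≤ A) (hB : 0 ≤ B)
    (h : ∀ n : ℕ, 1 ≤ n → κ * (n : ℝ) ^ 2 ≤ γ * ((n + A) * (n + B)) + 1) : κ ≤ γ := by
  by_contra! hlt
  set D := γ * (A + B) + γ * A * B + 1 with hD
  have hD0 : 0 < D := by positivity
  obtain ⟨n, hn⟩ := exists_nat_gt (D / (κ - γ))
  have hpos : 0 < κ - γ := by linarith
  have hn0 : (0 : ℝ) < n := (div_pos hD0 hpos).trans hn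
  have hn1 : 1 ≤ n := by exact_mod_cast hn0
  have hn1' : (1 : ℝ) ≤ n := by exact_mod_cast hn1
  rw [div_lt_iff₀ hpos] at hn
  have h1 := h n hn1
  have h2 : (κ - γ) * (n : ℝ) ^ 2 ≤ D * n := by
    have h3 : 0 ≤ (γ * A * B + 1) * (n - 1) := mul_nonneg (by positivity) (by linarith)
    rw [hD]
    nlinarith
  nlinarith

/-- The span of finitely many exponentials has at most as many dimensions. -/
theorem finrank_span_exponential_le {P : ℝ} (J : Finset ℤ) :
    Module.finrank ℂ (Submodule.span ℂ (exponential P '' J)) ≤ J.card := by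
  classical
  rw [← Finset.coe_image]
  exact (finrank_span_finset_le_card _).trans Finset.card_image_le

theorem card_Icc_ceil_floor_le {a b : ℝ} (h : a ≤ b) :
    ((Finset.Icc ⌈a⌉ ⌊b⌋).card : ℝ) ≤ b - a + 1 := by
  rw [Int.card_Icc]
  have h1 := Int.floor_le b
  have h2 := Int.le_ceil a
  rcases le_or_gt 0 (⌊b⌋ + 1 - ⌈a⌉) with h0 | h0
  · have : (((⌊b⌋ + 1 - ⌈a⌉).toNat : ℤ) : ℝ) = ((⌊b⌋ + 1 - ⌈a⌉ : ℤ) : ℝ) := by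
      rw [Int.toNat_of_nonneg h0]
    rw [Int.cast_natCast] at this
    rw [this]
    push_cast
    linarith
  · rw [Int.toNat_of_nonpos h0.le]
    push_cast
    linarith

/-- A density count in a growing time-frequency box: the L + 1 cells supply (L + 1)n² responses with
a uniform lower Riesz bound, all close to a space of dimension γn² + O(n). -/
theorem not_boundedResponses {T : ℝ} (hT : 0 < T) {L : ℕ} (hL : 1 ≤ L) {α β : ℝ} (hα : 0 < α)
    (hβ : 0 < β) {U : Finset (Fin L × Fin L)} (hU : U.card = L + 1) {x : 𝓢'(ℝ, ℂ)}
    (hbd : BoundedResponses x α β (supportedOperators (region T L U))) : False := by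
  classical
  have hL' : (0 : ℝ) < L := by exact_mod_cast hL
  set l : ℝ := 1 / (T * L) with hl
  have hl0 : 0 < l := by positivity
  -- The bumps lose the fraction 4ρ of each side of a cell. With this ρ, (1 - 4ρ)² (L + 1) > L, so γ
  -- = L / (1 - 4ρ)² stays below L + 1.
  set ρ : ℝ := 1 / (16 * (L + 1)) with hρ
  have hρ0 : 0 < ρ := by positivity
  have hρL : 16 * (L + 1) * ρ = 1 := by rw [hρ]; field_simp
  have hρ1 : 16 * ρ ≤ 1 := by nlinarith
  set P₁ : ℝ := (1 - 4 * ρ) * T with hP₁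
  set P₂ : ℝ := (1 - 4 * ρ) * l with hP₂
  have hP₁0 : 0 < P₁ := mul_pos (by linarith) hT
  have hP₂0 : 0 < P₂ := mul_pos (by linarith) hl0
  set δ₁ : ℝ := ρ * T with hδ₁
  set δ₂ : ℝ := ρ * l with hδ₂
  have hδ₁0 : 0 < δ₁ := mul_pos hρ0 hT
  have hδ₂0 : 0 < δ₂ := mul_pos hρ0 hl0
  set A₁ : U → ℝ := fun i => ((i.1.1 : ℕ) : ℝ) * T with hA₁
  set A₂ : U → ℝ := fun i => ((i.1.2 : ℕ) : ℝ) * l with hA₂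
  have hcell : ∀ i : U, cell T L i.1.1 i.1.2 =
      Ico (A₁ i) (A₁ i + T) ×ˢ Ico (A₂ i) (A₂ i + l) := by
    intro i
    rw [cell]
    congr 2
    · simp only [hA₁]; ring
    · simp only [hA₂, hl]; ring
    · simp only [hA₂, hl]; ring
  choose ψ₁ hψ₁ using fun i : U => exists_isBump (A₁ i) (A₁ i + T) hδ₁0
  choose ψ₂ hψ₂ using fun i : U => exists_isBump (A₂ i) (A₂ i + l) hδ₂0
  have hsub : ∀ i : U, Ico (A₁ i) (A₁ i + T) ×ˢ Ico (A₂ i) (A₂ i + l) ⊆ region T L U := by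
    intro i p hp
    rw [← hcell] at hp
    exact mem_region.2 ⟨i.1, i.2, hp⟩
  choose C₀ h₀ hh₀ hloc using fun i : U =>
    exists_isLocalized hβ hbd (hψ₁ i) (hψ₂ i) hδ₁0 hδ₂0 (hsub i)
  set C : ℝ := ∑ i, |C₀ i| with hC
  have hCi : ∀ i, C₀ i ≤ C := fun i => (le_abs_self _).trans
    (Finset.single_le_sum (f := fun i => |C₀ i|) (fun _ _ => abs_nonneg _) (Finset.mem_univ i))
  have hC0 : 0 ≤ C := Finset.sum_nonneg fun _ _ => abs_nonneg _
  have hatom0 : ∀ (i : U) (a b : ℝ) (p : ℝ × ℝ), p ∉ cell T L i.1.1 i.1.2 →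
      atom (ψ₁ i) (ψ₂ i) a b p = 0 := by
    intro i a b p hp
    refine atom_eq_zero (hψ₁ i) (hψ₂ i) a b fun h => hp ?_
    rw [hcell]
    rw [mem_prod, mem_Icc, mem_Icc] at h
    exact ⟨⟨by linarith [h.1.1], by linarith [h.1.2]⟩, ⟨by linarith [h.2.1], by linarith [h.2.2]⟩⟩
  set κ : ℝ := α ^ 2 * (P₁ * P₂) with hκ
  have hκ0 : 0 < κ := by positivity
  set γ : ℝ := 1 / (P₁ * P₂) with hγ
  have hγ0 : 0 < γ := by positivity
  have hγL : γ < L + 1 := by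
    have e : P₁ * P₂ = (1 - 4 * ρ) ^ 2 / L := by
      rw [hP₁, hP₂, hl]
      field_simp
    rw [hγ, e, one_div_div, div_lt_iff₀ (by nlinarith)]
    nlinarith [sq_nonneg ρ]
  -- The tolerated relative error: (L + 1)(1 - τ) is the midpoint of γ and L + 1. R is then chosen
  -- so that the approximation error squared is at most κτ.
  set τ : ℝ := (L + 1 - γ) / (2 * (L + 1)) with hτ
  have hτ0 : 0 < τ := div_pos (by linarith) (by positivity)
  obtain ⟨N, hN⟩ := exists_nat_gt (C ^ 2 / (κ * τ))
  set R : ℝ := N + 1 with hR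
  have hR1 : 1 ≤ R := by rw [hR]; linarith [(Nat.cast_nonneg N : (0 : ℝ) ≤ N)]
  have hCR : (C / R) ^ 2 ≤ κ * τ := by
    rw [div_pow, div_le_iff₀ (by positivity)]
    rw [div_lt_iff₀ (by positivity)] at hN
    have h1 : (N : ℝ) ≤ R ^ 2 := by rw [hR]; nlinarith [(Nat.cast_nonneg N : (0 : ℝ) ≤ N)]
    nlinarith [mul_le_mul_of_nonneg_right h1 (mul_pos hκ0 hτ0).le]
  -- An offset of u₀ lattice steps at each end of [0, P) keeps all times a at distance at least 3R
  -- from the ends; it does not grow with n.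
  obtain ⟨u₀, hu₀⟩ := exists_nat_ge (3 * R * P₂)
  have key : ∀ n : ℕ, 1 ≤ n → ((L + 1) * (1 - τ)) * (n : ℝ) ^ 2 ≤
      γ * ((n + 2 * R * P₁) * (n + 2 * u₀)) + 1 := by
    intro n hn
    have hn0 : (0 : ℝ) < n := by exact_mod_cast hn
    set P : ℝ := (n + 2 * u₀) / P₂ with hP
    have hP0 : 0 < P := by positivity
    let k : Fin n × Fin n → ℤ × ℤ := fun j => ((u₀ : ℤ) + (j.1 : ℕ), ((j.2 : ℕ) : ℤ))
    have hk : Function.Injective k := by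
      intro j j' hjj
      simp only [k, Prod.mk.injEq, add_right_inj, Nat.cast_inj] at hjj
      exact Prod.ext (Fin.ext hjj.1) (Fin.ext hjj.2)
    let fa : Fin n × Fin n → ℝ := fun j => (k j).1 / P₂
    let fb : Fin n × Fin n → ℝ := fun j => (k j).2 / P₁
    let s : U × (Fin n × Fin n) → SpreadingFunction := fun j =>
      (memLp_atom (hψ₁ j.1) (hψ₂ j.1) hδ₁0 hδ₂0 (fa j.2) (fb j.2)).toLp _
    have hs : ∀ j, s j =ᵐ[volume] atom (ψ₁ j.1) (ψ₂ j.1) (fa j.2) (fb j.2) := fun j =>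
      MemLp.coeFn_toLp _
    have hsupp : ∀ j, s j ∈ supportedOperators (region T L U) := by
      intro j
      rw [supportedOperators, mem_ofPred_eq]
      filter_upwards [hs j] with p hp hpM
      rw [hp]
      exact hatom0 _ _ _ _ fun h => hpM (mem_region.2 ⟨j.1.1, j.1.2, h⟩)
    choose y hy _ _ using fun j => hbd (s j) (hsupp j)
    set a₁ : U → ℝ := fun i => A₁ i + 2 * δ₁ with ha₁
    set a₂ : U → ℝ := fun i => A₂ i + 2 * δ₂ with ha₂
    have hrect : ∀ (i : U) (p : ℝ × ℝ), p ∈ rectangle (a₁ i) P₁ (a₂ i) P₂ →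
        p.1 ∈ Icc (A₁ i + 2 * δ₁) (A₁ i + T - 2 * δ₁) ∧
        p.2 ∈ Icc (A₂ i + 2 * δ₂) (A₂ i + l - 2 * δ₂) := by
      intro i p hp
      rw [rectangle, mem_prod, mem_Ico, mem_Ico] at hp
      refine ⟨⟨hp.1.1, ?_⟩, ⟨hp.2.1, ?_⟩⟩
      · have := hp.1.2
        simp only [ha₁, hP₁, hδ₁] at this ⊢
        linarith
      · have := hp.2.2
        simp only [ha₂, hP₂, hδ₂] at this ⊢
        linarith
    have hrc : ∀ (i : U), rectangle (a₁ i) P₁ (a₂ i) P₂ ⊆ cell T L i.1.1 i.1.2 := by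
      intro i p hp
      obtain ⟨h1, h2⟩ := hrect i p hp
      rw [hcell]
      exact ⟨⟨by linarith [h1.1], by linarith [h1.2]⟩, ⟨by linarith [h2.1], by linarith [h2.2]⟩⟩
    have hdc : ∀ i j : U, i ≠ j → Disjoint (cell T L i.1.1 i.1.2) (cell T L j.1.1 j.1.2) :=
      fun i j hij => cell_disjoint hT hL fun h => hij (Subtype.ext h)
    have hlower : ∀ c : U × (Fin n × Fin n) → ℂ,
        κ * ∑ j, ‖c j‖ ^ 2 ≤ ‖∑ j, c j • y j‖ ^ 2 := by
      intro c
      have h1 := mul_sum_le_norm_sum_sq hP₁0 hP₂0 hk (a₁ := a₁) (a₂ := a₂) (s := s)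
        (fun i j hij => (hdc i j hij).mono (hrc i) (hrc j))
        (fun i m => by
          filter_upwards [hs (i, m)] with p hp hpQ
          obtain ⟨h1, h2⟩ := hrect i p hpQ
          rw [hp, atom, (hψ₁ i).eq_one _ h1, (hψ₂ i).eq_one _ h2, planeChar]
          simp [fa, fb])
        (fun i j m hij => by
          filter_upwards [hs (i, m)] with p hp hpQ
          rw [hp]
          exact hatom0 _ _ _ _ (Set.disjoint_right.1 (hdc i j hij) (hrc j hpQ))) c
      obtain ⟨z, hz, hzα, -⟩ := hbd _ (sum_smul_mem_supportedOperators Finset.univ c hsupp)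
      have hz' := hz.unique (IsResponse.sum Finset.univ fun j _ => (hy j).const_smul (c j))
      rw [← hz']
      have h2 := pow_le_pow_left₀ (by positivity) hzα 2
      rw [mul_pow] at h2
      refine le_trans ?_ h2
      rw [hκ, mul_assoc]
      exact mul_le_mul_of_nonneg_left h1 (by positivity)
    -- All indices whose frequencies lie within R of [0, n / P₁], the range containing every b.
    set J : Finset ℤ := Finset.Icc ⌈-R * P⌉ ⌊(n / P₁ + R) * P⌋ with hJ
    have happ : ∀ j, ∃ w ∈ Submodule.span ℂ (exponential P '' J), ‖y j - w‖ ≤ C / R := by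
      intro j
      have hv : ((j.2.2 : ℕ) : ℝ) ≤ n := by exact_mod_cast j.2.2.2.le
      have hu : ((j.2.1 : ℕ) : ℝ) ≤ n := by exact_mod_cast j.2.1.2.le
      have hfb0 : 0 ≤ fb j.2 := by
        simp only [fb, k]
        positivity
      have hfb1 : fb j.2 ≤ n / P₁ := by
        simp only [fb, k, Int.cast_natCast]
        gcongr
      have hu₀' : 3 * R ≤ u₀ / P₂ := by rwa [le_div_iff₀ hP₂0]
      have hfa0 : 3 * R ≤ fa j.2 := by
        refine hu₀'.trans ?_
        simp only [fa, k]
        push_cast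
        gcongr
        linarith [(Nat.cast_nonneg (j.2.1 : ℕ) : (0 : ℝ) ≤ _)]
      have hfa1 : fa j.2 ≤ P - 3 * R := by
        have h1 : fa j.2 ≤ P - u₀ / P₂ := by
          simp only [fa, k, hP]
          push_cast
          rw [← sub_div]
          gcongr
          linarith
        linarith
      obtain ⟨w, hw, hyw⟩ := (hloc j.1 (fa j.2) (fb j.2) (s j) (y j) (hs j) (hy j)).exists_approx
        (hh₀ j.1) hP0 hR1 ⟨hfa0, hfa1⟩ J (fun m hm => by
          rw [abs_lt] at hm
          have h1 : -R ≤ m / P := by linarith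
          have h2 : m / P ≤ n / P₁ + R := by linarith
          rw [le_div_iff₀ hP0] at h1
          rw [div_le_iff₀ hP0] at h2
          exact Finset.mem_Icc.2 ⟨Int.ceil_le.2 h1, Int.le_floor.2 h2⟩)
      exact ⟨w, hw, hyw.trans (by gcongr; exact hCi _)⟩
    choose w hw hyw using happ
    have hfd : FiniteDimensional ℂ (Submodule.span ℂ (exponential P '' (J : Set ℤ))) :=
      FiniteDimensional.span_of_finite ℂ (J.finite_toSet.image _)
    have hcount := card_sub_finrank_mul_le _ hw hκ0.le hlower (ε := κ * τ) fun j =>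
      (pow_le_pow_left₀ (norm_nonneg _) (hyw j) 2).trans hCR
    have hcard : (Fintype.card (U × (Fin n × Fin n)) : ℝ) = (L + 1) * (n : ℝ) ^ 2 := by
      rw [Fintype.card_prod, Fintype.card_prod, Fintype.card_coe, hU, Fintype.card_fin]
      push_cast
      ring
    have hdim : (Module.finrank ℂ (Submodule.span ℂ (exponential P '' (J : Set ℤ))) : ℝ) ≤
        γ * ((n + 2 * R * P₁) * (n + 2 * u₀)) + 1 := by
      have h1 : (Module.finrank ℂ (Submodule.span ℂ (exponential P '' (J : Set ℤ))) : ℝ) ≤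
          J.card := by exact_mod_cast finrank_span_exponential_le J
      refine h1.trans ((card_Icc_ceil_floor_le ?_).trans (le_of_eq ?_))
      · have : 0 ≤ n / P₁ * P + 2 * (R * P) := by positivity
        linarith
      · rw [hγ, hP]
        field_simp
        ring
    rw [hcard] at hcount
    have h3 : ((L + 1) * (n : ℝ) ^ 2 -
        Module.finrank ℂ (Submodule.span ℂ (exponential P '' (J : Set ℤ)))) * κ ≤
          ((L + 1) * (n : ℝ) ^ 2 * τ) * κ := hcount.trans_eq (by ring)
    have h4 := le_of_mul_le_mul_right h3 hκ0
    linarith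
  have hfin := le_of_forall_quadratic hγ0 (by positivity) (by positivity) key
  have : (L + 1 : ℝ) * τ = (L + 1 - γ) / 2 := by
    rw [hτ]
    field_simp
  linarith

end OperatorIdentification

end

open OperatorIdentification in
theorem theorem2 (T : ℝ) (hT : 0 < T) (L : ℕ) (hL : 1 ≤ L) (Δ : ℝ) :
    (2 ≤ L →
      (1 / 2 < Δ → ∃ Γ : Finset (Fin L × Fin L), 1 / 2 < area T L Γ ∧ area T L Γ ≤ Δ) →
      (StablyIdentifiable (blindOperators T L Δ) ↔ Δ ≤ 1 / 2)) ∧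
    (Δ ≤ 1 / 2 → ∃ (c : ℤ → ℂ) (x : 𝓢'(ℝ, ℂ)), (∀ k : ℤ, c (k + L) = c k) ∧
      IsDiracTrain T c x ∧ StablyIdentifies x (blindOperators T L Δ)) := by
  refine ⟨fun hL2 hΓ => ⟨?_, fun hΔ => ?_⟩, exists_diracTrain_stablyIdentifies hT hL⟩
  · rintro ⟨x, hx⟩
    by_contra! hΔ
    obtain ⟨Γ, h1, h2⟩ := hΓ hΔ
    obtain ⟨α, β, U, hα, hβ, hU, hbd⟩ := boundedResponses_of_stablyIdentifies hT hL2 h1 h2 hx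
    exact not_boundedResponses hT hL hα hβ hU hbd
  · obtain ⟨c, x, -, -, hx⟩ := exists_diracTrain_stablyIdentifies hT hL hΔ
    exact ⟨x, hx⟩
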